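/- **Setting.** Let $\Bbbk$ be an algebraically closed field of arbitrary characteristic, and let $V=V_{\bar 0}\oplus V_{\bar 1}$ be a finite dimensional super vector space with homogeneous basis $(e_i)_{i\in I}$, $[i]:=|e_i|\in\mathbb Z/2$, and super dimension $\mathrm{sdim}V=\dim V_{\bar0}-\dim V_{\bar1}$. An even (resp. odd) form on $V$ is a nondegenerate bilinear form $\langle\cdot,\cdot\rangle$ with $\langle u,v\rangle=(-1)^{|u||v|}\langle v,u\rangle$ for homogeneous $u,v$, and with $\langle u,v\rangle=0$ if $|u|+|v|=\bar1$ (resp. if $|u|+|v|=\bar0$). Super algebras are commutative if $xy=(-1)^{|x||y|}yx$ for homogeneous $x,y$. Tensor products of super algebras are taken with $(a\otimes b)(c\otimes d)=(-1)^{|b||c|}ac\otimes bd$. **Super groups.** $\mathcal O[\mathsf{GL}(V)]$ is the commutative super algebra generated by $X_{ij},Z_{ij}$ ($i,j\in I$) of parity $[i]+[j]$ with relations $\sum_jZ_{ij}X_{jl}=\delta_{il}$, with $\Delta(X_{ij})=\sum_lX_{il}\otimes X_{lj}$, $\Delta(Z_{jl})=\sum_m(-1)^{([j]+[m])([m]+[l])}Z_{ml}\otimes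 Z_{jm}$ and $\varepsilon(X_{ij})=\varepsilon(Z_{ij})=\delta_{ij}$. For an even (resp. odd) form with $g_{ij}=\langle e_i,e_j\rangle$, the bialgebra $\mathcal O[\mathsf{OSp}(V)]$ (resp. $\mathcal O[\mathsf{Pe}(V)]$) is its quotient by the relations $\sum_{a,b}(-1)^{[b]([a]+[i])}X_{ai}g_{ab}X_{bj}=g_{ij}$. For an odd endomorphism $q$ of $V$ with $q^2=\mathrm{id}$ and matrix $Q$, that is, $q(e_i)=\sum_jQ_{ji}e_j$, the bialgebra $\mathcal O[\mathsf Q(V)]$ is the quotient of $\mathcal O[\mathsf{GL}(V)]$ by the relations $\sum_jX_{ij}Q_{jl}=\sum_jQ_{ij}X_{jl}$. These super groups act on $V$ by $e_i\mapsto\sum_je_j\otimes X_{ji}$, and on $V^*$ by $e_i^*\mapsto\sum_je_j^*\otimes(-1)^{[j]([i]+[j])}Z_{ij}$. They act on tensor products as follows: if $e_b\mapsto\sum_ae_a\otimes c_{ab}$ and $w\mapsto\sum_iw_i\otimes d_i$, then $e_b\otimes w\mapsto\sum_{a,i}(-1)^{|c_{ab}||w_i|}(e_a\otimes w_i)\otimes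 c_{ab}d_i$. For $\alpha\in M^*$ and $v$ in a comodule $M$ with coaction $\rho$, let $[\alpha|v]:=(\alpha\otimes\mathrm{id})\rho(v)\in\mathcal O[\mathsf G]$. **Diagram categories.** These are the strict symmetric monoidal super categories, linear over $\Bbbk$, with the following generators and relations ($s$ denotes the symmetric braiding, which is even). 1. The Brauer category $\mathcal B(\delta)$: objects $[n]=[1]^{\otimes n}$, even generators $\cap:[2]\to[0]$ and $\cup:[0]\to[2]$, relations $\cap s=\cap$, $s\cup=\cup$, $(\cap\otimes1)(1\otimes\cup)=1=(1\otimes\cap)(\cup\otimes1)$, $\cap\cup=\delta$. 2. The oriented Brauer category $\mathcal{OB}(\delta)$: objects the words in $\vee,\wedge$, even generators $\mathrm{ev}:\wedge\vee\to\mathbb 1$ and $\mathrm{coev}:\mathbb 1\to\vee\wedge$, relations $(1\otimes\mathrm{ev})(\mathrm{coev}\otimes1)=1_\vee$, $(\mathrm{ev}\otimes1)(1\otimes\mathrm{coev})=1_\wedge$, $\mathrm{ev}\,s\,\mathrm{coev}=\delta$. 3. The periplectic Brauer category $\mathcal A$: objects $[n]=[1]^{\otimes n}$, odd generators $\cap:[2]\to[0]$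 and $\cup:[0]\to[2]$, relations $\cap s=\cap$, $s\cup=-\cup$, $(\cap\otimes1)(1\otimes\cup)=1=-(1\otimes\cap)(\cup\otimes1)$, $\cap\cup=0$. 4. The oriented Brauer–Clifford category $\mathcal{OBC}$: generators and relations of $\mathcal{OB}(0)$, and in addition an odd endomorphism $\widetilde q$ of $\vee$ with $\widetilde q^2=1$ and $\mathrm{ev}\,s\,(\widetilde q\otimes1)\,\mathrm{coev}=0$. **Functors.** Consider the following monoidal super functors $\mathbf A\to\underline{\mathrm{Rep}}\,\mathsf G$. 1. $\mathcal B(\mathrm{sdim}V)\to\mathrm{Rep}\,\mathsf{OSp}(V)$ for $V$ with an even form: $[1]\mapsto V$, $\cap\mapsto\langle\cdot,\cdot\rangle$. 2. $\mathcal{OB}(\mathrm{sdim}V)\to\mathrm{Rep}\,\mathsf{GL}(V)$: $\vee\mapsto V$, $\wedge\mapsto V^*$, $\mathrm{ev}\mapsto(\alpha\otimes v\mapsto\alpha(v))$, $\mathrm{coev}\mapsto\sum_ie_i\otimes e_i^*$. 3. $\mathcal A\to\underline{\mathrm{Rep}}\,\mathsf{Pe}(V)$ for $V$ with an odd form: $[1]\mapsto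 V$, $\cap\mapsto\langle\cdot,\cdot\rangle$. 4. $\mathcal{OBC}\to\underline{\mathrm{Rep}}\,\mathsf Q(V)$ for $V$ with an odd endomorphism $q$ with $q^2=\mathrm{id}$: as in 2., and $\widetilde q\mapsto q$. (In 1. and 3. the image of $\cup$ is determined by that of $\cap$.) Let $F$ be the composite with the forgetful functor to finite dimensional super vector spaces. **Centraliser coalgebra.** Let $$\underline{\mathrm{CEnd}}_{\mathbf A}(F)=\Big(\bigoplus_{X\in\mathrm{Ob}\mathbf A}F(X)^*\otimes F(X)\Big)\Big/\mathrm{span}\{\alpha F(f)\otimes v-\alpha\otimes F(f)(v)\},$$ where $f$ runs over the morphisms $X\to Y$ of $\mathbf A$, $\alpha\in F(Y)^*$ and $v\in F(X)$. It is a super bialgebra with $\varepsilon(\alpha\otimes v)=\alpha(v)$, $\Delta(\alpha\otimes v)=\sum_i(\alpha\otimes f_i)\otimes(f_i^*\otimes v)$ for a basis $(f_i)$ of $F(X)$, product $(\alpha\otimes v)(\beta\otimes w)=(-1)^{|v||\beta|}(\alpha\otimes\beta)\otimes(v\otimes w)$, where $(\alpha\otimes\beta)(v\otimes w)=(-1)^{|\beta||v|}\alpha(v)\beta(w)$,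 and unit the class of $1^*\otimes1\in F(\mathbb 1)^*\otimes F(\mathbb 1)$. **Theorem.** For each of the four functors, the assignment $\alpha\otimes v\mapsto[\alpha|v]$ yields a well defined isomorphism of super bialgebras $$\phi:\ \underline{\mathrm{CEnd}}_{\mathbf A}(F)\ \xrightarrow{\ \sim\ }\ \mathcal O[\mathsf G],$$ that is, $\phi$ is bijective and compatible with parity, product, unit, coproduct and counit. -/

import Mathlib

open scoped TensorProduct DirectSum

set_option linter.unusedSectionVars false

noncomputable section

namespace SuperBrauer

universe u v w

/-! ## Signs -/

/-- The sign `(-1)^a` in `k`, for a parity `a`. -/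
def sgn (k : Type u) [Field k] (a : ZMod 2) : k := if a = 0 then 1 else -1

section Signs

variable (k : Type u) [Field k]

theorem sgn_zero : sgn k 0 = 1 := rfl

theorem sgn_one : sgn k 1 = -1 := if_neg (by decide)

theorem parity_cases (a : ZMod 2) : a = 0 ∨ a = 1 := by
  revert a; decide

theorem sgn_add (a b : ZMod 2) : sgn k (a + b) = sgn k a * sgn k b := by
  have h : (1 + 1 : ZMod 2) = 0 := rfl
  rcases parity_cases a with rfl | rfl <;> rcases parity_cases b with rfl | rfl <;>
    simp [sgn_zero, sgn_one, h]

theorem sgn_mul_self (a : ZMod 2) : sgn k a * sgn k a = 1 := by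
  rw [← sgn_add, CharTwo.add_self_eq_zero, sgn_zero]

theorem units_smul_eq_sgn {M : Type v} [AddCommGroup M] [Module k M] (a : ZMod 2) (x : M) :
    ((-1 : ℤˣ) ^ a) • x = sgn k a • x := by
  rcases parity_cases a with rfl | rfl
  · simp [sgn_zero]
  · rw [uzpow_one, sgn_one]
    simp

end Signs

/-! ## Commutative super algebras given by generators and relations -/

section SuperPres

variable {k : Type u} [Field k]

/-- The part of parity `i` of the free algebra on generators with prescribed parities:
the span of all words of total parity `i`. -/
def freeGr {T : Type v} (par : T → ZMod 2) (i : ZMod 2) : Submodule k (FreeAlgebra k T) :=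
  Submodule.span k {x | ∃ l : List T, (l.map par).sum = i ∧ x = (l.map (FreeAlgebra.ι k)).prod}

/-- A presentation of a commutative super algebra, on generators with given parities, by
homogeneous relators. -/
structure SuperPres (k : Type u) [Field k] {T : Type v} (par : T → ZMod 2) where
  rel : Set (FreeAlgebra k T)
  homog : ∀ r ∈ rel, ∃ i, r ∈ freeGr par i

namespace SuperPres

variable {T : Type v} {par : T → ZMod 2} (P : SuperPres k par)

/-- Super commutativity of the generators, and the relators. -/
inductive Rel : FreeAlgebra k T → FreeAlgebra k T → Prop
  | comm (s t : T) : Rel (FreeAlgebra.ι k s * FreeAlgebra.ι k t)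
      (sgn k (par s * par t) • (FreeAlgebra.ι k t * FreeAlgebra.ι k s))
  | relator (r : FreeAlgebra k T) (hr : r ∈ P.rel) : Rel r 0

/-- The commutative super algebra with the given presentation. -/
def Alg : Type (max u v) := RingQuot P.Rel

instance : Ring P.Alg := inferInstanceAs (Ring (RingQuot P.Rel))
instance : Algebra k P.Alg := inferInstanceAs (Algebra k (RingQuot P.Rel))

/-- The quotient map from the free algebra. -/
def quo : FreeAlgebra k T →ₐ[k] P.Alg := RingQuot.mkAlgHom k P.Rel

/-- The generators of the algebra. -/
def gen (t : T) : P.Alg := P.quo (FreeAlgebra.ι k t)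

theorem quo_surjective : Function.Surjective P.quo := RingQuot.mkAlgHom_surjective k P.Rel

theorem quo_rel {r : FreeAlgebra k T} (hr : r ∈ P.rel) : P.quo r = 0 :=
  (RingQuot.mkAlgHom_rel k (Rel.relator r hr)).trans (map_zero _)

theorem gen_comm (s t : T) :
    P.gen s * P.gen t = sgn k (par s * par t) • (P.gen t * P.gen s) := by
  have := RingQuot.mkAlgHom_rel k (Rel.comm (P := P) s t)
  rw [map_mul, map_smul, map_mul] at this
  exact this

/-- The universal property. -/
def lift {B : Type w} [Ring B] [Algebra k B] (f : T → B)
    (hcomm : ∀ s t, f s * f t = sgn k (par s * par t) • (f t * f s))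
    (hrel : ∀ r ∈ P.rel, FreeAlgebra.lift k f r = 0) : P.Alg →ₐ[k] B :=
  RingQuot.liftAlgHom k ⟨FreeAlgebra.lift k f, fun x y h => by
    cases h with
    | comm s t => simpa using hcomm s t
    | relator _ hr => rw [hrel _ hr, map_zero]⟩

theorem lift_quo {B : Type w} [Ring B] [Algebra k B] (f : T → B) (h₁) (h₂)
    (x : FreeAlgebra k T) : P.lift f h₁ h₂ (P.quo x) = FreeAlgebra.lift k f x :=
  RingQuot.liftAlgHom_mkAlgHom_apply k _ _ _

theorem lift_gen {B : Type w} [Ring B] [Algebra k B] (f : T → B) (h₁) (h₂)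
    (t : T) : P.lift f h₁ h₂ (P.gen t) = f t := by
  rw [gen, lift_quo, FreeAlgebra.lift_ι_apply]

/-- The part of parity `i`. -/
def gr (i : ZMod 2) : Submodule k P.Alg := (freeGr par i).map P.quo.toLinearMap

theorem word_mem_gr (l : List T) : (l.map P.gen).prod ∈ P.gr (l.map par).sum := by
  refine ⟨_, Submodule.subset_span ⟨l, rfl, rfl⟩, ?_⟩
  simp only [AlgHom.toLinearMap_apply, map_list_prod, List.map_map]
  rfl

theorem gen_mem_gr (t : T) : P.gen t ∈ P.gr (par t) := by
  simpa using P.word_mem_gr [t]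

theorem gr_eq_span (i : ZMod 2) : P.gr i =
    Submodule.span k {x | ∃ l : List T, (l.map par).sum = i ∧ x = (l.map P.gen).prod} := by
  rw [gr, freeGr, Submodule.map_span]
  congr 1
  ext x
  constructor
  · rintro ⟨_, ⟨l, hl, rfl⟩, rfl⟩
    refine ⟨l, hl, ?_⟩
    simp only [AlgHom.toLinearMap_apply, map_list_prod, List.map_map]
    rfl
  · rintro ⟨l, hl, rfl⟩
    refine ⟨_, ⟨l, hl, rfl⟩, ?_⟩
    simp only [AlgHom.toLinearMap_apply, map_list_prod, List.map_map]
    rfl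

instance : SetLike.GradedMonoid P.gr where
  one_mem := by simpa using P.word_mem_gr []
  mul_mem i j a b ha hb := by
    rw [gr_eq_span] at ha hb
    induction ha using Submodule.span_induction with
    | mem x hx =>
      obtain ⟨l, hl, rfl⟩ := hx
      induction hb using Submodule.span_induction with
      | mem y hy =>
        obtain ⟨m, hm, rfl⟩ := hy
        have := P.word_mem_gr (l ++ m)
        simpa [hl, hm] using this
      | zero => simp
      | add y z _ _ hy hz => rw [mul_add]; exact add_mem hy hz
      | smul c y _ hy => rw [mul_smul_comm]; exact Submodule.smul_mem _ _ hy
    | zero => simp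
    | add y z _ _ hy hz => rw [add_mul]; exact add_mem hy hz
    | smul c y _ hy => rw [smul_mul_assoc]; exact Submodule.smul_mem _ _ hy

/-- The generators, as elements of the direct sum of the homogeneous parts. -/
def genDS (t : T) : ⨁ i, P.gr i :=
  DirectSum.of (fun i => P.gr i) (par t) ⟨P.gen t, P.gen_mem_gr t⟩

theorem word_genDS (l : List T) : (l.map P.genDS).prod =
    DirectSum.of (fun i => P.gr i) (l.map par).sum ⟨_, P.word_mem_gr l⟩ := by
  induction l with
  | nil => rfl
  | cons t l ih =>
    rw [List.map_cons, List.prod_cons, ih, genDS, DirectSum.of_mul_of]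
    exact DirectSum.of_eq_of_gradedMonoid_eq
      (Sigma.subtype_ext (List.sum_cons).symm (List.prod_cons).symm)

theorem free_genDS {i : ZMod 2} {x : FreeAlgebra k T} (hx : x ∈ freeGr par i) :
    FreeAlgebra.lift k P.genDS x =
      DirectSum.of (fun i => P.gr i) i ⟨P.quo x, Submodule.mem_map_of_mem hx⟩ := by
  have hmem := Submodule.mem_map_of_mem (f := P.quo.toLinearMap) hx
  have key : ∀ y ∈ freeGr par i, ∀ h : P.quo y ∈ P.gr i, FreeAlgebra.lift k P.genDS y =
      DirectSum.of (fun i => P.gr i) i ⟨P.quo y, h⟩ := by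
    intro y hy
    induction hy using Submodule.span_induction with
    | mem y hy =>
      obtain ⟨l, rfl, rfl⟩ := hy
      intro h
      have h1 : FreeAlgebra.lift k P.genDS (l.map (FreeAlgebra.ι k)).prod
          = (l.map P.genDS).prod := by
        rw [map_list_prod, List.map_map]
        congr 1
        refine List.map_congr_left fun t _ => ?_
        simp
      rw [h1, word_genDS]
      congr 2
      rw [map_list_prod, List.map_map]
      rfl
    | zero =>
      intro h
      rw [map_zero]
      have : (⟨P.quo 0, h⟩ : P.gr i) = 0 := Subtype.ext (map_zero _)
      rw [this, map_zero]
    | add y z hy hz ihy ihz =>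
      intro h
      rw [map_add, ihy (Submodule.mem_map_of_mem hy), ihz (Submodule.mem_map_of_mem hz), ← map_add]
      congr 1
      exact Subtype.ext (map_add _ _ _).symm
    | smul c y hy ihy =>
      intro h
      rw [map_smul, ihy (Submodule.mem_map_of_mem hy), ← DirectSum.lof_eq_of k, ← map_smul,
        DirectSum.lof_eq_of]
      congr 1
      exact Subtype.ext (map_smul _ _ _).symm
  exact key x hx hmem

/-- The decomposition of the algebra into its even and odd part. -/
def toDS : P.Alg →ₐ[k] ⨁ i, P.gr i :=
  P.lift P.genDS
    (fun s t => by
      rw [genDS, genDS, DirectSum.of_mul_of, DirectSum.of_mul_of, ← DirectSum.lof_eq_of k,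
        ← DirectSum.lof_eq_of k, ← map_smul, DirectSum.lof_eq_of, DirectSum.lof_eq_of]
      exact DirectSum.of_eq_of_gradedMonoid_eq
        (Sigma.subtype_ext (add_comm _ _) (P.gen_comm s t)))
    (fun r hr => by
      obtain ⟨i, hi⟩ := P.homog r hr
      rw [P.free_genDS hi]
      have : (⟨P.quo r, Submodule.mem_map_of_mem hi⟩ : P.gr i) = 0 := Subtype.ext (P.quo_rel hr)
      exact (congrArg _ this).trans (map_zero _))

instance : GradedAlgebra P.gr :=
  GradedAlgebra.ofAlgHom P.gr P.toDS
    (by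
      have : ((DirectSum.coeAlgHom P.gr).comp P.toDS).comp P.quo = P.quo := by
        ext t
        change DirectSum.coeAlgHom P.gr (P.toDS (P.gen t)) = P.gen t
        rw [toDS, lift_gen, genDS, DirectSum.coeAlgHom_of]
      refine AlgHom.ext fun x => ?_
      obtain ⟨x, rfl⟩ := P.quo_surjective x
      exact AlgHom.congr_fun this x)
    (by
      rintro i ⟨_, x, hx, rfl⟩
      change P.toDS (P.quo x) = _
      rw [toDS, lift_quo, P.free_genDS hx]
      rfl)

/-- The algebra is super commutative. -/
theorem super_comm {i j : ZMod 2} {a b : P.Alg} (ha : a ∈ P.gr i) (hb : b ∈ P.gr j) :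
    a * b = sgn k (i * j) • (b * a) := by
  have h1 : ∀ (t : T) (l : List T), P.gen t * (l.map P.gen).prod =
      sgn k (par t * (l.map par).sum) • ((l.map P.gen).prod * P.gen t) := by
    intro t l
    induction l with
    | nil => simp [sgn]
    | cons s l ih =>
      simp only [List.map_cons, List.prod_cons, List.sum_cons]
      rw [← mul_assoc, P.gen_comm, smul_mul_assoc, mul_assoc, ih, mul_smul_comm, smul_smul,
        mul_add, sgn_add, mul_assoc]
  have h2 : ∀ l m : List T, (l.map P.gen).prod * (m.map P.gen).prod =
      sgn k ((l.map par).sum * (m.map par).sum) •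
        ((m.map P.gen).prod * (l.map P.gen).prod) := by
    intro l m
    induction l with
    | nil => simp [sgn]
    | cons s l ih =>
      simp only [List.map_cons, List.prod_cons, List.sum_cons]
      rw [mul_assoc, ih, mul_smul_comm, ← mul_assoc, h1, smul_mul_assoc, smul_smul, mul_assoc,
        add_mul, sgn_add, mul_comm (sgn k _)]
  rw [gr_eq_span] at ha hb
  induction ha using Submodule.span_induction with
  | mem x hx =>
    obtain ⟨l, rfl, rfl⟩ := hx
    induction hb using Submodule.span_induction with
    | mem y hy =>
      obtain ⟨m, rfl, rfl⟩ := hy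
      exact h2 l m
    | zero => simp
    | add y z _ _ hy hz => rw [mul_add, hy, hz, add_mul, smul_add]
    | smul c y _ hy => rw [mul_smul_comm, hy, smul_mul_assoc, smul_comm]
  | zero => simp
  | add y z _ _ hy hz => rw [add_mul, hy, hz, mul_add, smul_add]
  | smul c y _ hy => rw [smul_mul_assoc, hy, mul_smul_comm, smul_comm]

/-- The tensor square of the super algebra, with multiplication
`(a ⊗ b) (c ⊗ d) = (-1)^(|b||c|) ac ⊗ bd`. -/
abbrev TSq : Type (max u v) := P.gr ᵍ⊗[k] P.gr

/-- Pure tensors in the tensor square. -/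
abbrev tm (a b : P.Alg) : P.TSq := GradedTensorProduct.tmul k a b

theorem tm_mul_tm {i j : ZMod 2} (a : P.Alg) {b c : P.Alg} (d : P.Alg) (hb : b ∈ P.gr i)
    (hc : c ∈ P.gr j) : P.tm a b * P.tm c d = sgn k (i * j) • P.tm (a * c) (b * d) := by
  have := GradedTensorProduct.tmul_coe_mul_coe_tmul P.gr P.gr a ⟨b, hb⟩ ⟨c, hc⟩ d
  rw [← units_smul_eq_sgn]
  exact this

theorem tm_sum_left {S : Type w} (s : Finset S) (f : S → P.Alg) (b : P.Alg) :
    P.tm (∑ x ∈ s, f x) b = ∑ x ∈ s, P.tm (f x) b := by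
  simp only [tm, GradedTensorProduct.tmul, TensorProduct.sum_tmul, map_sum]

theorem tm_sum_right {S : Type w} (s : Finset S) (a : P.Alg) (f : S → P.Alg) :
    P.tm a (∑ x ∈ s, f x) = ∑ x ∈ s, P.tm a (f x) := by
  simp only [tm, GradedTensorProduct.tmul, TensorProduct.tmul_sum, map_sum]

theorem tm_smul_left (r : k) (a b : P.Alg) : P.tm (r • a) b = r • P.tm a b := by
  simp only [tm, GradedTensorProduct.tmul, ← TensorProduct.smul_tmul', map_smul]

theorem tm_smul_right (r : k) (a b : P.Alg) : P.tm a (r • b) = r • P.tm a b := by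
  simp only [tm, GradedTensorProduct.tmul, TensorProduct.tmul_smul, map_smul]

theorem tm_one : P.tm 1 1 = 1 := rfl

theorem tm_comm {i₁ i₂ i₃ i₄ : ZMod 2} {a b c d : P.Alg} (ha : a ∈ P.gr i₁) (hb : b ∈ P.gr i₂)
    (hc : c ∈ P.gr i₃) (hd : d ∈ P.gr i₄) : P.tm a b * P.tm c d =
      sgn k ((i₁ + i₂) * (i₃ + i₄)) • (P.tm c d * P.tm a b) := by
  rw [P.tm_mul_tm a d hb hc, P.tm_mul_tm c b hd ha, P.super_comm ha hc, P.super_comm hb hd]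
  rw [tm_smul_left, tm_smul_right, smul_smul, smul_smul, smul_smul]
  congr 1
  rw [← sgn_add, ← sgn_add, ← sgn_add]
  congr 1
  have h2 : i₄ * i₁ + i₄ * i₁ = 0 := CharTwo.add_self_eq_zero _
  linear_combination (-1 : ZMod 2) * h2

end SuperPres

end SuperPres

/-! ## Coordinate super algebras of closed sub super groups of `GL(V)` -/

section Coordinate

/-- The coordinates `X i j` and `Z i j` on the general linear super group. -/
inductive Coord (ι : Type v) : Type v
  | X (i j : ι)
  | Z (i j : ι)

variable {k : Type u} [Field k] {ι : Type v}

/-- Both `X i j` and `Z i j` have parity `[i] + [j]`. -/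
def Coord.par (p : ι → ZMod 2) : Coord ι → ZMod 2
  | .X i j => p i + p j
  | .Z i j => p i + p j

theorem mem_freeGr_ι {T : Type v} (par : T → ZMod 2) (t : T) :
    FreeAlgebra.ι k t ∈ freeGr par (par t) :=
  Submodule.subset_span ⟨[t], by simp, by simp⟩

theorem mem_freeGr_mul {T : Type v} (par : T → ZMod 2) (s t : T) :
    FreeAlgebra.ι k s * FreeAlgebra.ι k t ∈ freeGr par (par s + par t) :=
  Submodule.subset_span ⟨[s, t], by simp, by simp⟩

theorem mem_freeGr_algebraMap {T : Type v} (par : T → ZMod 2) (c : k) :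
    algebraMap k (FreeAlgebra k T) c ∈ freeGr par 0 := by
  rw [Algebra.algebraMap_eq_smul_one]
  exact Submodule.smul_mem _ _ (Submodule.subset_span ⟨[], by simp, by simp⟩)

variable [Fintype ι] [DecidableEq ι]

/-- The relators `∑ j, Z i j * X j l - δ i l`. -/
def invRel (k : Type u) [Field k] (ι : Type v) [Fintype ι] [DecidableEq ι] :
    Set (FreeAlgebra k (Coord ι)) :=
  {r | ∃ i l, r = ∑ j, FreeAlgebra.ι k (Coord.Z i j) * FreeAlgebra.ι k (Coord.X j l)
    - algebraMap k _ (if i = l then 1 else 0)}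

/-- The presentation of the coordinate super algebra of the closed subscheme of `GL(V)` cut out by
the homogeneous equations `R`. -/
abbrev coordPres (p : ι → ZMod 2) (R : Set (FreeAlgebra k (Coord ι)))
    (hR : ∀ r ∈ R, ∃ i, r ∈ freeGr (Coord.par p) i) : SuperPres k (Coord.par p) where
  rel := invRel k ι ∪ R
  homog r hr := by
    rcases hr with ⟨i, l, rfl⟩ | hr
    · refine ⟨p i + p l, sub_mem (sum_mem fun j _ => ?_) ?_⟩
      · have := mem_freeGr_mul (k := k) (Coord.par p) (Coord.Z i j) (Coord.X j l)
        have e : Coord.par p (Coord.Z i j) + Coord.par p (Coord.X j l) = p i + p l := by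
          have h2 : p j + p j = 0 := CharTwo.add_self_eq_zero _
          simp only [Coord.par]
          linear_combination h2
        rwa [e] at this
      · split_ifs with h
        · subst h
          rw [CharTwo.add_self_eq_zero]
          exact mem_freeGr_algebraMap _ _
        · rw [map_zero]
          exact zero_mem _
    · exact hR r hr

/-- The comultiplication on coordinates: `X i j ↦ ∑ l, X i l ⊗ X l j` and
`Z j l ↦ ∑ m, (-1)^(([j]+[m])([m]+[l])) Z m l ⊗ Z j m`. -/
def comulGen (p : ι → ZMod 2) (R : Set (FreeAlgebra k (Coord ι)))
    (hR : ∀ r ∈ R, ∃ i, r ∈ freeGr (Coord.par p) i) : Coord ι → (coordPres p R hR).TSq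
  | .X i j => ∑ l, (coordPres p R hR).tm ((coordPres p R hR).gen (Coord.X i l))
      ((coordPres p R hR).gen (Coord.X l j))
  | .Z j l => ∑ m, sgn k ((p j + p m) * (p m + p l)) •
      (coordPres p R hR).tm ((coordPres p R hR).gen (Coord.Z m l))
        ((coordPres p R hR).gen (Coord.Z j m))

/-- The counit on coordinates: `X i j ↦ δ i j` and `Z i j ↦ δ i j`. -/
def counitGen (k : Type u) [Field k] (ι : Type v) [DecidableEq ι] : Coord ι → k
  | .X i j => if i = j then 1 else 0
  | .Z i j => if i = j then 1 else 0

/-- Homogeneous equations, in the coordinates of `GL(V)`, which are compatible with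
comultiplication and counit, so that they cut out a closed subgroup. -/
structure GroupEqs (k : Type u) [Field k] (p : ι → ZMod 2) where
  rel : Set (FreeAlgebra k (Coord ι))
  homog : ∀ r ∈ rel, ∃ i, r ∈ freeGr (Coord.par p) i
  comul_rel : ∀ r ∈ rel, FreeAlgebra.lift k (comulGen p rel homog) r = 0
  counit_rel : ∀ r ∈ rel, FreeAlgebra.lift k (counitGen k ι) r = 0

namespace GroupEqs

variable {p : ι → ZMod 2} (G : GroupEqs k p)

/-- The presentation of `𝒪[G]`. -/
abbrev pres : SuperPres k (Coord.par p) := coordPres p G.rel G.homog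

/-- The super algebra `𝒪[G]`. -/
abbrev O : Type (max u v) := G.pres.Alg

/-- The coordinate function `X i j` in `𝒪[G]`. -/
def X (i j : ι) : G.O := G.pres.gen (Coord.X i j)

/-- The coordinate function `Z i j` in `𝒪[G]`; these form the inverse of the matrix `X`. -/
def Z (i j : ι) : G.O := G.pres.gen (Coord.Z i j)

theorem X_mem (i j : ι) : G.X i j ∈ G.pres.gr (p i + p j) := G.pres.gen_mem_gr (Coord.X i j)

theorem Z_mem (i j : ι) : G.Z i j ∈ G.pres.gr (p i + p j) := G.pres.gen_mem_gr (Coord.Z i j)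

theorem Z_mul_X (i l : ι) : ∑ j, G.Z i j * G.X j l = if i = l then 1 else 0 := by
  have := G.pres.quo_rel (r := ∑ j, FreeAlgebra.ι k (Coord.Z i j) * FreeAlgebra.ι k (Coord.X j l)
    - algebraMap k _ (if i = l then 1 else 0)) (Or.inl ⟨i, l, rfl⟩)
  rw [map_sub, sub_eq_zero, map_sum, AlgHom.commutes] at this
  simp only [map_mul] at this
  refine this.trans ?_
  split_ifs <;> simp

theorem comul_comm (s t : Coord ι) :
    comulGen p G.rel G.homog s * comulGen p G.rel G.homog t =
      sgn k (Coord.par p s * Coord.par p t) •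
        (comulGen p G.rel G.homog t * comulGen p G.rel G.homog s) := by
  have key : ∀ s : Coord ι, ∃ (c : ι → k) (a b : ι → G.O) (i j : ι → ZMod 2),
      comulGen p G.rel G.homog s = ∑ l, c l • G.pres.tm (a l) (b l) ∧
      (∀ l, a l ∈ G.pres.gr (i l)) ∧ (∀ l, b l ∈ G.pres.gr (j l)) ∧
      ∀ l, i l + j l = Coord.par p s := by
    intro s
    have h2 : ∀ x : ZMod 2, x + x = 0 := CharTwo.add_self_eq_zero
    cases s with
    | X i j =>
      refine ⟨fun _ => 1, fun l => G.X i l, fun l => G.X l j, fun l => p i + p l,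
        fun l => p l + p j, ?_, fun l => G.X_mem _ _, fun l => G.X_mem _ _, fun l => ?_⟩
      · simp only [one_smul]; rfl
      · simp only [Coord.par]; linear_combination h2 (p l)
    | Z i j =>
      refine ⟨fun m => sgn k ((p i + p m) * (p m + p j)), fun l => G.Z l j, fun l => G.Z i l,
        fun l => p l + p j, fun l => p i + p l, rfl, fun l => G.Z_mem _ _, fun l => G.Z_mem _ _,
        fun l => ?_⟩
      simp only [Coord.par]; linear_combination h2 (p l)
  obtain ⟨c, a, b, i, j, h, ha, hb, hs⟩ := key s
  obtain ⟨c', a', b', i', j', h', ha', hb', ht⟩ := key t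
  rw [h, h', Finset.sum_mul_sum, Finset.sum_mul_sum, Finset.sum_comm, Finset.smul_sum]
  refine Finset.sum_congr rfl fun m _ => ?_
  rw [Finset.smul_sum]
  refine Finset.sum_congr rfl fun l _ => ?_
  rw [smul_mul_smul_comm, smul_mul_smul_comm, G.pres.tm_comm (ha l) (hb l) (ha' m) (hb' m),
    smul_smul, smul_smul, hs, ht]
  congr 1
  ring

theorem comul_inv (r : FreeAlgebra k (Coord ι)) (hr : r ∈ invRel k ι) :
    FreeAlgebra.lift k (comulGen p G.rel G.homog) r = 0 := by
  obtain ⟨i, l, rfl⟩ := hr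
  rw [map_sub, sub_eq_zero, map_sum, AlgHom.commutes]
  simp only [map_mul, FreeAlgebra.lift_ι_apply]
  have h1 : ∀ j, comulGen p G.rel G.homog (Coord.Z i j) * comulGen p G.rel G.homog (Coord.X j l) =
      ∑ m, ∑ a, sgn k ((p i + p m) * (p m + p a)) •
        G.pres.tm (G.Z m j * G.X j a) (G.Z i m * G.X a l) := by
    intro j
    change (∑ m, sgn k ((p i + p m) * (p m + p j)) • G.pres.tm (G.Z m j) (G.Z i m)) *
      (∑ a, G.pres.tm (G.X j a) (G.X a l)) = _
    rw [Finset.sum_mul_sum]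
    refine Finset.sum_congr rfl fun m _ => Finset.sum_congr rfl fun a _ => ?_
    rw [smul_mul_assoc, G.pres.tm_mul_tm _ _ (G.Z_mem i m) (G.X_mem j a), smul_smul, ← sgn_add]
    congr 2
    have h2 : p j + p j = 0 := CharTwo.add_self_eq_zero _
    linear_combination (p i + p m) * h2
  rw [Finset.sum_congr rfl fun j _ => h1 j, Finset.sum_comm]
  have h3 : ∀ m, ∑ j, ∑ a, sgn k ((p i + p m) * (p m + p a)) •
        G.pres.tm (G.Z m j * G.X j a) (G.Z i m * G.X a l) =
      G.pres.tm 1 (G.Z i m * G.X m l) := by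
    intro m
    rw [Finset.sum_comm, Finset.sum_eq_single m]
    · rw [← Finset.smul_sum, ← G.pres.tm_sum_left, Z_mul_X, if_pos rfl,
        CharTwo.add_self_eq_zero, mul_zero, sgn_zero, one_smul]
    · intro a _ ha
      rw [← Finset.smul_sum, ← G.pres.tm_sum_left, Z_mul_X, if_neg (Ne.symm ha), SuperPres.tm,
        GradedTensorProduct.tmul, TensorProduct.zero_tmul, map_zero, smul_zero]
    · simp
  rw [Finset.sum_congr rfl fun m _ => h3 m, ← G.pres.tm_sum_right, Z_mul_X]
  split_ifs
  · rw [map_one]; rfl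
  · rw [map_zero, SuperPres.tm, GradedTensorProduct.tmul, TensorProduct.tmul_zero, map_zero]

/-- The comultiplication `𝒪[G] → 𝒪[G] ⊗ 𝒪[G]`, a morphism of super algebras. -/
def comul : G.O →ₐ[k] G.pres.TSq :=
  G.pres.lift (comulGen p G.rel G.homog) G.comul_comm fun r hr =>
    hr.elim (G.comul_inv r) (G.comul_rel r)

/-- The counit `𝒪[G] → k`. -/
def counit : G.O →ₐ[k] k :=
  G.pres.lift (counitGen k ι)
    (fun s t => by
      have h0 : ∀ s : Coord ι, counitGen k ι s ≠ 0 → Coord.par p s = 0 := by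
        intro s hs
        cases s with
        | X i j =>
          simp only [counitGen, ne_eq, ite_eq_right_iff, one_ne_zero, imp_false, not_not] at hs
          simp only [Coord.par, hs, CharTwo.add_self_eq_zero]
        | Z i j =>
          simp only [counitGen, ne_eq, ite_eq_right_iff, one_ne_zero, imp_false, not_not] at hs
          simp only [Coord.par, hs, CharTwo.add_self_eq_zero]
      by_cases hs : counitGen k ι s = 0
      · rw [hs, zero_mul, mul_zero, smul_zero]
      · change _ = sgn k (Coord.par p s * Coord.par p t) • _
        rw [h0 s hs, zero_mul, sgn_zero, one_smul, mul_comm])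
    (fun r hr => hr.elim
      (by
        rintro ⟨i, l, rfl⟩
        rw [map_sub, sub_eq_zero, map_sum, AlgHom.commutes]
        simp [counitGen])
      (G.counit_rel r))

end GroupEqs

/-- The general linear super group: no further equations. -/
def glEqs (k : Type u) [Field k] (p : ι → ZMod 2) : GroupEqs k p where
  rel := ∅
  homog _ h := h.elim
  comul_rel _ h := h.elim
  counit_rel _ h := h.elim

/-- The equations `∑ a b, (-1)^([b]([a]+[i])) X a i * g a b * X b j - g i j` of the subgroup of
`GL(V)` which preserves the form with Gram matrix `g`. -/
def formRel (p : ι → ZMod 2) (g : Matrix ι ι k) : Set (FreeAlgebra k (Coord ι)) :=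
  {r | ∃ i j, r = ∑ a, ∑ b, (sgn k (p b * (p a + p i)) * g a b) •
      (FreeAlgebra.ι k (Coord.X a i) * FreeAlgebra.ι k (Coord.X b j))
    - algebraMap k _ (g i j)}

theorem formRel_homog (p : ι → ZMod 2) (g : Matrix ι ι k) (c : ZMod 2)
    (hg : ∀ i j, p i + p j ≠ c → g i j = 0) :
    ∀ r ∈ formRel p g, ∃ i, r ∈ freeGr (Coord.par p) i := by
  rintro _ ⟨i, j, rfl⟩
  refine ⟨p i + p j + c, sub_mem (sum_mem fun a _ => sum_mem fun b _ => ?_) ?_⟩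
  · by_cases h : p a + p b = c
    · refine Submodule.smul_mem _ _ ?_
      have := mem_freeGr_mul (k := k) (Coord.par p) (Coord.X a i) (Coord.X b j)
      have e : Coord.par p (Coord.X a i) + Coord.par p (Coord.X b j) = p i + p j + c := by
        simp only [Coord.par]; linear_combination h
      rwa [e] at this
    · rw [hg a b h, mul_zero, zero_smul]
      exact zero_mem _
  · by_cases h : p i + p j = c
    · rw [h, CharTwo.add_self_eq_zero]
      exact mem_freeGr_algebraMap _ _
    · rw [hg i j h, map_zero]
      exact zero_mem _

/-- The subgroup of `GL(V)` which preserves a homogeneous form with Gram matrix `g`. -/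
def formEqs (p : ι → ZMod 2) (g : Matrix ι ι k) (c : ZMod 2)
    (hg : ∀ i j, p i + p j ≠ c → g i j = 0) : GroupEqs k p where
  rel := formRel p g
  homog := formRel_homog p g c hg
  comul_rel := by
    rintro _ ⟨i, j, rfl⟩
    set P := coordPres p (formRel p g) (formRel_homog p g c hg) with hP
    let X : ι → ι → P.Alg := fun i j => P.gen (Coord.X i j)
    have hX : ∀ i j, X i j ∈ P.gr (p i + p j) := fun i j => P.gen_mem_gr (Coord.X i j)
    have hform : ∀ i j, ∑ a, ∑ b, (sgn k (p b * (p a + p i)) * g a b) • (X a i * X b j) =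
        algebraMap k _ (g i j) := by
      intro i j
      have := P.quo_rel (r := ∑ a, ∑ b, (sgn k (p b * (p a + p i)) * g a b) •
        (FreeAlgebra.ι k (Coord.X a i) * FreeAlgebra.ι k (Coord.X b j))
          - algebraMap k _ (g i j)) (Or.inr ⟨i, j, rfl⟩)
      rw [map_sub, sub_eq_zero, AlgHom.commutes] at this
      simp only [map_sum, map_smul, map_mul] at this
      exact this
    rw [map_sub, sub_eq_zero, AlgHom.commutes]
    simp only [map_sum, map_smul, map_mul, FreeAlgebra.lift_ι_apply]
    have h1 : ∀ a b, (sgn k (p b * (p a + p i)) * g a b) •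
        (comulGen p (formRel p g) (formRel_homog p g c hg) (Coord.X a i) *
          comulGen p (formRel p g) (formRel_homog p g c hg) (Coord.X b j)) =
        ∑ e, ∑ d, (sgn k (p d * (p e + p i)) * (sgn k (p b * (p a + p e)) * g a b)) •
          P.tm (X a e * X b d) (X e i * X d j) := by
      intro a b
      change _ • ((∑ e, P.tm (X a e) (X e i)) * (∑ d, P.tm (X b d) (X d j))) = _
      rw [Finset.sum_mul_sum, Finset.smul_sum]
      refine Finset.sum_congr rfl fun e _ => ?_
      rw [Finset.smul_sum]
      refine Finset.sum_congr rfl fun d _ => ?_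
      rw [P.tm_mul_tm _ _ (hX e i) (hX b d), smul_smul, mul_right_comm, ← mul_assoc, ← sgn_add,
        ← sgn_add]
      congr 3
      have h2 : p b * p i + p b * p i = 0 := CharTwo.add_self_eq_zero _
      linear_combination h2
    simp only [h1]
    have h2 : ∑ a, ∑ b, ∑ e, ∑ d,
        (sgn k (p d * (p e + p i)) * (sgn k (p b * (p a + p e)) * g a b)) •
          P.tm (X a e * X b d) (X e i * X d j) =
        ∑ e, ∑ d, sgn k (p d * (p e + p i)) • P.tm
          (∑ a, ∑ b, (sgn k (p b * (p a + p e)) * g a b) • (X a e * X b d)) (X e i * X d j) := by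
      simp only [P.tm_sum_left, P.tm_smul_left, Finset.smul_sum, smul_smul]
      rw [Finset.sum_congr rfl fun a _ => Finset.sum_comm, Finset.sum_comm]
      refine Finset.sum_congr rfl fun e _ => ?_
      rw [Finset.sum_congr rfl fun a _ => Finset.sum_comm, Finset.sum_comm]
    rw [h2]
    simp only [hform, Algebra.algebraMap_eq_smul_one, P.tm_smul_left, smul_smul,
      ← P.tm_smul_right]
    rw [Finset.sum_congr rfl fun e _ => (P.tm_sum_right _ _ _).symm,
      ← P.tm_sum_right, hform i j, Algebra.algebraMap_eq_smul_one, P.tm_smul_right]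
    rfl
  counit_rel := by
    rintro _ ⟨i, j, rfl⟩
    rw [map_sub, sub_eq_zero, AlgHom.commutes]
    simp [counitGen, CharTwo.add_self_eq_zero, sgn_zero]

/-- The equations `∑ j, X i j * Q j l - ∑ j, Q i j * X j l` of the subgroup of `GL(V)` which
commutes with the endomorphism with matrix `Q`. -/
def commRel (Q : Matrix ι ι k) : Set (FreeAlgebra k (Coord ι)) :=
  {r | ∃ i l, r = ∑ j, Q j l • FreeAlgebra.ι k (Coord.X i j)
    - ∑ j, Q i j • FreeAlgebra.ι k (Coord.X j l)}

theorem commRel_homog (p : ι → ZMod 2) (Q : Matrix ι ι k) (c : ZMod 2)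
    (hQ : ∀ i j, p i + p j ≠ c → Q i j = 0) :
    ∀ r ∈ commRel Q, ∃ i, r ∈ freeGr (Coord.par p) i := by
  rintro _ ⟨i, l, rfl⟩
  refine ⟨p i + p l + c, sub_mem (sum_mem fun j _ => ?_) (sum_mem fun j _ => ?_)⟩
  · by_cases h : p j + p l = c
    · refine Submodule.smul_mem _ _ ?_
      have := mem_freeGr_ι (k := k) (Coord.par p) (Coord.X i j)
      have e : Coord.par p (Coord.X i j) = p i + p l + c := by
        have h2 : p l + p l = 0 := CharTwo.add_self_eq_zero _
        simp only [Coord.par]; linear_combination h - h2 + 0 * h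
      rwa [e] at this
    · rw [hQ j l h, zero_smul]
      exact zero_mem _
  · by_cases h : p i + p j = c
    · refine Submodule.smul_mem _ _ ?_
      have := mem_freeGr_ι (k := k) (Coord.par p) (Coord.X j l)
      have e : Coord.par p (Coord.X j l) = p i + p l + c := by
        have h2 : p i + p i = 0 := CharTwo.add_self_eq_zero _
        simp only [Coord.par]; linear_combination h - h2
      rwa [e] at this
    · rw [hQ i j h, zero_smul]
      exact zero_mem _

/-- The subgroup of `GL(V)` which commutes with a homogeneous endomorphism with matrix `Q`. -/
def commEqs (p : ι → ZMod 2) (Q : Matrix ι ι k) (c : ZMod 2)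
    (hQ : ∀ i j, p i + p j ≠ c → Q i j = 0) : GroupEqs k p where
  rel := commRel Q
  homog := commRel_homog p Q c hQ
  comul_rel := by
    rintro _ ⟨i, l, rfl⟩
    set P := coordPres p (commRel Q) (commRel_homog p Q c hQ) with hP
    let X : ι → ι → P.Alg := fun i j => P.gen (Coord.X i j)
    have hcomm : ∀ i l, ∑ j, Q j l • X i j = ∑ j, Q i j • X j l := by
      intro i l
      have := P.quo_rel (r := ∑ j, Q j l • FreeAlgebra.ι k (Coord.X i j)
        - ∑ j, Q i j • FreeAlgebra.ι k (Coord.X j l)) (Or.inr ⟨i, l, rfl⟩)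
      rw [map_sub, sub_eq_zero] at this
      simp only [map_sum, map_smul] at this
      exact this
    rw [map_sub, sub_eq_zero]
    simp only [map_sum, map_smul, FreeAlgebra.lift_ι_apply]
    change ∑ j, Q j l • (∑ m, P.tm (X i m) (X m j)) = ∑ j, Q i j • (∑ m, P.tm (X j m) (X m l))
    have h1 : ∑ j, Q j l • (∑ m, P.tm (X i m) (X m j)) =
        ∑ m, P.tm (X i m) (∑ j, Q j l • X m j) := by
      simp only [P.tm_sum_right, P.tm_smul_right, Finset.smul_sum]
      exact Finset.sum_comm
    have h2 : ∑ j, Q i j • (∑ m, P.tm (X j m) (X m l)) =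
        ∑ m, P.tm (∑ j, Q i j • X j m) (X m l) := by
      simp only [P.tm_sum_left, P.tm_smul_left, Finset.smul_sum]
      exact Finset.sum_comm
    rw [h1, h2]
    rw [Finset.sum_congr rfl fun m _ => congrArg (P.tm (X i m)) (hcomm m l),
      Finset.sum_congr rfl fun m _ => congrArg (fun x => P.tm x (X m l)) (hcomm i m).symm]
    simp only [P.tm_sum_left, P.tm_smul_left, P.tm_sum_right, P.tm_smul_right]
    exact Finset.sum_comm
  counit_rel := by
    rintro _ ⟨i, l, rfl⟩
    rw [map_sub, sub_eq_zero]
    simp [counitGen]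

end Coordinate

/-! ## Monoidal super categories given by generators and relations

The categories below are strict symmetric monoidal super categories, linear over `k`, whose monoid
of objects is the monoid of words in an alphabet `S`. -/

section Diagrams

/-- Generating morphisms, with their source, target and parity. -/
structure Signature (S : Type) where
  Gen : Type
  dom : Gen → List S
  cod : Gen → List S
  par : Gen → ZMod 2

variable {S : Type}

namespace Signature

/-- The elementary morphisms: the crossings `x ⊗ y → y ⊗ x` of letters, which are even, and the
generating morphisms. -/
inductive Elem (σ : Signature S) : Type
  | cross (x y : S)
  | of (g : σ.Gen)

variable (σ : Signature S)

/-- The source of an elementary morphism. -/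
def Elem.dom {σ : Signature S} : σ.Elem → List S
  | .cross x y => [x, y]
  | .of g => σ.dom g

/-- The target of an elementary morphism. -/
def Elem.cod {σ : Signature S} : σ.Elem → List S
  | .cross x y => [y, x]
  | .of g => σ.cod g

/-- The parity of an elementary morphism. -/
def Elem.par {σ : Signature S} : σ.Elem → ZMod 2
  | .cross _ _ => 0
  | .of g => σ.par g

/-- A layer `id ⊗ e ⊗ id` of a diagram, with `e` elementary. -/
structure Layer (X Y : List S) where
  left : List S
  elem : σ.Elem
  right : List S
  dom_eq : X = left ++ (elem.dom ++ right)
  cod_eq : Y = left ++ (elem.cod ++ right)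

/-- A diagram from `X` to `Y`: a finite sequence of composable layers, the first of which is
applied first. -/
inductive Path : List S → List S → Type
  | nil (X : List S) : Path X X
  | cons {X Y Z : List S} (L : σ.Layer X Y) (P : Path Y Z) : Path X Z

variable {σ}

/-- Tensoring a layer with an identity morphism from the left. -/
def Layer.whiskerLeft {X Y : List S} (a : List S) (L : σ.Layer X Y) :
    σ.Layer (a ++ X) (a ++ Y) where
  left := a ++ L.left
  elem := L.elem
  right := L.right
  dom_eq := by rw [List.append_assoc, ← L.dom_eq]
  cod_eq := by rw [List.append_assoc, ← L.cod_eq]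

/-- Tensoring a layer with an identity morphism from the right. -/
def Layer.whiskerRight {X Y : List S} (L : σ.Layer X Y) (b : List S) :
    σ.Layer (X ++ b) (Y ++ b) where
  left := L.left
  elem := L.elem
  right := L.right ++ b
  dom_eq := by
    conv_lhs => rw [L.dom_eq]
    simp only [List.append_assoc]
  cod_eq := by
    conv_lhs => rw [L.cod_eq]
    simp only [List.append_assoc]

namespace Path

/-- Concatenation of diagrams: `P` first, then `Q`. -/
def comp {X Y Z : List S} : σ.Path X Y → σ.Path Y Z → σ.Path X Z
  | .nil _, Q => Q
  | .cons L P, Q => .cons L (P.comp Q)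

/-- The diagram `id_a ⊗ P`. -/
def whiskerLeft (a : List S) {X Y : List S} : σ.Path X Y → σ.Path (a ++ X) (a ++ Y)
  | .nil _ => .nil _
  | .cons L P => .cons (L.whiskerLeft a) (P.whiskerLeft a)

/-- The diagram `P ⊗ id_b`. -/
def whiskerRight {X Y : List S} (b : List S) : σ.Path X Y → σ.Path (X ++ b) (Y ++ b)
  | .nil _ => .nil _
  | .cons L P => .cons (L.whiskerRight b) (P.whiskerRight b)

/-- The parity of a diagram. -/
def par {X Y : List S} : σ.Path X Y → ZMod 2
  | .nil _ => 0
  | .cons L P => L.elem.par + P.par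

/-- The diagram which starts with the layer `id_a ⊗ e ⊗ id_b : X → Y` and continues with `P`. -/
def step {X Z : List S} (a : List S) (e : σ.Elem) (b Y : List S) (P : σ.Path Y Z)
    (hX : X = a ++ (e.dom ++ b) := by rfl) (hY : Y = a ++ (e.cod ++ b) := by rfl) : σ.Path X Z :=
  .cons ⟨a, e, b, hX, hY⟩ P

/-- The diagram `X ⊗ z → z ⊗ X` in which the letter `z` crosses all letters of `X`. -/
def crossWord : (X : List S) → (z : S) → σ.Path (X ++ [z]) (z :: X)
  | [], z => .nil [z]
  | x :: X, z => ((crossWord X z).whiskerLeft [x]).comp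
      (step [] (.cross x z) X (z :: x :: X) (.nil _))

end Path

end Signature

/-- A presentation of a symmetric monoidal super category: generating morphisms, and homogeneous
relations of the form `P = c • Q` with parallel diagrams `P`, `Q` and a scalar `c`. -/
structure CatPres (k : Type u) [Field k] (S : Type) extends Signature S where
  rel : ∀ X Y : List S, toSignature.Path X Y → k → toSignature.Path X Y → Prop
  homog : ∀ X Y P c Q, rel X Y P c Q → c = 0 ∨ P.par = Q.par

namespace CatPres

variable {k : Type u} [Field k] (C : CatPres k S)

open Signature Signature.Path

/-- Diagrams in the generators of `C`. -/
abbrev Diag (X Y : List S) : Type := C.toSignature.Path X Y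

/-- The local relations `P = c • Q`: the super interchange law, the axioms of a symmetric braiding
and the relations of the presentation. -/
inductive LocalRel : ∀ X Y : List S, C.Diag X Y → k → C.Diag X Y → Prop
  | interchange (e f : C.toSignature.Elem) (c : List S) :
      LocalRel (e.dom ++ (c ++ f.dom)) (e.cod ++ (c ++ f.cod))
        (step [] e (c ++ f.dom) (e.cod ++ (c ++ f.dom))
          (step (e.cod ++ c) f [] _ (.nil _) (by simp) (by simp)))
        (sgn k (e.par * f.par))
        (step (e.dom ++ c) f [] (e.dom ++ (c ++ f.cod))
          (step [] e (c ++ f.cod) _ (.nil _)) (by simp) (by simp))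
  | symm (x y : S) :
      LocalRel [x, y] [x, y]
        (step [] (.cross x y) [] [y, x] <| step [] (.cross y x) [] _ <| .nil _) 1 (.nil _)
  | braid (x y z : S) :
      LocalRel [x, y, z] [z, y, x]
        (step [] (.cross x y) [z] [y, x, z] <| step [y] (.cross x z) [] [y, z, x] <|
          step [] (.cross y z) [x] _ <| .nil _)
        1
        (step [x] (.cross y z) [] [x, z, y] <| step [] (.cross x z) [y] [z, x, y] <|
          step [z] (.cross x y) [] _ <| .nil _)
  | natural (g : C.Gen) (z : S) :
      LocalRel (C.dom g ++ [z]) (z :: C.cod g)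
        (step [] (.of g) [z] (C.cod g ++ [z]) (crossWord (C.cod g) z))
        1
        ((crossWord (C.dom g) z).comp
          (step [z] (.of g) [] _ (.nil _) (by simp [Elem.dom]) (by simp [Elem.cod])))
  | rel {X Y : List S} (P : C.Diag X Y) (c : k) (Q : C.Diag X Y) (h : C.rel X Y P c Q) :
      LocalRel X Y P c Q

/-- All relations `P = c • Q` between diagrams: the closure of the local relations under
tensoring with identity morphisms and under composition with diagrams. -/
inductive Rel : ∀ X Y : List S, C.Diag X Y → k → C.Diag X Y → Prop
  | loc {X Y : List S} {P : C.Diag X Y} {c : k} {Q : C.Diag X Y} (h : C.LocalRel X Y P c Q) :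
      Rel X Y P c Q
  | whiskerLeft (a : List S) {X Y : List S} {P : C.Diag X Y} {c : k} {Q : C.Diag X Y}
      (h : Rel X Y P c Q) : Rel (a ++ X) (a ++ Y) (P.whiskerLeft a) c (Q.whiskerLeft a)
  | whiskerRight (b : List S) {X Y : List S} {P : C.Diag X Y} {c : k} {Q : C.Diag X Y}
      (h : Rel X Y P c Q) : Rel (X ++ b) (Y ++ b) (P.whiskerRight b) c (Q.whiskerRight b)
  | precomp {X Y Z : List S} (s : C.Diag X Y) {P : C.Diag Y Z} {c : k} {Q : C.Diag Y Z}
      (h : Rel Y Z P c Q) : Rel X Z (s.comp P) c (s.comp Q)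
  | postcomp {X Y Z : List S} {P : C.Diag X Y} {c : k} {Q : C.Diag X Y} (h : Rel X Y P c Q)
      (t : C.Diag Y Z) : Rel X Z (P.comp t) c (Q.comp t)

/-- The space of linear combinations of diagrams which vanish in the category. -/
def relSub (X Y : List S) : Submodule k (C.Diag X Y →₀ k) :=
  Submodule.span k {r | ∃ (P : C.Diag X Y) (c : k) (Q : C.Diag X Y), C.Rel X Y P c Q ∧
    r = Finsupp.single P 1 - c • Finsupp.single Q 1}

/-- The space of morphisms from `X` to `Y`: linear combinations of diagrams modulo relations. -/
abbrev Hom (X Y : List S) : Type u := (C.Diag X Y →₀ k) ⧸ C.relSub X Y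

/-- The morphism given by a diagram. -/
def diag {X Y : List S} (P : C.Diag X Y) : C.Hom X Y :=
  (C.relSub X Y).mkQ (Finsupp.single P 1)

theorem diag_rel {X Y : List S} {P : C.Diag X Y} {c : k} {Q : C.Diag X Y}
    (h : C.Rel X Y P c Q) : C.diag P = c • C.diag Q := by
  rw [diag, diag, ← map_smul, ← sub_eq_zero, ← map_sub]
  exact (Submodule.Quotient.mk_eq_zero _).2 (Submodule.subset_span ⟨P, c, Q, h, rfl⟩)

/-- Linear maps out of the morphism spaces, defined on diagrams. -/
def liftHom {X Y : List S} {M : Type w} [AddCommGroup M] [Module k M] (f : C.Diag X Y → M)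
    (hf : ∀ P c Q, C.Rel X Y P c Q → f P = c • f Q) : C.Hom X Y →ₗ[k] M :=
  (C.relSub X Y).liftQ (Finsupp.lift M k _ f) (by
    rw [relSub, Submodule.span_le]
    rintro _ ⟨P, c, Q, h, rfl⟩
    rw [SetLike.mem_coe, LinearMap.mem_ker, map_sub, map_smul]
    simp [hf P c Q h])

theorem liftHom_diag {X Y : List S} {M : Type w} [AddCommGroup M] [Module k M]
    (f : C.Diag X Y → M) (hf) (P : C.Diag X Y) : C.liftHom f hf (C.diag P) = f P := by
  rw [liftHom, diag, Submodule.mkQ_apply, Submodule.liftQ_apply]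
  simp

theorem hom_induction {X Y : List S} {p : C.Hom X Y → Prop} (f : C.Hom X Y)
    (hd : ∀ P, p (C.diag P)) (h0 : p 0) (hadd : ∀ f g, p f → p g → p (f + g))
    (hsmul : ∀ (c : k) f, p f → p (c • f)) : p f := by
  obtain ⟨f, rfl⟩ := Submodule.mkQ_surjective _ f
  induction f using Finsupp.induction_linear with
  | zero => rwa [map_zero]
  | add f g hf hg => rw [map_add]; exact hadd _ _ hf hg
  | single P c =>
    have : (C.relSub X Y).mkQ (Finsupp.single P c) = c • C.diag P := by
      rw [diag, ← map_smul, Finsupp.smul_single, smul_eq_mul, mul_one]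
    rw [this]
    exact hsmul _ _ (hd P)

/-- Identity morphisms. -/
def id (X : List S) : C.Hom X X := C.diag (.nil X)

/-- Composition of morphisms (`f` first, then `g`), induced by concatenation of diagrams. -/
def comp {X Y Z : List S} : C.Hom X Y →ₗ[k] C.Hom Y Z →ₗ[k] C.Hom X Z :=
  C.liftHom
    (fun P => C.liftHom (fun Q => C.diag (P.comp Q)) fun _ _ _ h => C.diag_rel (h.precomp P))
    (fun P c Q h => by
      refine LinearMap.ext fun g => ?_
      induction g using C.hom_induction with
      | hd R =>
        rw [LinearMap.smul_apply, liftHom_diag, liftHom_diag]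
        exact C.diag_rel (h.postcomp R)
      | h0 => simp
      | hadd f g hf hg => rw [map_add, map_add, hf, hg]
      | hsmul c f hf => rw [map_smul, map_smul, hf])

/-- The morphism `id_a ⊗ f`. -/
def whiskerLeft (a : List S) {X Y : List S} : C.Hom X Y →ₗ[k] C.Hom (a ++ X) (a ++ Y) :=
  C.liftHom (fun P => C.diag (P.whiskerLeft a)) fun _ _ _ h => C.diag_rel (h.whiskerLeft a)

/-- The morphism `f ⊗ id_b`. -/
def whiskerRight {X Y : List S} (b : List S) : C.Hom X Y →ₗ[k] C.Hom (X ++ b) (Y ++ b) :=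
  C.liftHom (fun P => C.diag (P.whiskerRight b)) fun _ _ _ h => C.diag_rel (h.whiskerRight b)

/-- The tensor product `f ⊗ g = (f ⊗ id) ∘ (id ⊗ g)` of morphisms. -/
def tensor {X Y X' Y' : List S} (f : C.Hom X Y) (g : C.Hom X' Y') :
    C.Hom (X ++ X') (Y ++ Y') :=
  C.comp (C.whiskerLeft X g) (C.whiskerRight Y' f)

theorem par_comp {X Y Z : List S} (P : C.Diag X Y) (Q : C.Diag Y Z) :
    (P.comp Q).par = P.par + Q.par := by
  induction P with
  | nil => simp [Path.comp, Path.par]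
  | cons L P ih => simp only [Path.comp, Path.par, ih, add_assoc]

theorem par_whiskerLeft (a : List S) {X Y : List S} (P : C.Diag X Y) :
    (P.whiskerLeft a).par = P.par := by
  induction P with
  | nil => rfl
  | cons L P ih => simp only [Path.whiskerLeft, Path.par, ih]; rfl

theorem par_whiskerRight (b : List S) {X Y : List S} (P : C.Diag X Y) :
    (P.whiskerRight b).par = P.par := by
  induction P with
  | nil => rfl
  | cons L P ih => simp only [Path.whiskerRight, Path.par, ih]; rfl

theorem par_crossWord (X : List S) (z : S) : (crossWord X z : C.Diag _ _).par = 0 := by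
  induction X with
  | nil => rfl
  | cons x X ih =>
    refine (C.par_comp _ _).trans ?_
    rw [par_whiskerLeft, ih]
    rfl

theorem rel_par {X Y : List S} {P : C.Diag X Y} {c : k} {Q : C.Diag X Y}
    (h : C.Rel X Y P c Q) : c = 0 ∨ P.par = Q.par := by
  induction h with
  | loc h =>
    cases h with
    | interchange e f c =>
      right
      simp only [step, Path.par, add_zero]
      exact add_comm _ _
    | symm x y => right; simp [step, Path.par, Elem.par]
    | braid x y z => right; simp [step, Path.par, Elem.par]
    | natural g z => right; rw [par_comp, par_crossWord]; simp [step, Path.par, par_crossWord]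
    | rel P c Q h => exact C.homog _ _ _ _ _ h
  | whiskerLeft a h ih => rwa [par_whiskerLeft, par_whiskerLeft]
  | whiskerRight b h ih => rwa [par_whiskerRight, par_whiskerRight]
  | precomp s h ih => rw [par_comp, par_comp]; exact ih.imp_right fun h => by rw [h]
  | postcomp h t ih => rw [par_comp, par_comp]; exact ih.imp_right fun h => by rw [h]

end CatPres

end Diagrams

/-! ## Tensor products of super spaces with homogeneous bases

An alphabet `S` of super spaces is given by the disjoint union `E` of homogeneous bases, with the
map `sh : E → S` which assigns to a basis element the letter whose space it belongs to, and with
the parity `p : E → ZMod 2`. The tensor product of the spaces in a word `X` has the basis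
consisting of the words in `E` which lie over `X`. -/

section Tensors

variable {S : Type} {E : Type v}

/-- Words in the basis elements lying over the word `X` of letters, that is, basis elements
`e₁ ⊗ e₂ ⊗ ⋯` of the tensor product of the spaces in `X`. -/
@[ext]
structure Word (sh : E → S) (X : List S) : Type v where
  list : List E
  map_eq : list.map sh = X

namespace Word

variable {sh : E → S} {X Y : List S}

/-- Concatenation of words. -/
def append (u : Word sh X) (v : Word sh Y) : Word sh (X ++ Y) :=
  ⟨u.1 ++ v.1, by rw [List.map_append, u.2, v.2]⟩

/-- The initial part of a word. -/
def fst (w : Word sh (X ++ Y)) : Word sh X :=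
  ⟨w.1.take X.length, by rw [List.map_take, w.2, List.take_left]⟩

/-- The final part of a word. -/
def snd (w : Word sh (X ++ Y)) : Word sh Y :=
  ⟨w.1.drop X.length, by rw [List.map_drop, w.2, List.drop_left]⟩

/-- Transport along an equality of words of letters. -/
def cast (h : X = Y) (w : Word sh X) : Word sh Y := ⟨w.1, w.2.trans h⟩

/-- The parity of a word. -/
def par (p : E → ZMod 2) (w : Word sh X) : ZMod 2 := (w.1.map p).sum

/-- The reversal of a word with two letters. -/
def rev {x y : S} (w : Word sh [x, y]) : Word sh [y, x] :=
  ⟨w.1.reverse, by rw [List.map_reverse, w.2]; rfl⟩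

theorem length_eq (w : Word sh X) : w.1.length = X.length := by
  conv_rhs => rw [← w.2, List.length_map]

theorem fst_append (u : Word sh X) (v : Word sh Y) : (u.append v).fst = u :=
  Word.ext (by simp [append, fst, ← u.length_eq])

theorem snd_append (u : Word sh X) (v : Word sh Y) : (u.append v).snd = v :=
  Word.ext (by simp [append, snd, ← u.length_eq])

theorem append_fst_snd (w : Word sh (X ++ Y)) : w.fst.append w.snd = w :=
  Word.ext (List.take_append_drop _ _)

theorem par_append (p : E → ZMod 2) (u : Word sh X) (v : Word sh Y) :
    (u.append v).par p = u.par p + v.par p := by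
  simp [par, append]

end Word

instance [Finite E] (sh : E → S) (X : List S) : Finite (Word sh X) :=
  have : Finite {l : List E // l.length = X.length} :=
    (List.finite_length_eq E X.length).to_subtype
  Finite.of_injective
    (fun w : Word sh X => (⟨w.1, w.length_eq⟩ : {l : List E // l.length = X.length}))
    (fun _ _ h => Word.ext (congrArg (fun l => l.1) h))

instance [Fintype E] (sh : E → S) (X : List S) : Fintype (Word sh X) := Fintype.ofFinite _

/-- The tensor product of the spaces in the word `X`. -/
abbrev Tens (k : Type u) [Field k] (sh : E → S) (X : List S) : Type (max u v) := Word sh X →₀ k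

variable {k : Type u} [Field k] {sh : E → S} {X Y Z : List S}

/-- The basis element of a tensor product given by a word. -/
abbrev bv (k : Type u) [Field k] {sh : E → S} {X : List S} (w : Word sh X) : Tens k sh X :=
  Finsupp.single w 1

/-- The tensor product `v ⊗ w` of elements. -/
def tmul : Tens k sh X →ₗ[k] Tens k sh Y →ₗ[k] Tens k sh (X ++ Y) :=
  Finsupp.lift _ k _ fun u => Finsupp.lmapDomain k k fun v => u.append v

theorem tmul_bv (u : Word sh X) (v : Word sh Y) :
    tmul (bv k u) (bv k v) = bv k (u.append v) := by
  simp [tmul, bv]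

/-- The homogeneous component of parity `i` of an element. -/
def part (p : E → ZMod 2) (i : ZMod 2) : Tens k sh X →ₗ[k] Tens k sh X :=
  Finsupp.lift _ k _ fun w => if w.par p = i then bv k w else 0

theorem part_bv (p : E → ZMod 2) (i : ZMod 2) (w : Word sh X) :
    part p i (bv k w) = if w.par p = i then bv k w else 0 := by
  simp [part, bv]

theorem tens_ext {M : Type w} [AddCommGroup M] [Module k M] {f g : Tens k sh X →ₗ[k] M}
    (h : ∀ w, f (bv k w) = g (bv k w)) : f = g :=
  Finsupp.lhom_ext' fun w => LinearMap.ext_ring (h w)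

/-! ### The functor attached to a choice of images of the generating morphisms -/

variable {C : CatPres k S}

open Signature

/-- The crossing `v ⊗ w ↦ (-1)^(|v||w|) w ⊗ v` of two letters. -/
def crossMap (p : E → ZMod 2) (x y : S) : Tens k sh [x, y] →ₗ[k] Tens k sh [y, x] :=
  Finsupp.lift _ k _ fun w => sgn k (w.1.map p).prod • bv k w.rev

theorem crossMap_bv (p : E → ZMod 2) {x y : S} (w : Word sh [x, y]) :
    crossMap p x y (bv k w) = sgn k (w.1.map p).prod • bv k w.rev := by
  rw [crossMap, Finsupp.lift_apply, Finsupp.sum_single_index (by simp), one_smul]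

/-- Linear maps assigned to the generating morphisms. -/
abbrev GenAct (C : CatPres k S) (sh : E → S) : Type (max u v) :=
  ∀ g : C.Gen, Tens k sh (C.dom g) →ₗ[k] Tens k sh (C.cod g)

/-- The linear map assigned to an elementary morphism. -/
def elemMap (p : E → ZMod 2) (act : GenAct C sh) :
    ∀ e : C.toSignature.Elem, Tens k sh e.dom →ₗ[k] Tens k sh e.cod
  | .cross x y => crossMap p x y
  | .of g => act g

/-- The linear map assigned to a layer `id ⊗ e ⊗ id`:
`u ⊗ v ⊗ w ↦ (-1)^(|e||u|) u ⊗ e(v) ⊗ w`. -/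
def layerMap (p : E → ZMod 2) (act : GenAct C sh) (L : C.toSignature.Layer X Y) :
    Tens k sh X →ₗ[k] Tens k sh Y :=
  Finsupp.lift _ k _ fun w =>
    sgn k (L.elem.par * (w.cast L.dom_eq).fst.par p) •
      Finsupp.lmapDomain k k
        (fun v => ((w.cast L.dom_eq).fst.append
          (v.append (w.cast L.dom_eq).snd.snd)).cast L.cod_eq.symm)
        (elemMap p act L.elem (bv k (w.cast L.dom_eq).snd.fst))

/-- The linear map assigned to a diagram. -/
def pathMap (p : E → ZMod 2) (act : GenAct C sh) :
    ∀ {X Y : List S}, C.Diag X Y → (Tens k sh X →ₗ[k] Tens k sh Y)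
  | _, _, .nil _ => LinearMap.id
  | _, _, .cons L P => pathMap p act P ∘ₗ layerMap p act L

/-- Images of the generating morphisms which are homogeneous of the prescribed parity and satisfy
the relations of the presentation. -/
structure Realization (C : CatPres k S) (sh : E → S) (p : E → ZMod 2) where
  act : GenAct C sh
  homog : ∀ g i, part p i ∘ₗ act g = act g ∘ₗ part p (i + C.par g)
  resp : ∀ X Y P c Q, C.rel X Y P c Q → pathMap p act P = c • pathMap p act Q

/-! ### Comparison with the tensor algebra -/

/-- The tensor algebra of the direct sum of the spaces in the alphabet. -/
abbrev TA (k : Type u) [Field k] (E : Type v) : Type (max u v) := MonoidAlgebra k (FreeMonoid E)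

/-- Basis elements of the tensor algebra. -/
def ew (k : Type u) [Field k] {E : Type v} (l : List E) : TA k E :=
  MonoidAlgebra.of k (FreeMonoid E) (FreeMonoid.ofList l)

theorem ew_append (l m : List E) : ew k (l ++ m) = ew k l * ew k m := by
  rw [ew, ew, ew, ← map_mul, FreeMonoid.ofList_append]

theorem ew_nil : ew k ([] : List E) = 1 := by
  rw [ew, FreeMonoid.ofList_nil, map_one]

theorem ew_cons (a : E) (l : List E) : ew k (a :: l) = ew k [a] * ew k l :=
  ew_append [a] l

/-- The embedding of a tensor product into the tensor algebra. -/
def emb : Tens k sh X →ₗ[k] TA k E := Finsupp.lift _ k _ fun w => ew k w.1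

theorem emb_bv (w : Word sh X) : emb (bv k w) = ew k w.1 := by
  simp [emb, bv]

theorem emb_injective : Function.Injective (emb : Tens k sh X →ₗ[k] TA k E) := by
  intro s t h
  have key : ∀ (t : Tens k sh X) (w : Word sh X),
      (emb t).coeff (FreeMonoid.ofList w.1) = t w := by
    intro t w
    induction t using Finsupp.induction_linear with
    | zero => simp
    | add f g hf hg => rw [map_add, MonoidAlgebra.coeff_add, Finsupp.add_apply, hf, hg]; rfl
    | single v c =>
      simp only [emb, ew, Finsupp.lift_apply, zero_smul, Finsupp.sum_single_index]
      simp only [MonoidAlgebra.of_apply, MonoidAlgebra.coeff_smul, Finsupp.smul_apply,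
        MonoidAlgebra.coeff_single, smul_eq_mul]
      classical
      rw [Finsupp.single_apply, Finsupp.single_apply]
      have : FreeMonoid.ofList v.1 = FreeMonoid.ofList w.1 ↔ v = w :=
        ⟨fun h => Word.ext (FreeMonoid.ofList.injective h), fun h => by rw [h]⟩
      simp [this]
  ext w
  rw [← key s w, ← key t w, h]

theorem emb_tmul (a : Tens k sh X) (b : Tens k sh Y) : emb (tmul a b) = emb a * emb b := by
  induction a using Finsupp.induction_linear with
  | zero => simp
  | add f g hf hg => rw [map_add, LinearMap.add_apply, map_add, hf, hg, map_add, add_mul]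
  | single u c =>
    induction b using Finsupp.induction_linear with
    | zero => simp
    | add f g hf hg => rw [map_add, map_add, hf, hg, map_add, mul_add]
    | single v d =>
      have hu : (Finsupp.single u c : Tens k sh X) = c • bv k u := by simp [bv]
      have hv : (Finsupp.single v d : Tens k sh Y) = d • bv k v := by simp [bv]
      rw [hu, hv]
      simp only [map_smul, LinearMap.smul_apply, tmul_bv, emb_bv, smul_mul_smul_comm]
      rw [smul_smul, mul_comm d c]
      simp only [Word.append, ew_append]

/-- Transport of tensors along an equality of words of letters. -/
def tcast (h : X = Y) : Tens k sh X →ₗ[k] Tens k sh Y := Finsupp.lmapDomain k k (Word.cast h)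

theorem tcast_bv (h : X = Y) (w : Word sh X) : tcast h (bv k w) = bv k (w.cast h) := by
  simp [tcast, bv]

theorem emb_tcast (h : X = Y) (t : Tens k sh X) : emb (tcast h t) = emb t := by
  have : emb ∘ₗ tcast h = (emb : Tens k sh X →ₗ[k] TA k E) :=
    tens_ext fun w => by rw [LinearMap.comp_apply, tcast_bv, emb_bv, emb_bv]; rfl
  exact LinearMap.congr_fun this t

/-- The operator `v ↦ (-1)^(c|v|) v`. -/
def tw (p : E → ZMod 2) (c : ZMod 2) : Tens k sh X →ₗ[k] Tens k sh X :=
  Finsupp.lift _ k _ fun w => sgn k (c * w.par p) • bv k w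

theorem tw_bv (p : E → ZMod 2) (c : ZMod 2) (w : Word sh X) :
    tw p c (bv k w) = sgn k (c * w.par p) • bv k w := by
  rw [tw, Finsupp.lift_apply, Finsupp.sum_single_index (by simp), one_smul]

theorem tw_zero (p : E → ZMod 2) (t : Tens k sh X) : tw p 0 t = t := by
  have : tw p 0 = (LinearMap.id : Tens k sh X →ₗ[k] _) :=
    tens_ext fun w => by simp [tw_bv, sgn_zero]
  rw [this]; rfl

theorem tw_tw (p : E → ZMod 2) (c d : ZMod 2) (t : Tens k sh X) :
    tw p c (tw p d t) = tw p (c + d) t := by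
  have : tw p c ∘ₗ tw p d = (tw p (c + d) : Tens k sh X →ₗ[k] _) :=
    tens_ext fun w => by
      rw [LinearMap.comp_apply, tw_bv, map_smul, tw_bv, tw_bv, smul_smul, add_mul, sgn_add,
        mul_comm]
  exact LinearMap.congr_fun this t

theorem tw_tmul (p : E → ZMod 2) (c : ZMod 2) (a : Tens k sh X) (b : Tens k sh Y) :
    tw p c (tmul a b) = tmul (tw p c a) (tw p c b) := by
  have : tmul.compr₂ (tw p c) =
      (tmul.compl₁₂ (tw p c) (tw p c) : Tens k sh X →ₗ[k] Tens k sh Y →ₗ[k] _) :=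
    tens_ext fun u => tens_ext fun v => by
      rw [LinearMap.compr₂_apply, LinearMap.compl₁₂_apply, tmul_bv, tw_bv, tw_bv, tw_bv,
        map_smul, map_smul, LinearMap.smul_apply, tmul_bv, smul_smul, Word.par_append, mul_add,
        sgn_add, mul_comm]
  exact LinearMap.congr_fun₂ this a b

theorem tw_eq_sum (p : E → ZMod 2) (c : ZMod 2) :
    (tw p c : Tens k sh X →ₗ[k] _) = ∑ i, sgn k (c * i) • part p i := by
  refine tens_ext fun w => ?_
  rw [LinearMap.sum_apply, tw_bv, Finset.sum_eq_single (w.par p)]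
  · rw [LinearMap.smul_apply, part_bv, if_pos rfl]
  · intro i _ hi
    rw [LinearMap.smul_apply, part_bv, if_neg (Ne.symm hi), smul_zero]
  · simp

/-- Linear maps which are homogeneous of parity `c`. -/
def IsHom (p : E → ZMod 2) (c : ZMod 2) (f : Tens k sh X →ₗ[k] Tens k sh Y) : Prop :=
  ∀ i, part p i ∘ₗ f = f ∘ₗ part p (i + c)

theorem IsHom.tw {p : E → ZMod 2} {c : ZMod 2} {f : Tens k sh X →ₗ[k] Tens k sh Y}
    (hf : IsHom p c f) (d : ZMod 2) (t : Tens k sh X) :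
    tw p d (f t) = sgn k (d * c) • f (tw p d t) := by
  have h1 : ∀ i, part p i (f t) = f (part p (i + c) t) := fun i => LinearMap.congr_fun (hf i) t
  rw [tw_eq_sum, tw_eq_sum, LinearMap.sum_apply, LinearMap.sum_apply, map_sum, Finset.smul_sum]
  refine Fintype.sum_equiv (Equiv.addRight c) _ _ fun i => ?_
  rw [LinearMap.smul_apply, LinearMap.smul_apply, h1, map_smul, smul_smul, Equiv.coe_addRight,
    mul_add, sgn_add, mul_left_comm, sgn_mul_self, mul_one]

theorem isHom_crossMap (p : E → ZMod 2) (x y : S) :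
    IsHom p 0 (crossMap p x y : Tens k sh _ →ₗ[k] _) := by
  refine fun i => tens_ext fun w => ?_
  rw [LinearMap.comp_apply, LinearMap.comp_apply, add_zero, part_bv, crossMap_bv, map_smul,
    part_bv]
  have e : w.rev.par p = w.par p := by simp [Word.par, Word.rev]
  rw [e]
  split_ifs with hi
  · rw [crossMap_bv]
  · rw [smul_zero, map_zero]

namespace Realization

variable {p : E → ZMod 2} (F : Realization C sh p)

theorem isHom_elem (e : C.toSignature.Elem) : IsHom p e.par (elemMap p F.act e) := by
  cases e with
  | cross x y => exact isHom_crossMap p x y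
  | of g => exact F.homog g

theorem layerMap_bv (act : GenAct C sh) (L : C.toSignature.Layer X Y) (x : Word sh L.left) (y : Word sh L.elem.dom)
    (z : Word sh L.right) :
    layerMap p act L (bv k ((x.append (y.append z)).cast L.dom_eq.symm)) =
      sgn k (L.elem.par * x.par p) • Finsupp.lmapDomain k k
        (fun v => (x.append (v.append z)).cast L.cod_eq.symm) (elemMap p act L.elem (bv k y)) := by
  have h : ((x.append (y.append z)).cast L.dom_eq.symm).cast L.dom_eq = x.append (y.append z) := rfl
  rw [layerMap, Finsupp.lift_apply, Finsupp.sum_single_index (by simp), one_smul, h,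
    Word.fst_append, Word.snd_append, Word.fst_append, Word.snd_append]

theorem exists_split (L : C.toSignature.Layer X Y) (w : Word sh X) :
    ∃ (x : Word sh L.left) (y : Word sh L.elem.dom) (z : Word sh L.right),
      w = (x.append (y.append z)).cast L.dom_eq.symm :=
  ⟨(w.cast L.dom_eq).fst, (w.cast L.dom_eq).snd.fst, (w.cast L.dom_eq).snd.snd, by
    rw [Word.append_fst_snd, Word.append_fst_snd]; rfl⟩

theorem isHom_layer (L : C.toSignature.Layer X Y) :
    IsHom p L.elem.par (layerMap p F.act L) := by
  refine fun i => tens_ext fun w => ?_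
  obtain ⟨x, y, z, rfl⟩ := exists_split L w
  rw [LinearMap.comp_apply, LinearMap.comp_apply, part_bv]
  have h1 : ∀ t : Tens k sh L.elem.cod, part p i (Finsupp.lmapDomain k k
      (fun v => (x.append (v.append z)).cast L.cod_eq.symm) t) =
      Finsupp.lmapDomain k k (fun v => (x.append (v.append z)).cast L.cod_eq.symm)
        (part p (i + x.par p + z.par p) t) := by
    intro t
    refine LinearMap.congr_fun (f := part p i ∘ₗ Finsupp.lmapDomain k k _)
      (g := Finsupp.lmapDomain k k _ ∘ₗ part p (i + x.par p + z.par p)) (tens_ext fun v => ?_) t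
    have e : ∀ v : Word sh L.elem.cod, Word.par p ((x.append (v.append z)).cast L.cod_eq.symm) =
        x.par p + (v.par p + z.par p) := fun v => by
      rw [← Word.par_append, ← Word.par_append]; rfl
    have h2 : ∀ a b c i : ZMod 2, a + (b + c) = i ↔ b = i + a + c := by decide
    rw [LinearMap.comp_apply, LinearMap.comp_apply, Finsupp.lmapDomain_apply,
      Finsupp.mapDomain_single, part_bv, part_bv, e]
    simp only [h2]
    split_ifs <;> simp [bv]
  rw [layerMap_bv, map_smul, h1, ← LinearMap.comp_apply (part p _), F.isHom_elem,
    LinearMap.comp_apply, part_bv]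
  have e : Word.par p ((x.append (y.append z)).cast L.dom_eq.symm) =
      x.par p + (y.par p + z.par p) := by
    rw [← Word.par_append, ← Word.par_append]; rfl
  have h2 : ∀ a b c i j : ZMod 2, a + (b + c) = i + j ↔ b = i + a + c + j := by decide
  rw [e]
  simp only [h2]
  split_ifs
  · rw [layerMap_bv]
  · simp

theorem isHom_path (P : C.Diag X Y) : IsHom p P.par (pathMap p F.act P) := by
  induction P with
  | nil => intro i; rw [Path.par, add_zero]; rfl
  | cons L P ih =>
    intro i
    rw [pathMap, Path.par, ← LinearMap.comp_assoc, ih i, LinearMap.comp_assoc,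
      F.isHom_layer L, ← LinearMap.comp_assoc]
    congr 2
    ring

/-- `(id ⊗ e ⊗ id)(a ⊗ t ⊗ b) = (-1)^(|e||a|) a ⊗ e(t) ⊗ b`. -/
theorem emb_layerMap (act : GenAct C sh) (L : C.toSignature.Layer X Y) (t' : Tens k sh X) (a : Tens k sh L.left)
    (t : Tens k sh L.elem.dom) (b : Tens k sh L.right) (h : emb t' = emb a * emb t * emb b) :
    emb (layerMap p act L t') =
      emb (tw p L.elem.par a) * emb (elemMap p act L.elem t) * emb b := by
  have ht : t' = tcast L.dom_eq.symm (tmul a (tmul t b)) := emb_injective (by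
    rw [h, emb_tcast, emb_tmul, emb_tmul, mul_assoc])
  rw [ht]
  clear ht h
  induction a using Finsupp.induction_linear with
  | zero => simp
  | add f g hf hg => simp only [map_add, LinearMap.add_apply, hf, hg, add_mul]
  | single x c =>
  induction t using Finsupp.induction_linear with
  | zero => simp
  | add f g hf hg => simp only [map_add, LinearMap.add_apply, hf, hg, add_mul, mul_add]
  | single y d =>
  induction b using Finsupp.induction_linear with
  | zero => simp
  | add f g hf hg => simp only [map_add, hf, hg, mul_add]
  | single z r =>
    have hx : (Finsupp.single x c : Tens k sh _) = c • bv k x := by simp [bv]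
    have hy : (Finsupp.single y d : Tens k sh _) = d • bv k y := by simp [bv]
    have hz : (Finsupp.single z r : Tens k sh _) = r • bv k z := by simp [bv]
    rw [hx, hy, hz]
    simp only [map_smul, LinearMap.smul_apply, tmul_bv, tcast_bv, layerMap_bv, tw_bv,
      smul_mul_assoc, mul_smul_comm]
    have key : ∀ s : Tens k sh L.elem.cod, emb (Finsupp.lmapDomain k k
        (fun v => (x.append (v.append z)).cast L.cod_eq.symm) s) =
        emb (bv k x) * emb s * emb (bv k z) := by
      intro s
      induction s using Finsupp.induction_linear with
      | zero => simp
      | add f g hf hg => rw [map_add, map_add, map_add, hf, hg, mul_add, add_mul]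
      | single v q =>
        have hv : (Finsupp.single v q : Tens k sh _) = q • bv k v := by simp [bv]
        rw [hv, map_smul, map_smul, map_smul, Finsupp.lmapDomain_apply, Finsupp.mapDomain_single,
          emb_bv, emb_bv, emb_bv, emb_bv, mul_smul_comm, smul_mul_assoc]
        simp only [Word.append, Word.cast, ew_append, mul_assoc]
    rw [key]

theorem layerMap_whiskerLeft (L : C.toSignature.Layer X Y) (a : Tens k sh Z) (t : Tens k sh X) :
    layerMap p F.act (L.whiskerLeft Z) (tmul a t) =
      tmul (tw p L.elem.par a) (layerMap p F.act L t) := by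
  have : (layerMap p F.act (L.whiskerLeft Z)) ∘ₗ tmul a =
      tmul (tw p L.elem.par a) ∘ₗ layerMap p F.act L := by
    refine tens_ext fun w => ?_
    obtain ⟨x, y, z, rfl⟩ := exists_split L w
    apply emb_injective
    rw [LinearMap.comp_apply, LinearMap.comp_apply, emb_tmul]
    have e : emb (bv k ((x.append (y.append z)).cast L.dom_eq.symm)) =
        emb (bv k x) * emb (bv k y) * emb (bv k z) := by
      simp only [emb_bv, Word.cast, Word.append, ew_append, mul_assoc]
    have h1 : emb (tmul a (bv k ((x.append (y.append z)).cast L.dom_eq.symm))) =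
        emb (tmul a (bv k x)) * emb (bv k y) * emb (bv k z) := by
      rw [emb_tmul, e, emb_tmul]; simp only [mul_assoc]
    have h2 : emb (layerMap p F.act (L.whiskerLeft Z)
        (tmul a (bv k ((x.append (y.append z)).cast L.dom_eq.symm)))) =
        emb (tw p L.elem.par (tmul a (bv k x))) * emb (elemMap p F.act L.elem (bv k y)) *
          emb (bv k z) :=
      emb_layerMap F.act (L.whiskerLeft Z) _ (tmul a (bv k x)) (bv k y) (bv k z) h1
    rw [emb_layerMap F.act L _ _ _ _ e, h2, tw_tmul, emb_tmul]
    simp only [mul_assoc]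
  exact LinearMap.congr_fun this t

theorem layerMap_whiskerRight (L : C.toSignature.Layer X Y) (t : Tens k sh X) (b : Tens k sh Z) :
    layerMap p F.act (L.whiskerRight Z) (tmul t b) = tmul (layerMap p F.act L t) b := by
  have : (layerMap p F.act (L.whiskerRight Z)) ∘ₗ tmul.flip b =
      tmul.flip b ∘ₗ layerMap p F.act L := by
    refine tens_ext fun w => ?_
    obtain ⟨x, y, z, rfl⟩ := exists_split L w
    apply emb_injective
    rw [LinearMap.comp_apply, LinearMap.comp_apply, LinearMap.flip_apply, LinearMap.flip_apply,
      emb_tmul]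
    have e : emb (bv k ((x.append (y.append z)).cast L.dom_eq.symm)) =
        emb (bv k x) * emb (bv k y) * emb (bv k z) := by
      simp only [emb_bv, Word.cast, Word.append, ew_append, mul_assoc]
    have h1 : emb (tmul (bv k ((x.append (y.append z)).cast L.dom_eq.symm)) b) =
        emb (bv k x) * emb (bv k y) * emb (tmul (bv k z) b) := by
      rw [emb_tmul, e, emb_tmul]; simp only [mul_assoc]
    have h2 : emb (layerMap p F.act (L.whiskerRight Z)
        (tmul (bv k ((x.append (y.append z)).cast L.dom_eq.symm)) b)) =
        emb (tw p L.elem.par (bv k x)) * emb (elemMap p F.act L.elem (bv k y)) *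
          emb (tmul (bv k z) b) :=
      emb_layerMap F.act (L.whiskerRight Z) _ (bv k x) (bv k y) (tmul (bv k z) b) h1
    rw [emb_layerMap F.act L _ _ _ _ e, h2, emb_tmul]
    simp only [mul_assoc]
  exact LinearMap.congr_fun this t

theorem pathMap_whiskerLeft (P : C.Diag X Y) (a : Tens k sh Z) (t : Tens k sh X) :
    pathMap p F.act (P.whiskerLeft Z) (tmul a t) = tmul (tw p P.par a) (pathMap p F.act P t) := by
  induction P generalizing a with
  | nil => rw [Path.par, tw_zero]; rfl
  | cons L P ih =>
    simp only [Path.whiskerLeft, pathMap, LinearMap.comp_apply]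
    rw [layerMap_whiskerLeft, ih, tw_tw, Path.par, add_comm]

theorem pathMap_whiskerRight (P : C.Diag X Y) (t : Tens k sh X) (b : Tens k sh Z) :
    pathMap p F.act (P.whiskerRight Z) (tmul t b) = tmul (pathMap p F.act P t) b := by
  induction P with
  | nil => rfl
  | cons L P ih =>
    simp only [Path.whiskerRight, pathMap, LinearMap.comp_apply]
    rw [layerMap_whiskerRight, ih]

theorem pathMap_comp (P : C.Diag X Y) (Q : C.Diag Y Z) :
    pathMap p F.act (P.comp Q) = pathMap p F.act Q ∘ₗ pathMap p F.act P := by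
  induction P with
  | nil => rfl
  | cons L P ih => simp only [Path.comp, pathMap, ih, LinearMap.comp_assoc]

theorem emb_step (act : GenAct C sh) (a b : List S) (e : C.toSignature.Elem) (hX : X = a ++ (e.dom ++ b))
    (hY : Y = a ++ (e.cod ++ b)) (P : C.Diag Y Z) (t' : Tens k sh X) (s : Tens k sh a)
    (t : Tens k sh e.dom) (r : Tens k sh b) (h : emb t' = emb s * emb t * emb r) :
    ∃ t'' : Tens k sh Y, pathMap p act (Path.step a e b Y P hX hY) t' = pathMap p act P t'' ∧
      emb t'' = emb (tw p e.par s) * emb (elemMap p act e t) * emb r :=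
  ⟨_, rfl, emb_layerMap act ⟨a, e, b, hX, hY⟩ t' s t r h⟩

/-- The word with one letter. -/
def one {x : S} (a : E) (ha : sh a = x) : Word sh [x] := ⟨[a], congrArg (fun x => [x]) ha⟩

theorem emb_cross (act : GenAct C sh) (a b : List S) (x y : S) (hX : X = a ++ ([x, y] ++ b))
    (hY : Y = a ++ ([y, x] ++ b)) (P : C.Diag Y Z) (t' : Tens k sh X) (s : Tens k sh a) (i j : E)
    (hi : sh i = x) (hj : sh j = y) (r : Tens k sh b)
    (h : emb t' = emb s * (ew k [i] * ew k [j]) * emb r) :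
    ∃ t'' : Tens k sh Y,
      pathMap p act (Path.step a (.cross x y) b Y P hX hY) t' = pathMap p act P t'' ∧
      emb t'' = sgn k (p i * p j) • (emb s * (ew k [j] * ew k [i]) * emb r) := by
  obtain ⟨t'', h1, h2⟩ := emb_step act a b (.cross x y) hX hY P t' s
    (bv k (⟨[i, j], by rw [← hi, ← hj]; rfl⟩ : Word sh [x, y])) r (by
      rw [h]; congr 2; exact ((emb_bv _).trans (ew_cons _ _)).symm)
  refine ⟨t'', h1, h2.trans ?_⟩
  have h3 : emb (tw p (Elem.cross x y : C.toSignature.Elem).par s) = emb s :=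
    congrArg emb (tw_zero p s)
  have h4 : emb (elemMap p act (.cross x y)
      (bv k (⟨[i, j], by rw [← hi, ← hj]; rfl⟩ : Word sh [x, y]))) =
      sgn k (p i * p j) • (ew k [j] * ew k [i]) := by
    refine (congrArg emb (crossMap_bv p _)).trans ?_
    rw [map_smul, emb_bv]
    simp [Word.rev, ew_cons j [i]]
  rw [h3, h4]
  simp only [mul_smul_comm, smul_mul_assoc]

theorem layer_apply (act : GenAct C sh) {M : Type w} [Fintype M] (a b : List S)
    (e : C.toSignature.Elem) (hX : X = a ++ (e.dom ++ b)) (hY : Y = a ++ (e.cod ++ b))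
    (w : Word sh X) (x : Word sh a) (y : Word sh e.dom) (z : Word sh b)
    (hw : w.1 = x.1 ++ (y.1 ++ z.1)) (c : M → k) (u : M → Word sh e.cod)
    (hy : elemMap p act e (bv k y) = ∑ m, c m • bv k (u m)) (w' : M → Word sh Y)
    (hw' : ∀ m, (w' m).1 = x.1 ++ ((u m).1 ++ z.1)) :
    layerMap p act ⟨a, e, b, hX, hY⟩ (bv k w) =
      ∑ m, (sgn k (e.par * x.par p) * c m) • bv k (w' m) := by
  have h1 : w = (x.append (y.append z)).cast hX.symm := Word.ext hw
  have h2 : ∀ m, (x.append ((u m).append z)).cast hY.symm = w' m :=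
    fun m => Word.ext (hw' m).symm
  rw [h1]
  refine (layerMap_bv act ⟨a, e, b, hX, hY⟩ x y z).trans ?_
  rw [hy, map_sum, Finset.smul_sum]
  refine Finset.sum_congr rfl fun m _ => ?_
  rw [map_smul, Finsupp.lmapDomain_apply, Finsupp.mapDomain_single, smul_smul]
  simp only [h2]

/-- The empty word. -/
def nilW (sh : E → S) : Word sh [] := ⟨[], rfl⟩

theorem emb_nilW : emb (bv k (nilW sh)) = 1 := (emb_bv _).trans ew_nil

theorem emb_tw_nilW (c : ZMod 2) : emb (tw p c (bv k (nilW sh))) = 1 := by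
  rw [tw_bv]
  simp [nilW, Word.par, sgn_zero, emb_bv, ew_nil]

theorem emb_one {x : S} (a : E) (ha : sh a = x) : emb (bv k (one a ha)) = ew k [a] := emb_bv _

theorem exists_one {x : S} (w : Word sh [x]) : ∃ (a : E) (ha : sh a = x), w = one a ha := by
  obtain ⟨l, hl⟩ := w
  match l, hl with
  | [a], hl => exact ⟨a, by simpa using hl, rfl⟩

theorem exists_cons {x : S} (w : Word sh (x :: X)) : ∃ (a : E) (ha : sh a = x) (u : Word sh X),
    w.1 = a :: u.1 := by
  obtain ⟨l, hl⟩ := w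
  match l, hl with
  | a :: l, hl =>
    rw [List.map_cons, List.cons.injEq] at hl
    exact ⟨a, hl.1, ⟨l, hl.2⟩, rfl⟩

theorem emb_crossWord (X : List S) (z : S) (b : E) (hb : sh b = z) (s : Tens k sh X) :
    emb (pathMap p F.act (Path.crossWord X z) (tmul s (bv k (one b hb)))) =
      ew k [b] * emb (tw p (p b) s) := by
  induction X with
  | nil =>
    have : ∀ s : Tens k sh [], emb (tmul s (bv k (one b hb))) = ew k [b] * emb (tw p (p b) s) := by
      intro s
      refine LinearMap.congr_fun (f := emb ∘ₗ tmul.flip (bv k (one b hb)))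
        (g := LinearMap.mulLeft k (ew k [b]) ∘ₗ emb ∘ₗ tw p (p b)) (tens_ext fun w => ?_) s
      have hw : w = nilW sh := Word.ext (List.map_eq_nil_iff.1 w.2)
      rw [LinearMap.comp_apply, LinearMap.flip_apply, emb_tmul, LinearMap.comp_apply,
        LinearMap.comp_apply, LinearMap.mulLeft_apply, hw, emb_nilW, emb_tw_nilW, one_mul, mul_one,
        emb_one]
    exact this s
  | cons x X ih =>
    refine LinearMap.congr_fun (f := emb ∘ₗ pathMap p F.act (Path.crossWord (x :: X) z) ∘ₗ
        tmul.flip (bv k (one b hb)))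
      (g := LinearMap.mulLeft k (ew k [b]) ∘ₗ emb ∘ₗ tw p (p b)) (tens_ext fun w => ?_) s
    obtain ⟨a, ha, u, hu⟩ := exists_cons w
    have hw : w = (one a ha).append u := Word.ext hu
    rw [LinearMap.comp_apply, LinearMap.comp_apply, LinearMap.flip_apply, LinearMap.comp_apply,
      LinearMap.comp_apply, LinearMap.mulLeft_apply, tw_bv, map_smul, emb_bv, hu, ew_cons a u.1]
    have e1 : tmul (bv k w) (bv k (one b hb)) =
        tmul (bv k (one a ha)) (tmul (bv k u) (bv k (one b hb))) := by
      rw [tmul_bv, tmul_bv, tmul_bv]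
      congr 1
      exact Word.ext (by simp [Word.append, hu, one])
    rw [e1]
    have e2 : pathMap p F.act (Path.crossWord (x :: X) z : C.Diag _ _) =
        pathMap p F.act (Path.step [] (.cross x z) X (z :: x :: X) (.nil _) : C.Diag _ _) ∘ₗ
          pathMap p F.act ((Path.crossWord X z).whiskerLeft [x] : C.Diag _ _) :=
      F.pathMap_comp _ _
    have e3 := F.pathMap_whiskerLeft (Path.crossWord X z) (bv k (one a ha))
      (tmul (bv k u) (bv k (one b hb)))
    rw [CatPres.par_crossWord, tw_zero] at e3
    have e4 : emb (tmul (bv k (one a ha))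
        (pathMap p F.act (Path.crossWord X z) (tmul (bv k u) (bv k (one b hb))))) =
        emb (bv k (nilW sh)) * (ew k [a] * ew k [b]) * emb (tw p (p b) (bv k u)) := by
      rw [emb_tmul, ih, emb_one, emb_nilW, one_mul, mul_assoc]
    obtain ⟨t'', h1, h2⟩ := emb_cross (p := p) F.act [] X x z (Z := z :: x :: X) rfl rfl (.nil _) _ _ a b ha hb _ e4
    have e5 := (LinearMap.congr_fun e2 (tmul (bv k (one a ha))
      (tmul (bv k u) (bv k (one b hb))))).trans ((congrArg _ e3).trans h1)
    refine (congrArg emb e5).trans (h2.trans ?_)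
    rw [emb_nilW, one_mul, tw_bv, map_smul, emb_bv, mul_smul_comm, smul_smul, mul_smul_comm,
      mul_assoc, ← sgn_add]
    congr 2
    rw [hw, Word.par_append]
    simp [Word.par, one]
    ring

theorem pathMap_local {P : C.Diag X Y} {c : k} {Q : C.Diag X Y} (h : C.LocalRel X Y P c Q) :
    pathMap p F.act P = c • pathMap p F.act Q := by
  cases h with
  | interchange e f c =>
    refine tens_ext fun w => emb_injective ?_
    obtain ⟨u, m, v, rfl⟩ : ∃ (u : Word sh e.dom) (m : Word sh c) (v : Word sh f.dom),
        w = u.append (m.append v) :=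
      ⟨w.fst, w.snd.fst, w.snd.snd, by rw [Word.append_fst_snd, Word.append_fst_snd]⟩
    have e0 : emb (bv k (u.append (m.append v))) =
        emb (bv k u) * emb (bv k m) * emb (bv k v) := by
      simp only [emb_bv, Word.append, ew_append, mul_assoc]
    obtain ⟨t₁, h1, h2⟩ := emb_step (p := p) F.act [] (c ++ f.dom) e (Y := e.cod ++ (c ++ f.dom)) rfl rfl
      (.step (e.cod ++ c) f [] (e.cod ++ (c ++ f.cod)) (.nil _) (by simp) (by simp))
      (bv k (u.append (m.append v))) (bv k (nilW sh)) (bv k u) (tmul (bv k m) (bv k v))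
      (by rw [e0, emb_nilW, emb_tmul, one_mul, mul_assoc])
    obtain ⟨t₂, h3, h4⟩ := emb_step (p := p) F.act (e.cod ++ c) [] f (Y := e.cod ++ (c ++ f.cod)) (by simp)
      (by simp) (.nil _) t₁ (tmul (elemMap p F.act e (bv k u)) (bv k m)) (bv k v) (bv k (nilW sh))
      (by rw [h2, emb_tw_nilW, emb_nilW, emb_tmul, emb_tmul, one_mul, mul_one, mul_assoc])
    obtain ⟨t₃, h5, h6⟩ := emb_step (p := p) F.act (e.dom ++ c) [] f (Y := e.dom ++ (c ++ f.cod)) (by simp)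
      (by simp) (.step [] e (c ++ f.cod) (e.cod ++ (c ++ f.cod)) (.nil _))
      (bv k (u.append (m.append v))) (tmul (bv k u) (bv k m)) (bv k v) (bv k (nilW sh))
      (by rw [e0, emb_nilW, emb_tmul, mul_one])
    obtain ⟨t₄, h7, h8⟩ := emb_step (p := p) F.act [] (c ++ f.cod) e (Y := e.cod ++ (c ++ f.cod)) rfl rfl
      (.nil _) t₃ (bv k (nilW sh)) (tw p f.par (bv k u))
      (tmul (tw p f.par (bv k m)) (elemMap p F.act f (bv k v)))
      (by rw [h6, tw_tmul, emb_tmul, emb_tmul, emb_nilW, one_mul, mul_one, mul_assoc])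
    rw [h1, h3, LinearMap.smul_apply, h5, h7, map_smul]
    refine h4.trans (Eq.trans ?_ (congrArg _ h8.symm))
    rw [emb_tw_nilW, emb_nilW, emb_tmul, tw_tmul, emb_tmul, mul_one, one_mul,
      (F.isHom_elem e).tw, map_smul, smul_mul_assoc, smul_mul_assoc, mul_comm f.par, mul_assoc]
  | symm x y =>
    refine tens_ext fun w => emb_injective ?_
    obtain ⟨i, hi, u, hu⟩ := exists_cons w
    obtain ⟨j, hj, rfl⟩ := exists_one u
    have e0 : emb (bv k w) = emb (bv k (nilW sh)) * (ew k [i] * ew k [j]) * emb (bv k (nilW sh)) := by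
      rw [emb_bv, hu, ew_cons i, emb_nilW, one_mul, mul_one]; rfl
    obtain ⟨t₁, h1, h2⟩ := emb_cross (p := p) F.act [] [] x y (Y := [y, x]) rfl rfl
      (.step [] (.cross y x) [] [x, y] (.nil _)) (bv k w) _ i j hi hj _ e0
    obtain ⟨t₂, h3, h4⟩ := emb_cross (p := p) F.act [] [] y x (Y := [x, y]) rfl rfl (.nil _) t₁
      (sgn k (p i * p j) • bv k (nilW sh)) j i hj hi (bv k (nilW sh))
      (by rw [h2, map_smul, smul_mul_assoc, smul_mul_assoc])
    rw [h1, h3, LinearMap.smul_apply, one_smul]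
    refine h4.trans ?_
    change _ = emb (bv k w)
    rw [e0, map_smul, smul_mul_assoc, smul_mul_assoc, smul_smul, mul_comm (p j), sgn_mul_self,
      one_smul]
  | braid x y z =>
    refine tens_ext fun w => emb_injective ?_
    obtain ⟨i, hi, u, hu⟩ := exists_cons w
    obtain ⟨j, hj, v, hv⟩ := exists_cons u
    obtain ⟨l, hl, rfl⟩ := exists_one v
    have e0 : emb (bv k w) = ew k [i] * (ew k [j] * ew k [l]) := by
      rw [emb_bv, hu, hv, ew_cons i, ew_cons j]; rfl
    obtain ⟨t₁, h1, g1⟩ := emb_cross (p := p) F.act [] [z] x y (Y := [y, x, z]) rfl rfl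
      (.step [y] (.cross x z) [] [y, z, x] <| .step [] (.cross y z) [x] [z, y, x] <| .nil _)
      (bv k w) (bv k (nilW sh)) i j hi hj (bv k (one l hl))
      (by rw [e0, emb_nilW, emb_one, one_mul, mul_assoc])
    obtain ⟨t₂, h2, g2⟩ := emb_cross (p := p) F.act [y] [] x z (Y := [y, z, x]) rfl rfl
      (.step [] (.cross y z) [x] [z, y, x] <| .nil _)
      t₁ (sgn k (p i * p j) • bv k (one j hj)) i l hi hl (bv k (nilW sh))
      (by simp only [g1, map_smul, smul_mul_assoc, emb_nilW, emb_one, one_mul, mul_one, mul_assoc])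
    obtain ⟨t₃, h3, g3⟩ := emb_cross (p := p) F.act [] [x] y z (Y := [z, y, x]) rfl rfl (.nil _)
      t₂ ((sgn k (p i * p l) * sgn k (p i * p j)) • bv k (nilW sh)) j l hj hl (bv k (one i hi))
      (by simp only [g2, map_smul, smul_mul_assoc, emb_nilW, emb_one, one_mul, mul_one, mul_assoc,
            smul_smul])
    obtain ⟨s₁, h4, g4⟩ := emb_cross (p := p) F.act [x] [] y z (Y := [x, z, y]) rfl rfl
      (.step [] (.cross x z) [y] [z, x, y] <| .step [z] (.cross x y) [] [z, y, x] <| .nil _)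
      (bv k w) (bv k (one i hi)) j l hj hl (bv k (nilW sh))
      (by rw [e0, emb_nilW, emb_one, mul_one])
    obtain ⟨s₂, h5, g5⟩ := emb_cross (p := p) F.act [] [y] x z (Y := [z, x, y]) rfl rfl
      (.step [z] (.cross x y) [] [z, y, x] <| .nil _)
      s₁ (sgn k (p j * p l) • bv k (nilW sh)) i l hi hl (bv k (one j hj))
      (by simp only [g4, map_smul, smul_mul_assoc, emb_nilW, emb_one, one_mul, mul_one, mul_assoc])
    obtain ⟨s₃, h6, g6⟩ := emb_cross (p := p) F.act [z] [] x y (Y := [z, y, x]) rfl rfl (.nil _)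
      s₂ ((sgn k (p i * p l) * sgn k (p j * p l)) • bv k (one l hl)) i j hi hj (bv k (nilW sh))
      (by simp only [g5, map_smul, smul_mul_assoc, emb_nilW, emb_one, one_mul, mul_one, mul_assoc,
            smul_smul])
    rw [h1, h2, h3, LinearMap.smul_apply, one_smul, h4, h5, h6]
    refine g3.trans (Eq.trans ?_ g6.symm)
    simp only [map_smul, smul_mul_assoc, emb_nilW, emb_one, one_mul, mul_one, mul_assoc, smul_smul]
    congr 1
    ring
  | natural g z =>
    refine tens_ext fun w => emb_injective ?_
    obtain ⟨u, v, rfl⟩ : ∃ (u : Word sh (C.dom g)) (v : Word sh [z]), w = u.append v :=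
      ⟨w.fst, w.snd, by rw [Word.append_fst_snd]⟩
    obtain ⟨b, hb, rfl⟩ := exists_one v
    rw [← tmul_bv, LinearMap.smul_apply, one_smul, pathMap_comp, LinearMap.comp_apply]
    have e0 : emb (tmul (bv k u) (bv k (one b hb))) =
        emb (bv k (nilW sh)) * emb (bv k u) * emb (bv k (one b hb)) := by
      rw [emb_tmul, emb_nilW, one_mul]
    obtain ⟨t₁, h1, g1⟩ := emb_step (p := p) F.act [] [z] (.of g) (X := C.dom g ++ [z]) (Y := C.cod g ++ [z])
      rfl rfl (Path.crossWord (C.cod g) z) (tmul (bv k u) (bv k (one b hb))) (bv k (nilW sh))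
      (bv k u) (bv k (one b hb)) e0
    have e1 : t₁ = tmul (F.act g (bv k u)) (bv k (one b hb)) := emb_injective (by
      rw [g1, emb_tw_nilW, one_mul, emb_tmul]; rfl)
    refine (congrArg emb h1).trans ?_
    rw [e1, emb_crossWord]
    have e3 : emb (pathMap p F.act (Path.crossWord (C.dom g) z)
        (tmul (bv k u) (bv k (one b hb)))) =
        emb (bv k (one b hb)) * emb (tw p (p b) (bv k u)) * emb (bv k (nilW sh)) := by
      rw [emb_crossWord, emb_one, emb_nilW, mul_one]
    obtain ⟨t₂, h2, g2⟩ := emb_step (p := p) F.act [z] [] (.of g) (X := z :: C.dom g) (Y := z :: C.cod g)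
      (by simp [Elem.dom]) (by simp [Elem.cod]) (.nil _)
      (pathMap p F.act (Path.crossWord (C.dom g) z) (tmul (bv k u) (bv k (one b hb))))
      (bv k (one b hb)) (tw p (p b) (bv k u)) (bv k (nilW sh)) e3
    have g3 : emb t₂ = emb (tw p (C.par g) (bv k (one b hb))) *
        emb (F.act g (tw p (p b) (bv k u))) * emb (bv k (nilW sh)) := g2
    rw [h2]
    refine Eq.trans ?_ g3.symm
    rw [IsHom.tw (F.homog g), emb_nilW, mul_one, tw_bv, tw_bv]
    simp only [map_smul, emb_one, mul_smul_comm, smul_mul_assoc, smul_smul]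
    congr 1
    rw [mul_comm]
    congr 1
    simp [Word.par, one, mul_comm]
  | rel P c Q h => exact F.resp _ _ _ _ _ h

theorem tmul_ext {M : Type w} [AddCommGroup M] [Module k M] {f g : Tens k sh (X ++ Y) →ₗ[k] M}
    (h : ∀ a b, f (tmul a b) = g (tmul a b)) : f = g :=
  tens_ext fun w => by
    have := h (bv k w.fst) (bv k w.snd)
    rwa [tmul_bv, Word.append_fst_snd] at this

theorem pathMap_rel {P : C.Diag X Y} {c : k} {Q : C.Diag X Y} (h : C.Rel X Y P c Q) :
    pathMap p F.act P = c • pathMap p F.act Q := by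
  induction h with
  | loc h => exact F.pathMap_local h
  | whiskerLeft a h ih =>
    refine tmul_ext fun s t => ?_
    rw [LinearMap.smul_apply, pathMap_whiskerLeft, pathMap_whiskerLeft, ih]
    rcases C.rel_par h with rfl | hp
    · simp
    · rw [hp, LinearMap.smul_apply, map_smul]
  | whiskerRight b h ih =>
    refine tmul_ext fun s t => ?_
    rw [LinearMap.smul_apply, pathMap_whiskerRight, pathMap_whiskerRight, ih,
      LinearMap.smul_apply, map_smul, LinearMap.smul_apply]
  | precomp s h ih => rw [pathMap_comp, pathMap_comp, ih, LinearMap.smul_comp]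
  | postcomp h t ih => rw [pathMap_comp, pathMap_comp, ih, LinearMap.comp_smul]

/-- The monoidal super functor on morphisms. On objects it sends the word `X` to the tensor product
`Tens k sh X`. -/
def map {X Y : List S} : C.Hom X Y →ₗ[k] (Tens k sh X →ₗ[k] Tens k sh Y) :=
  C.liftHom (pathMap p F.act) fun _ _ _ h => F.pathMap_rel h

end Realization

end Tensors

/-! ## The centraliser coalgebra of a monoidal super functor -/

section Centraliser

variable {k : Type u} [Field k] {S : Type} [DecidableEq S] {E : Type v} [Fintype E]
  {sh : E → S} {p : E → ZMod 2} {C : CatPres k S} {X Y Z : List S}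

open Signature

/-- The dual space `F(X)*`. -/
abbrev DualTens (k : Type u) [Field k] (sh : E → S) (X : List S) : Type (max u v) :=
  Module.Dual k (Tens k sh X)

/-- The dual basis element given by a word. -/
abbrev dbv (k : Type u) [Field k] {sh : E → S} {X : List S} (w : Word sh X) : DualTens k sh X :=
  Finsupp.lapply w

/-- The direct sum of the spaces `F(X)* ⊗ F(X)`, over all objects `X`. -/
abbrev PreCEnd (k : Type u) [Field k] (sh : E → S) : Type (max u v) :=
  ⨁ X : List S, (DualTens k sh X ⊗[k] Tens k sh X)

instance : AddCommGroup (PreCEnd k sh) := Module.addCommMonoidToAddCommGroup k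

/-- The inclusion of the summand `F(X)* ⊗ F(X)`. -/
def incl (X : List S) : (DualTens k sh X ⊗[k] Tens k sh X) →ₗ[k] PreCEnd k sh :=
  DirectSum.lof k (List S) (fun X => DualTens k sh X ⊗[k] Tens k sh X) X

theorem toModule_incl {M : Type w} [AddCommGroup M] [Module k M]
    (T : ∀ X : List S, (DualTens k sh X ⊗[k] Tens k sh X) →ₗ[k] M) (X : List S)
    (x : DualTens k sh X ⊗[k] Tens k sh X) :
    DirectSum.toModule k (List S) M T (incl X x) = T X x :=
  DirectSum.toModule_lof (R := k) (M := fun X => DualTens k sh X ⊗[k] Tens k sh X) (φ := T) X x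

/-- The tensor product `α ⊗ β` of functionals:
`(α ⊗ β)(v ⊗ w) = (-1)^(|β||v|) α(v) β(w)`. -/
def dualMul (p : E → ZMod 2) :
    DualTens k sh X →ₗ[k] DualTens k sh Y →ₗ[k] DualTens k sh (X ++ Y) :=
  LinearMap.mk₂ k
    (fun α β => Finsupp.lift k k _ fun w =>
      sgn k (w.snd.par p * w.fst.par p) * (α (bv k w.fst) * β (bv k w.snd)))
    (fun α α' β => tens_ext fun w => by simp; ring)
    (fun c α β => tens_ext fun w => by simp; ring)
    (fun α β β' => tens_ext fun w => by simp; ring)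
    (fun c α β => tens_ext fun w => by simp; ring)

theorem dualMul_bv (α : DualTens k sh X) (β : DualTens k sh Y) (u : Word sh X) (w : Word sh Y) :
    dualMul p α β (tmul (bv k u) (bv k w)) =
      sgn k (w.par p * u.par p) * (α (bv k u) * β (bv k w)) := by
  rw [tmul_bv, dualMul, LinearMap.mk₂_apply, Finsupp.lift_apply,
    Finsupp.sum_single_index (by simp), one_smul, Word.fst_append, Word.snd_append]

/-- The multiplication `(α ⊗ v)(β ⊗ w) = (-1)^(|v||β|) (α ⊗ β) ⊗ (v ⊗ w)`; the summand for `i`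
is the contribution of the component of parity `i` of `β`. -/
def mulPiece (p : E → ZMod 2) (X Y : List S) :
    (DualTens k sh X ⊗[k] Tens k sh X) →ₗ[k] (DualTens k sh Y ⊗[k] Tens k sh Y) →ₗ[k]
      (DualTens k sh (X ++ Y) ⊗[k] Tens k sh (X ++ Y)) :=
  ∑ i : ZMod 2, TensorProduct.map₂ ((dualMul p).compl₂ (part p i).dualMap) (tmul ∘ₗ tw p i)

theorem mulPiece_tmul (α : DualTens k sh X) (v : Tens k sh X) (β : DualTens k sh Y)
    (w : Tens k sh Y) : mulPiece p X Y (α ⊗ₜ v) (β ⊗ₜ w) =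
      ∑ i, dualMul p α (β ∘ₗ part p i) ⊗ₜ[k] tmul (tw p i v) w := by
  simp only [mulPiece, LinearMap.sum_apply, TensorProduct.map₂_apply_tmul, LinearMap.comp_apply]
  rfl

theorem dualMul_part (α : DualTens k sh X) (β : DualTens k sh Y) (i : ZMod 2) (v : Tens k sh X)
    (w : Tens k sh Y) :
    dualMul p α (β ∘ₗ part p i) (tmul v w) = α (tw p i v) * β (part p i w) := by
  refine LinearMap.congr_fun₂ (f := tmul.compr₂ (dualMul p α (β ∘ₗ part p i)))
    (g := (LinearMap.mul k k).compl₁₂ (α ∘ₗ tw p i) (β ∘ₗ part p i))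
    (tens_ext fun u => tens_ext fun w => ?_) v w
  rw [LinearMap.compr₂_apply, dualMul_bv, LinearMap.compl₁₂_apply, LinearMap.comp_apply,
    LinearMap.comp_apply, tw_bv, part_bv, map_smul, LinearMap.mul_apply', smul_eq_mul]
  split_ifs with h
  · rw [h, mul_assoc]
  · simp

namespace Realization

variable (F : Realization C sh p)

/-- The relations `α F(f) ⊗ v = α ⊗ F(f) v`, for morphisms `f : X → Y`. -/
def cendRel : Submodule k (PreCEnd k sh) :=
  Submodule.span k {r | ∃ (X Y : List S) (f : C.Hom X Y) (α : DualTens k sh Y) (v : Tens k sh X),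
    r = incl X ((α ∘ₗ F.map f) ⊗ₜ v) - incl Y (α ⊗ₜ F.map f v)}

/-- The centraliser coalgebra of the functor. -/
abbrev CEnd : Type (max u v) := PreCEnd k sh ⧸ F.cendRel

/-- The map `F(X)* ⊗ F(X) → CEnd(F)`. -/
def cls (X : List S) : (DualTens k sh X ⊗[k] Tens k sh X) →ₗ[k] F.CEnd :=
  F.cendRel.mkQ ∘ₗ incl X

theorem cls_map (f : C.Hom X Y) (α : DualTens k sh Y) (v : Tens k sh X) :
    F.cls X ((α ∘ₗ F.map f) ⊗ₜ v) = F.cls Y (α ⊗ₜ F.map f v) := by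
  rw [← sub_eq_zero, cls, cls, LinearMap.comp_apply, LinearMap.comp_apply, ← map_sub]
  exact (Submodule.Quotient.mk_eq_zero _).2 (Submodule.subset_span ⟨X, Y, f, α, v, rfl⟩)

theorem map_diag (P : C.Diag X Y) : F.map (C.diag P) = pathMap p F.act P := C.liftHom_diag _ _ _

theorem cls_path (P : C.Diag X Y) (α : DualTens k sh Y) (v : Tens k sh X) :
    F.cls X ((α ∘ₗ pathMap p F.act P) ⊗ₜ v) = F.cls Y (α ⊗ₜ pathMap p F.act P v) := by
  rw [← map_diag, cls_map]

/-- Linear maps out of the centraliser coalgebra. -/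
def liftC {M : Type w} [AddCommGroup M] [Module k M]
    (T : ∀ X : List S, (DualTens k sh X ⊗[k] Tens k sh X) →ₗ[k] M)
    (hT : ∀ (X Y : List S) (P : C.Diag X Y) (α : DualTens k sh Y) (v : Tens k sh X),
      T X ((α ∘ₗ pathMap p F.act P) ⊗ₜ v) = T Y (α ⊗ₜ pathMap p F.act P v)) : F.CEnd →ₗ[k] M :=
  F.cendRel.liftQ (DirectSum.toModule k (List S) M T) (by
    rw [cendRel, Submodule.span_le]
    rintro _ ⟨X, Y, f, α, v, rfl⟩
    rw [SetLike.mem_coe, LinearMap.mem_ker, map_sub, toModule_incl,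
      toModule_incl, sub_eq_zero]
    induction f using C.hom_induction with
    | hd P => rw [map_diag]; exact hT X Y P α v
    | h0 => simp
    | hadd f g hf hg =>
      rw [map_add, LinearMap.comp_add, TensorProduct.add_tmul, map_add, hf, hg,
        LinearMap.add_apply, TensorProduct.tmul_add, map_add]
    | hsmul c f hf =>
      rw [map_smul, LinearMap.comp_smul, ← TensorProduct.smul_tmul', map_smul, hf,
        LinearMap.smul_apply, TensorProduct.tmul_smul, map_smul])

theorem liftC_cls {M : Type w} [AddCommGroup M] [Module k M]
    (T : ∀ X : List S, (DualTens k sh X ⊗[k] Tens k sh X) →ₗ[k] M) (hT) (X : List S)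
    (x : DualTens k sh X ⊗[k] Tens k sh X) : F.liftC T hT (F.cls X x) = T X x := by
  rw [liftC, cls, LinearMap.comp_apply, Submodule.mkQ_apply, Submodule.liftQ_apply,
    toModule_incl]

theorem cend_ext {M : Type w} [AddCommGroup M] [Module k M] {f g : F.CEnd →ₗ[k] M}
    (h : ∀ X α v, f (F.cls X (α ⊗ₜ v)) = g (F.cls X (α ⊗ₜ v))) : f = g :=
  Submodule.linearMap_qext _ (DirectSum.linearMap_ext _ fun X => TensorProduct.ext'
    fun α v => h X α v)

/-- The counit `α ⊗ v ↦ α(v)`. -/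
def counit : F.CEnd →ₗ[k] k :=
  F.liftC (fun X => contractLeft k (Tens k sh X)) fun X Y P α v => by
    rw [contractLeft_apply, contractLeft_apply]; rfl

/-- The comultiplication `α ⊗ v ↦ ∑ w, (α ⊗ w) ⊗ (w* ⊗ v)`, the sum being over a basis. -/
def comul : F.CEnd →ₗ[k] F.CEnd ⊗[k] F.CEnd :=
  F.liftC
    (fun X => ∑ w : Word sh X, TensorProduct.map
      (F.cls X ∘ₗ (TensorProduct.mk k (DualTens k sh X) (Tens k sh X)).flip (bv k w))
      (F.cls X ∘ₗ TensorProduct.mk k (DualTens k sh X) (Tens k sh X) (dbv k w)))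
    fun X Y P α v => by
      simp only [LinearMap.sum_apply, TensorProduct.map_tmul, LinearMap.comp_apply,
        LinearMap.flip_apply, TensorProduct.mk_apply]
      set f := pathMap p F.act P with hf
      have h1 : ∀ t : Tens k sh Y, t = ∑ u : Word sh Y, t u • bv k u := fun t => by
        conv_lhs => rw [← Finsupp.univ_sum_single t]
        simp [bv]
      have h2 : ∀ u : Word sh Y, dbv k u ∘ₗ f = ∑ w : Word sh X, f (bv k w) u • dbv k w := fun u =>
        tens_ext fun w => by
          rw [LinearMap.sum_apply, Finset.sum_eq_single w]
          · simp
          · intro b _ hb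
            simp [Finsupp.single_eq_of_ne hb]
          · simp
      have h3 : ∀ w : Word sh X, F.cls X ((α ∘ₗ f) ⊗ₜ bv k w) =
          ∑ u : Word sh Y, f (bv k w) u • F.cls Y (α ⊗ₜ bv k u) := fun w => by
        rw [hf, cls_path, ← hf]
        conv_lhs => rw [h1 (f (bv k w))]
        simp only [TensorProduct.tmul_sum, TensorProduct.tmul_smul, map_sum, map_smul]
      have h4 : ∀ u : Word sh Y, F.cls Y (dbv k u ⊗ₜ f v) =
          ∑ w : Word sh X, f (bv k w) u • F.cls X (dbv k w ⊗ₜ v) := fun u => by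
        rw [hf, ← cls_path, ← hf, h2]
        simp only [TensorProduct.sum_tmul, ← TensorProduct.smul_tmul', map_sum, map_smul]
      simp only [h3, h4, TensorProduct.sum_tmul, TensorProduct.tmul_sum,
        TensorProduct.smul_tmul', TensorProduct.tmul_smul]
      exact Finset.sum_comm

/-- The unit element, the class of `id ⊗ 1` in `F(𝟙)* ⊗ F(𝟙)`, where `F(𝟙) = k`. -/
def cone : F.CEnd := F.cls [] (dbv k (nilW sh) ⊗ₜ bv k (nilW sh))

theorem cls_mul_left (P : C.Diag X Y) (α : DualTens k sh Y) (v : Tens k sh X)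
    (y : DualTens k sh Z ⊗[k] Tens k sh Z) :
    F.cls (X ++ Z) (mulPiece p X Z ((α ∘ₗ pathMap p F.act P) ⊗ₜ v) y) =
      F.cls (Y ++ Z) (mulPiece p Y Z (α ⊗ₜ pathMap p F.act P v) y) := by
  induction y using TensorProduct.induction_on with
  | zero => simp
  | add a b ha hb => rw [map_add, map_add, ha, hb, map_add, map_add]
  | tmul β w =>
    rw [mulPiece_tmul, mulPiece_tmul, map_sum, map_sum]
    refine Finset.sum_congr rfl fun i _ => ?_
    have h1 : dualMul p (α ∘ₗ pathMap p F.act P) (β ∘ₗ part p i) = sgn k (i * P.par) •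
        (dualMul p α (β ∘ₗ part p i) ∘ₗ pathMap p F.act (P.whiskerRight Z)) :=
      tmul_ext fun a b => by
        rw [dualMul_part, LinearMap.smul_apply, LinearMap.comp_apply, LinearMap.comp_apply,
          pathMap_whiskerRight, dualMul_part, (F.isHom_path P).tw, map_smul, smul_eq_mul,
          smul_eq_mul, ← mul_assoc, ← mul_assoc, sgn_mul_self, one_mul]
    rw [h1, ← TensorProduct.smul_tmul', map_smul, cls_path, pathMap_whiskerRight,
      (F.isHom_path P).tw, map_smul, LinearMap.smul_apply, TensorProduct.tmul_smul, map_smul]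

theorem cls_mul_right (P : C.Diag X Y) (α : DualTens k sh Y) (v : Tens k sh X)
    (y : DualTens k sh Z ⊗[k] Tens k sh Z) :
    F.cls (Z ++ X) (mulPiece p Z X y ((α ∘ₗ pathMap p F.act P) ⊗ₜ v)) =
      F.cls (Z ++ Y) (mulPiece p Z Y y (α ⊗ₜ pathMap p F.act P v)) := by
  induction y using TensorProduct.induction_on with
  | zero => simp
  | add a b ha hb =>
    rw [map_add, map_add, LinearMap.add_apply, LinearMap.add_apply, map_add, map_add, ha, hb]
  | tmul β w =>
    rw [mulPiece_tmul, mulPiece_tmul, map_sum, map_sum]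
    refine Fintype.sum_equiv (Equiv.addRight P.par) _ _ fun i => ?_
    rw [Equiv.coe_addRight]
    have h2 : i + P.par + P.par = i := by
      rw [add_assoc, CharTwo.add_self_eq_zero, add_zero]
    have h1 : dualMul p β ((α ∘ₗ pathMap p F.act P) ∘ₗ part p i) =
        dualMul p β (α ∘ₗ part p (i + P.par)) ∘ₗ pathMap p F.act (P.whiskerLeft Z) :=
      tmul_ext fun a b => by
        rw [dualMul_part, LinearMap.comp_apply, LinearMap.comp_apply,
          pathMap_whiskerLeft, dualMul_part, tw_tw, h2]
        congr 2
        have := LinearMap.congr_fun (F.isHom_path P (i + P.par)) b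
        rw [LinearMap.comp_apply, LinearMap.comp_apply, h2] at this
        exact this.symm
    rw [h1, cls_path, pathMap_whiskerLeft, tw_tw, add_comm P.par]

/-- The multiplication, `(α ⊗ v)(β ⊗ w) = (-1)^(|v||β|) (α ⊗ β) ⊗ (v ⊗ w)`. -/
def cmul : F.CEnd →ₗ[k] F.CEnd →ₗ[k] F.CEnd :=
  F.liftC
    (fun X => LinearMap.flip (F.liftC
      (fun Y => LinearMap.flip ((mulPiece p X Y).compr₂ (F.cls (X ++ Y))))
      (fun Y Y' P α v => LinearMap.ext fun y => F.cls_mul_right P α v y)))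
    (fun X X' P α v => F.cend_ext fun Y β w => by
      rw [LinearMap.flip_apply, LinearMap.flip_apply, liftC_cls, liftC_cls]
      exact F.cls_mul_left P α v (β ⊗ₜ w))

theorem cmul_cls (x : DualTens k sh X ⊗[k] Tens k sh X) (y : DualTens k sh Y ⊗[k] Tens k sh Y) :
    F.cmul (F.cls X x) (F.cls Y y) = F.cls (X ++ Y) (mulPiece p X Y x y) := by
  rw [cmul, liftC_cls, LinearMap.flip_apply, liftC_cls]
  rfl

/-- The part of parity `i`: the span of the classes of `α ⊗ v` with homogeneous `α` and `v` such
that `|α| + |v| = i`. -/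
def cgr (i : ZMod 2) : Submodule k F.CEnd :=
  Submodule.span k {x | ∃ (X : List S) (u w : Word sh X), u.par p + w.par p = i ∧
    x = F.cls X (dbv k u ⊗ₜ bv k w)}

end Realization

end Centraliser

/-! ## Coactions and matrix coefficients -/

section Coaction

variable {k : Type u} [Field k] {S : Type} {E : Type v} {sh : E → S} {X : List S}
  {O : Type w} [Ring O] [Algebra k O]

/-- Matrix coefficients of tensor products: if `e b ↦ ∑ a, e a ⊗ c a b` on letters, then
`e b ⊗ v ↦ ∑ a, ∑ u, (-1)^(|c a b||u|) (e a ⊗ u) ⊗ c a b * d u v` on words, where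
`v ↦ ∑ u, u ⊗ d u v`. -/
def coeff (k : Type u) [Field k] [Algebra k O] (p : E → ZMod 2) (c : E → E → O) :
    List E → List E → O
  | [], [] => 1
  | a :: u, b :: v => sgn k ((p a + p b) * (u.map p).sum) • (c a b * coeff k p c u v)
  | _, _ => 0

/-- The coaction on a tensor product of letters. -/
def coact [Fintype E] (p : E → ZMod 2) (c : E → E → O) : Tens k sh X →ₗ[k] Tens k sh X ⊗[k] O :=
  Finsupp.lift _ k _ fun v => ∑ u : Word sh X, bv k u ⊗ₜ[k] coeff k p c u.1 v.1

/-- The matrix coefficient `[α|v] = (α ⊗ id)(coaction v)`. -/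
def matCoeff [Fintype E] (p : E → ZMod 2) (c : E → E → O) (α : DualTens k sh X) (v : Tens k sh X) :
    O :=
  TensorProduct.lid k O (TensorProduct.map α LinearMap.id (coact p c v))

/-- The map `α ⊗ v ↦ [α|v]` is a well defined isomorphism of super bialgebras from the centraliser
coalgebra of the functor `F` to `𝒪[G]`. Here `c` contains the coaction on the letters. -/
def PhiIsIso [DecidableEq S] [Fintype E] {p : E → ZMod 2} {C : CatPres k S}
    (F : Realization C sh p) {ι : Type v} [Fintype ι] [DecidableEq ι] {p' : ι → ZMod 2}
    (G : GroupEqs k p') (c : E → E → G.O) : Prop :=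
  ∃ φ : F.CEnd ≃ₗ[k] G.O,
    (∀ (X : List S) (α : DualTens k sh X) (v : Tens k sh X),
      φ (F.cls X (α ⊗ₜ v)) = matCoeff p c α v) ∧
    φ F.cone = 1 ∧
    (∀ x y, φ (F.cmul x y) = φ x * φ y) ∧
    (∀ x, G.counit (φ x) = F.counit x) ∧
    (∀ x, G.comul (φ x) = GradedTensorProduct.of k G.pres.gr G.pres.gr
      (TensorProduct.map φ.toLinearMap φ.toLinearMap (F.comul x))) ∧
    ∀ i, (F.cgr i).map φ.toLinearMap = G.pres.gr i

end Coaction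

/-! ## The Brauer category and the periplectic Brauer category -/

section Brauer

open Signature Signature.Path

/-- The generating morphisms of the Brauer category and of its periplectic analogue. -/
inductive BrauerGen : Type
  | cap
  | cup

/-- The cap `[2] → [0]` and the cup `[0] → [2]`, of parity `c`. Words in one letter are the
objects `[n]`. -/
def brauerSig (c : ZMod 2) : Signature Unit where
  Gen := BrauerGen
  dom | .cap => [(), ()] | .cup => []
  cod | .cap => [] | .cup => [(), ()]
  par _ := c

variable {k : Type u} [Field k]

/-- The relations between caps and cups: symmetry of the cap, symmetry of the cup, the two
straightening relations, and the value `δ` of the loop. -/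
inductive BrauerRel (c : ZMod 2) (δ : k) :
    ∀ X Y : List Unit, (brauerSig c).Path X Y → k → (brauerSig c).Path X Y → Prop
  | capSymm : BrauerRel c δ [(), ()] []
      (step [] (.cross () ()) [] [(), ()] <| step [] (.of .cap) [] _ <| .nil _) 1
      (step [] (.of .cap) [] _ <| .nil _)
  | cupSymm : BrauerRel c δ [] [(), ()]
      (step [] (.of .cup) [] [(), ()] <| step [] (.cross () ()) [] _ <| .nil _) (sgn k c)
      (step [] (.of .cup) [] _ <| .nil _)
  | straight₁ : BrauerRel c δ [()] [()]
      (step [()] (.of .cup) [] [(), (), ()] <| step [] (.of .cap) [()] _ <| .nil _) 1 (.nil _)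
  | straight₂ : BrauerRel c δ [()] [()]
      (step [] (.of .cup) [()] [(), (), ()] <| step [()] (.of .cap) [] _ <| .nil _) (sgn k c)
      (.nil _)
  | loop : BrauerRel c δ [] []
      (step [] (.of .cup) [] [(), ()] <| step [] (.of .cap) [] _ <| .nil _) δ (.nil _)

theorem BrauerRel.homog (c : ZMod 2) (δ : k) (X Y P a Q) (h : BrauerRel c δ X Y P a Q) :
    a = 0 ∨ P.par = Q.par := by
  have hc : c + c = 0 := CharTwo.add_self_eq_zero _
  cases h <;> right <;> simp [step, Path.par, Elem.par, brauerSig, hc]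

/-- The Brauer category with parity `c` of cap and cup and with loop value `δ`. -/
def brauerPres (c : ZMod 2) (δ : k) : CatPres k Unit where
  toSignature := brauerSig c
  rel := BrauerRel c δ
  homog := BrauerRel.homog c δ

/-- The Brauer category `ℬ(δ)`. -/
abbrev brauerCat (δ : k) : CatPres k Unit := brauerPres 0 δ

/-- The periplectic Brauer category `𝒜`, with odd cap and cup and with loops evaluated at `0`. -/
abbrev periplecticCat (k : Type u) [Field k] : CatPres k Unit := brauerPres 1 0

variable {ι : Type v} [Fintype ι] [DecidableEq ι]

/-- The unique letter is realised by the space with basis `ι`. -/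
abbrev unitSh (ι : Type v) : ι → Unit := fun _ => ()

/-- Matrix entries, indexed by words. -/
def entry (g : Matrix ι ι k) : List ι → k
  | [i, j] => g i j
  | _ => 0

/-- The word `[i, j]`. -/
def two (i j : ι) : Word (unitSh ι) [(), ()] := ⟨[i, j], rfl⟩

/-- The form with Gram matrix `g`, as a map on the tensor square. -/
def capMap (g : Matrix ι ι k) : Tens k (unitSh ι) [(), ()] →ₗ[k] Tens k (unitSh ι) [] :=
  Finsupp.lift _ k _ fun w => entry g w.1 • bv k (Realization.nilW _)

/-- The copairing `1 ↦ ∑ i j, (-1)^(c[j]) (g⁻¹) i j • e i ⊗ e j`. -/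
def cupMap (p : ι → ZMod 2) (c : ZMod 2) (g : Matrix ι ι k) :
    Tens k (unitSh ι) [] →ₗ[k] Tens k (unitSh ι) [(), ()] :=
  Finsupp.lift _ k _ fun _ => ∑ m : ι × ι, (sgn k (c * p m.2) * g⁻¹ m.1 m.2) • bv k (two m.1 m.2)

/-- The cap is mapped to the form with Gram matrix `g`, and the cup to the corresponding
copairing. -/
def brauerAct (p : ι → ZMod 2) (c : ZMod 2) (δ : k) (g : Matrix ι ι k) :
    GenAct (brauerPres c δ) (unitSh ι)
  | .cap => capMap g
  | .cup => cupMap p c g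

theorem step_apply {S : Type} {E : Type v} {sh : E → S} {C : CatPres k S} {p : E → ZMod 2}
    (act : GenAct C sh) {M : Type w} [Fintype M] {X Y Z : List S} (a b : List S)
    (e : C.toSignature.Elem) (hX : X = a ++ (e.dom ++ b)) (hY : Y = a ++ (e.cod ++ b))
    (P : C.Diag Y Z) (w : Word sh X) (x : Word sh a) (y : Word sh e.dom) (z : Word sh b)
    (hw : w.1 = x.1 ++ (y.1 ++ z.1)) (c : M → k) (u : M → Word sh e.cod)
    (hy : elemMap p act e (bv k y) = ∑ m, c m • bv k (u m)) (w' : M → Word sh Y)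
    (hw' : ∀ m, (w' m).1 = x.1 ++ ((u m).1 ++ z.1)) :
    pathMap p act (step a e b Y P hX hY) (bv k w) =
      ∑ m, (sgn k (e.par * x.par p) * c m) • pathMap p act P (bv k (w' m)) := by
  have h := Realization.layer_apply act a b e hX hY w x y z hw c u hy w' hw'
  refine (congrArg (pathMap p act P) h).trans ?_
  rw [map_sum]
  exact Finset.sum_congr rfl fun m _ => map_smul _ _ _

theorem step_single {S : Type} {E : Type v} {sh : E → S} {C : CatPres k S} {p : E → ZMod 2}
    (act : GenAct C sh) {X Y Z : List S} (a b : List S)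
    (e : C.toSignature.Elem) (hX : X = a ++ (e.dom ++ b)) (hY : Y = a ++ (e.cod ++ b))
    (P : C.Diag Y Z) (w : Word sh X) (x : Word sh a) (y : Word sh e.dom) (z : Word sh b)
    (hw : w.1 = x.1 ++ (y.1 ++ z.1)) (c : k) (u : Word sh e.cod)
    (hy : elemMap p act e (bv k y) = c • bv k u) (w' : Word sh Y)
    (hw' : w'.1 = x.1 ++ (u.1 ++ z.1)) :
    pathMap p act (step a e b Y P hX hY) (bv k w) =
      (sgn k (e.par * x.par p) * c) • pathMap p act P (bv k w') := by
  refine (step_apply act a b e hX hY P w x y z hw (fun _ : Unit => c) (fun _ => u)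
    (by simpa using hy) (fun _ => w') fun _ => hw').trans ?_
  simp

theorem cross_two {S : Type} {E : Type v} {sh : E → S} {C : CatPres k S} (act : GenAct C sh)
    (p : E → ZMod 2) {x y : S} (i j : E) (h : [i, j].map sh = [x, y]) (h' : [j, i].map sh = [y, x]) :
    elemMap p act (.cross x y) (bv k (⟨[i, j], h⟩ : Word sh [x, y])) =
      sgn k (p i * p j) • bv k (⟨[j, i], h'⟩ : Word sh [y, x]) := by
  refine (crossMap_bv p _).trans ?_
  simp [Word.rev]

theorem word_nil {S : Type} {E : Type v} {sh : E → S} (w : Word sh []) :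
    w = Realization.nilW sh := Word.ext (List.map_eq_nil_iff.1 w.2)

theorem par_nilW {S : Type} {E : Type v} {sh : E → S} (p : E → ZMod 2) :
    (Realization.nilW sh).par p = 0 := rfl

theorem lift_bv {S : Type} {E : Type v} {sh : E → S} {X : List S} {M : Type w} [AddCommGroup M]
    [Module k M] (f : Word sh X → M) (w : Word sh X) :
    Finsupp.lift M k (Word sh X) f (bv k w) = f w := by
  simp [bv]

theorem cap_two (g : Matrix ι ι k) (i j : ι) :
    capMap g (bv k (two i j)) = g i j • bv k (Realization.nilW (unitSh ι)) := by
  rw [capMap, lift_bv]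
  simp [entry, two]

theorem cup_nil (p : ι → ZMod 2) (c : ZMod 2) (g : Matrix ι ι k)
    (w : Word (unitSh ι) []) : cupMap p c g (bv k w) =
      ∑ m : ι × ι, (sgn k (c * p m.2) * g⁻¹ m.1 m.2) • bv k (two m.1 m.2) := by
  rw [cupMap, lift_bv]

theorem exists_two (w : Word (unitSh ι) [(), ()]) : ∃ i j, w = two i j := by
  obtain ⟨l, hl⟩ := w
  match l, hl with
  | [i, j], _ => exact ⟨i, j, rfl⟩

/-- A homogeneous, super symmetric and invertible Gram matrix. -/
structure IsGram (p : ι → ZMod 2) (c : ZMod 2) (g : Matrix ι ι k) : Prop where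
  homog : ∀ i j, p i + p j ≠ c → g i j = 0
  symm : ∀ i j, g i j = sgn k (p i * p j) * g j i
  inv : IsUnit g.det

namespace IsGram

variable {p : ι → ZMod 2} {c : ZMod 2} {g : Matrix ι ι k}

theorem mul_inv (h : IsGram p c g) (i l : ι) :
    ∑ j, g i j * g⁻¹ j l = if i = l then 1 else 0 := by
  rw [← Matrix.mul_apply, Matrix.mul_nonsing_inv _ h.inv, Matrix.one_apply]

theorem inv_mul (h : IsGram p c g) (i l : ι) :
    ∑ j, g⁻¹ i j * g j l = if i = l then 1 else 0 := by
  rw [← Matrix.mul_apply, Matrix.nonsing_inv_mul _ h.inv, Matrix.one_apply]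

theorem inv_homog (h : IsGram p c g) (i j : ι) (hij : p i + p j ≠ c) : g⁻¹ i j = 0 := by
  have h1 : g * Matrix.of (fun i j => if p i + p j = c then g⁻¹ i j else 0) = 1 := by
    ext a b
    rw [Matrix.mul_apply, Matrix.one_apply, ← h.mul_inv]
    by_cases hab : p a = p b
    · refine Finset.sum_congr rfl fun m _ => ?_
      by_cases hm : p a + p m = c
      · rw [Matrix.of_apply, if_pos (by rw [← hab, add_comm, hm])]
      · rw [h.homog _ _ hm, zero_mul, zero_mul]
    · rw [h.mul_inv, if_neg (fun e => hab (by rw [e]))]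
      refine Finset.sum_eq_zero fun m _ => ?_
      by_cases hm : p a + p m = c
      · rw [Matrix.of_apply, if_neg, mul_zero]
        intro hm'
        rw [← hm, add_comm] at hm'
        exact hab (add_right_cancel hm').symm
      · rw [h.homog _ _ hm, zero_mul]
  rw [Matrix.inv_eq_right_inv h1, Matrix.of_apply, if_neg hij]

theorem inv_symm (h : IsGram p c g) (i j : ι) : g⁻¹ i j = sgn k (p i * p j) * g⁻¹ j i := by
  have h1 : g * Matrix.of (fun i j => sgn k (p i * p j) * g⁻¹ j i) = 1 := by
    ext a b
    rw [Matrix.mul_apply, Matrix.one_apply]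
    have h2 : ∀ m, g a m * Matrix.of (fun i j => sgn k (p i * p j) * g⁻¹ j i) m b =
        g⁻¹ b m * g m a := by
      intro m
      rw [Matrix.of_apply]
      by_cases hm : p a + p m = c
      · by_cases hm' : p b + p m = c
        · have hab : p a = p b := add_right_cancel (hm.trans hm'.symm)
          rw [h.symm a m, hab, mul_comm (p m)]
          linear_combination (g m a * g⁻¹ b m) * sgn_mul_self k (p b * p m)
        · rw [h.inv_homog _ _ hm', mul_zero, mul_zero, zero_mul]
      · rw [h.homog _ _ hm, h.homog m a (by rwa [add_comm]), mul_zero, zero_mul]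
    rw [Finset.sum_congr rfl fun m _ => h2 m, h.inv_mul]
    simp only [eq_comm]
  conv_lhs => rw [Matrix.inv_eq_right_inv h1, Matrix.of_apply]

theorem straight₁ (h : IsGram p c g) (i l : ι) :
    ∑ j, (sgn k (c * p i) * (sgn k (c * p l) * g⁻¹ j l)) * g i j = if i = l then 1 else 0 := by
  have h1 : ∑ j, (sgn k (c * p i) * (sgn k (c * p l) * g⁻¹ j l)) * g i j =
      sgn k (c * p i) * sgn k (c * p l) * ∑ j, g i j * g⁻¹ j l := by
    rw [Finset.mul_sum]
    exact Finset.sum_congr rfl fun j _ => by ring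
  rw [h1, h.mul_inv]
  split_ifs with e
  · rw [e, sgn_mul_self, mul_one]
  · rw [mul_zero]

theorem straight₂ (h : IsGram p c g) (i j : ι) :
    ∑ l, (sgn k (c * p l) * g⁻¹ j l) * (sgn k (c * p j) * g l i) =
      sgn k c * if i = j then 1 else 0 := by
  have h1 : ∀ l, (sgn k (c * p l) * g⁻¹ j l) * (sgn k (c * p j) * g l i) =
      sgn k c * (g⁻¹ j l * g l i) := by
    intro l
    by_cases hjl : p j + p l = c
    · have : sgn k (c * p l) * sgn k (c * p j) = sgn k c := by
        rw [← sgn_add, ← mul_add, add_comm, hjl]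
        rcases parity_cases c with rfl | rfl <;> rfl
      rw [← this]
      ring
    · rw [h.inv_homog _ _ hjl]; ring
  rw [Finset.sum_congr rfl fun l _ => h1 l, ← Finset.mul_sum, h.inv_mul]
  simp only [eq_comm]

theorem cup_symm (h : IsGram p c g) (i j : ι) :
    sgn k (c * p j) * g⁻¹ i j * sgn k (p i * p j) = sgn k c * (sgn k (c * p i) * g⁻¹ j i) := by
  by_cases hij : p i + p j = c
  · have h1 : sgn k (c * p j) = sgn k c * sgn k (c * p i) := by
      rw [← sgn_add, ← hij]
      congr 1
      generalize p i = a
      generalize p j = b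
      revert a b
      decide
    rw [h.inv_symm i j, h1]
    linear_combination (sgn k c * sgn k (c * p i) * g⁻¹ j i) * sgn_mul_self k (p i * p j)
  · rw [h.inv_homog _ _ hij, h.inv_homog j i (by rwa [add_comm])]; ring

theorem loop (h : IsGram p c g) :
    ∑ m : ι × ι, (sgn k (c * p m.2) * g⁻¹ m.1 m.2) * g m.1 m.2 = ∑ i, sgn k (p i) := by
  rw [Fintype.sum_prod_type_right]
  refine Finset.sum_congr rfl fun j _ => ?_
  have h1 : ∀ i, (sgn k (c * p j) * g⁻¹ i j) * g i j = sgn k (p j) * (g j i * g⁻¹ i j) := by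
    intro i
    by_cases hij : p i + p j = c
    · have h2 : sgn k (c * p j) * sgn k (p i * p j) = sgn k (p j) := by
        rw [← sgn_add, ← hij]
        congr 1
        generalize p i = a
        generalize p j = b
        revert a b
        decide
      rw [h.symm i j, ← h2]
      ring
    · rw [h.inv_homog _ _ hij]; ring
  rw [Finset.sum_congr rfl fun i _ => h1 i, ← Finset.mul_sum, h.mul_inv, if_pos rfl, mul_one]

end IsGram

/-- A super space with an invertible odd endomorphism, or pairing, has super dimension zero. -/
theorem sdim_eq_zero (p : ι → ZMod 2) (A B : Matrix ι ι k) (hA : ∀ i j, p i + p j ≠ 1 → A i j = 0)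
    (hAB : A * B = 1) : ∑ i, sgn k (p i) = 0 := by
  have hBA : B * A = 1 := mul_eq_one_comm.1 hAB
  have h1 : ∀ i, ∑ j, A i j * B j i = 1 := fun i => by
    rw [← Matrix.mul_apply, hAB, Matrix.one_apply_eq]
  have h2 : ∀ j, ∑ i, B j i * A i j = 1 := fun j => by
    rw [← Matrix.mul_apply, hBA, Matrix.one_apply_eq]
  have h3 : ∑ i, (if p i = 0 then (1 : k) else 0) = ∑ j, (if p j = 1 then (1 : k) else 0) := by
    have e1 : ∑ i, (if p i = 0 then (1 : k) else 0) =
        ∑ i, ∑ j, (if p i = 0 then (1 : k) else 0) * (A i j * B j i) :=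
      Finset.sum_congr rfl fun i _ => by rw [← Finset.mul_sum, h1, mul_one]
    have e2 : ∑ j, (if p j = 1 then (1 : k) else 0) =
        ∑ j, ∑ i, (if p j = 1 then (1 : k) else 0) * (B j i * A i j) :=
      Finset.sum_congr rfl fun i _ => by rw [← Finset.mul_sum, h2, mul_one]
    rw [e1, e2, Finset.sum_comm]
    refine Finset.sum_congr rfl fun j _ => Finset.sum_congr rfl fun i _ => ?_
    by_cases hij : p i + p j = 1
    · have h4 : ∀ a b : ZMod 2, a + b = 1 → (a = 0 ↔ b = 1) := by decide
      simp only [h4 _ _ hij, mul_comm (A i j)]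
    · rw [hA _ _ hij, zero_mul, mul_zero, mul_zero, mul_zero]
  have h5 : ∀ i, sgn k (p i) = (if p i = 0 then (1 : k) else 0) - if p i = 1 then 1 else 0 := by
    intro i
    rcases parity_cases (p i) with e | e <;> rw [e] <;> simp [sgn_zero, sgn_one]
  rw [Finset.sum_congr rfl fun i _ => h5 i, Finset.sum_sub_distrib, h3, sub_self]

theorem par_two (p : ι → ZMod 2) (a b : ι) : (two a b).par p = p a + p b := by
  simp [Word.par, two]

theorem isHom_capMap {p : ι → ZMod 2} {c : ZMod 2} {g : Matrix ι ι k} (h : IsGram p c g) :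
    IsHom p c (capMap g) := by
  refine fun i => tens_ext fun w => ?_
  obtain ⟨a, b, rfl⟩ := exists_two w
  rw [LinearMap.comp_apply, LinearMap.comp_apply, part_bv, par_two, apply_ite (capMap g), cap_two,
    map_zero]
  by_cases hab : p a + p b = c
  · have h0 : (0 : ZMod 2) = i ↔ c = i + c := by rw [right_eq_add, eq_comm]
    simp only [map_smul, part_bv, par_nilW, hab, h0]
    split_ifs <;> simp
  · simp [h.homog a b hab]

theorem isHom_cupMap {p : ι → ZMod 2} {c : ZMod 2} {g : Matrix ι ι k} (h : IsGram p c g) :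
    IsHom p c (cupMap p c g) := by
  refine fun i => tens_ext fun w => ?_
  rw [LinearMap.comp_apply, LinearMap.comp_apply, part_bv, word_nil w, par_nilW,
    apply_ite (cupMap p c g), cup_nil, map_zero]
  have e3 : ∀ m : ι × ι, part p i ((sgn k (c * p m.2) * g⁻¹ m.1 m.2) • bv k (two m.1 m.2)) =
      if 0 = i + c then (sgn k (c * p m.2) * g⁻¹ m.1 m.2) • bv k (two m.1 m.2) else 0 := by
    intro m
    rw [map_smul, part_bv, par_two]
    by_cases hm : p m.1 + p m.2 = c
    · have h0 : ∀ c i : ZMod 2, c = i ↔ 0 = i + c := by decide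
      simp only [hm, h0 c i]
      split_ifs <;> simp
    · rw [h.inv_homog _ _ hm]; simp
  rw [map_sum, Finset.sum_congr rfl fun m _ => e3 m]
  split_ifs <;> simp

theorem brauerAct_resp (p : ι → ZMod 2) (c : ZMod 2) (δ : k) (g : Matrix ι ι k)
    (h : IsGram p c g) (hδ : ∑ i, sgn k (p i) = δ) (X Y P a Q) (r : BrauerRel c δ X Y P a Q) :
    pathMap p (brauerAct p c δ g) P = a • pathMap p (brauerAct p c δ g) Q := by
  set act := brauerAct p c δ g with hact
  let n := Realization.nilW (unitSh ι)
  let one : ι → Word (unitSh ι) [()] := fun i => ⟨[i], rfl⟩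
  let three : ι → ι → ι → Word (unitSh ι) [(), (), ()] := fun i j l => ⟨[i, j, l], rfl⟩
  have par1 : ∀ i, (one i).par p = p i := fun i => by simp [one, Word.par]
  have cap : ∀ i j, elemMap p act (.of BrauerGen.cap) (bv k (two i j)) =
      g i j • bv k n := cap_two g
  have cup : elemMap p act (.of BrauerGen.cup) (bv k n) =
      ∑ m : ι × ι, (sgn k (c * p m.2) * g⁻¹ m.1 m.2) • bv k (two m.1 m.2) := cup_nil p c g _
  have cr : ∀ i j, elemMap p act (.cross () ()) (bv k (two i j)) =
      sgn k (p i * p j) • bv k (two j i) := fun i j => cross_two act p i j rfl rfl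
  have exists_one : ∀ w : Word (unitSh ι) [()], ∃ i, w = one i := fun w => by
    obtain ⟨i, _, rfl⟩ := Realization.exists_one w; exact ⟨i, rfl⟩
  have z : ∀ c : ZMod 2, sgn k (c * 0) = 1 := fun c => by rw [mul_zero, sgn_zero]
  have z' : ∀ (c : ZMod 2) (n' : Word (unitSh ι) []), n' = n → sgn k (c * n'.par p) = 1 := by
    rintro c _ rfl; exact z c
  have sw : ∀ f : ι × ι → Tens k (unitSh ι) [(), ()],
      ∑ m : ι × ι, f m = ∑ m : ι × ι, f m.swap := fun f => by
    exact (Fintype.sum_equiv (Equiv.prodComm ι ι) _ _ fun _ => rfl)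
  cases r with
  | capSymm =>
    refine tens_ext fun w => ?_
    obtain ⟨i, j, rfl⟩ := exists_two w
    refine (step_single act [] [] (.cross () ()) rfl rfl _ (two i j) n (two i j) n rfl _ _ (cr i j)
      (two j i) rfl).trans ?_
    have h1 : ∀ i j, pathMap p act (step [] (.of BrauerGen.cap) [] [] (.nil []) rfl rfl)
        (bv k (two i j)) = g i j • bv k n := fun i j => by
      refine (step_single act [] [] (.of BrauerGen.cap) rfl rfl _ (two i j) n (two i j) n rfl _ _
        (cap i j) n rfl).trans ?_
      exact congrArg (fun x => x • bv k n) (by rw [z' _ n rfl, one_mul])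
    rw [LinearMap.smul_apply, one_smul]
    refine Eq.trans ?_ (h1 i j).symm
    refine (congrArg _ (h1 j i)).trans ?_
    rw [z' _ n rfl, one_mul, smul_smul, ← h.symm]
  | cupSymm =>
    refine tens_ext fun w => ?_
    rw [word_nil w]
    refine (step_apply act [] [] (.of BrauerGen.cup) rfl rfl _ n n n n rfl _ _ cup
      (fun m => two m.1 m.2) fun _ => rfl).trans ?_
    have h1 : ∀ i j, pathMap p act (step [] (.cross () ()) [] [(), ()] (.nil _) rfl rfl)
        (bv k (two i j)) = sgn k (p i * p j) • bv k (two j i) := fun i j => by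
      refine (step_single act [] [] (.cross () ()) rfl rfl _ (two i j) n (two i j) n rfl _ _
        (cr i j) (two j i) rfl).trans ?_
      exact congrArg (fun x => x • bv k (two j i)) (by rw [z' _ n rfl, one_mul])
    have h2 := step_apply act [] [] (.of BrauerGen.cup) rfl rfl (.nil [(), ()]) n n n n rfl _ _ cup
      (fun m => two m.1 m.2) fun _ => rfl
    rw [LinearMap.smul_apply]
    refine Eq.trans ?_ (congrArg _ h2.symm)
    refine (Finset.sum_congr rfl fun m _ => congrArg _ (h1 m.1 m.2)).trans ?_
    rw [sw, Finset.smul_sum]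
    refine Finset.sum_congr rfl fun m _ => ?_
    simp only [Prod.fst_swap, Prod.snd_swap]
    change _ = sgn k c • (_ • bv k (two m.1 m.2))
    rw [smul_smul, smul_smul]
    congr 1
    have h3 : Word.par p n = 0 := rfl
    rw [h3, z, one_mul, one_mul]
    exact h.cup_symm m.2 m.1
  | straight₁ =>
    refine tens_ext fun w => ?_
    obtain ⟨i, rfl⟩ := exists_one w
    refine (step_apply act [()] [] (.of BrauerGen.cup) rfl rfl _ (one i) (one i) n n rfl _ _ cup
      (fun m => three i m.1 m.2) fun _ => rfl).trans ?_
    have h1 : ∀ i j l, pathMap p act (step [] (.of BrauerGen.cap) [()] [()] (.nil _) rfl rfl)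
        (bv k (three i j l)) = g i j • bv k (one l) := fun i j l => by
      refine (step_single act [] [()] (.of BrauerGen.cap) rfl rfl _ (three i j l) n (two i j) (one l)
        rfl _ _ (cap i j) (one l) rfl).trans ?_
      exact congrArg (fun x => x • bv k (one l)) (by rw [z' _ n rfl, one_mul])
    refine (Finset.sum_congr rfl fun m _ => congrArg _ (h1 i m.1 m.2)).trans ?_
    rw [one_smul, Fintype.sum_prod_type_right]
    change _ = bv k (one i)
    have h2 : ∀ l, ∑ j, (sgn k (c * p i) * (sgn k (c * p l) * g⁻¹ j l)) • g i j • bv k (one l) =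
        (if i = l then 1 else 0 : k) • bv k (one l) := fun l => by
      rw [← h.straight₁, Finset.sum_smul]
      simp only [smul_smul]
    rw [par1]
    refine (Finset.sum_congr rfl fun l _ => h2 l).trans ?_
    simp
  | straight₂ =>
    refine tens_ext fun w => ?_
    obtain ⟨i, rfl⟩ := exists_one w
    refine (step_apply act [] [()] (.of BrauerGen.cup) rfl rfl _ (one i) n n (one i) rfl _ _ cup
      (fun m => three m.1 m.2 i) fun _ => rfl).trans ?_
    have h1 : ∀ j l, pathMap p act (step [()] (.of BrauerGen.cap) [] [()] (.nil _) rfl rfl)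
        (bv k (three j l i)) = (sgn k (c * p j) * g l i) • bv k (one j) := fun j l => by
      refine (step_single act [()] [] (.of BrauerGen.cap) rfl rfl _ (three j l i) (one j) (two l i) n
        rfl _ _ (cap l i) (one j) rfl).trans ?_
      rw [par1]
      rfl
    refine (Finset.sum_congr rfl fun m _ => congrArg _ (h1 m.1 m.2)).trans ?_
    rw [Fintype.sum_prod_type]
    change _ = sgn k c • bv k (one i)
    have h2 : ∀ j, ∑ l, (sgn k (c * 0) * (sgn k (c * p l) * g⁻¹ j l)) •
        (sgn k (c * p j) * g l i) • bv k (one j) =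
        (sgn k c * if i = j then 1 else 0 : k) • bv k (one j) := fun j => by
      rw [← h.straight₂, Finset.sum_smul]
      simp only [smul_smul, z, one_mul]
    refine (Finset.sum_congr rfl fun l _ => h2 l).trans ?_
    simp
  | loop =>
    refine tens_ext fun w => ?_
    rw [word_nil w]
    refine (step_apply act [] [] (.of BrauerGen.cup) rfl rfl _ n n n n rfl _ _ cup
      (fun m => two m.1 m.2) fun _ => rfl).trans ?_
    have h1 : ∀ i j, pathMap p act (step [] (.of BrauerGen.cap) [] [] (.nil []) rfl rfl)
        (bv k (two i j)) = g i j • bv k n := fun i j => by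
      refine (step_single act [] [] (.of BrauerGen.cap) rfl rfl _ (two i j) n (two i j) n rfl _ _
        (cap i j) n rfl).trans ?_
      exact congrArg (fun x => x • bv k n) (by rw [z' _ n rfl, one_mul])
    refine (Finset.sum_congr rfl fun m _ => congrArg _ (h1 m.1 m.2)).trans ?_
    change _ = δ • bv k n
    rw [← hδ, ← h.loop, Finset.sum_smul]
    refine Finset.sum_congr rfl fun m _ => ?_
    have h3 : Word.par p n = 0 := rfl
    rw [smul_smul, h3, z, one_mul]

/-- The monoidal super functor from the Brauer category, or from its periplectic analogue, given by
an even, respectively odd, form with Gram matrix `g`. -/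
def brauerFunctor (p : ι → ZMod 2) (c : ZMod 2) (δ : k) (g : Matrix ι ι k) (h : IsGram p c g)
    (hδ : ∑ i, sgn k (p i) = δ) : Realization (brauerPres c δ) (unitSh ι) p where
  act := brauerAct p c δ g
  homog
    | .cap => isHom_capMap h
    | .cup => isHom_cupMap h
  resp := brauerAct_resp p c δ g h hδ

end Brauer

/-! ## The oriented Brauer category and the oriented Brauer-Clifford category -/

section OrientedBrauer

open Signature Signature.Path

/-- The letters `∨` and `∧`. -/
inductive Arrow : Type
  | dn
  | up
  deriving DecidableEq

/-- The generating morphisms of the oriented Brauer category, and additional endomorphisms of `∨`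
indexed by `A`. -/
inductive OBGen (A : Type) : Type
  | ev
  | coev
  | endo (a : A)

/-- The even morphisms `ev : ∧ ∨ → 𝟙` and `coev : 𝟙 → ∨ ∧`, and odd endomorphisms of `∨`. -/
def obSig (A : Type) : Signature Arrow where
  Gen := OBGen A
  dom | .ev => [.up, .dn] | .coev => [] | .endo _ => [.dn]
  cod | .ev => [] | .coev => [.dn, .up] | .endo _ => [.dn]
  par | .ev => 0 | .coev => 0 | .endo _ => 1

variable {k : Type u} [Field k]

/-- The relations of a dual pair, the value `δ` of the loop, and for the additional endomorphisms
`q` of `∨` the relations that `q ∘ q = 1` and that the loop decorated by `q` vanishes. -/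
inductive OBRel (A : Type) (δ : k) :
    ∀ X Y : List Arrow, (obSig A).Path X Y → k → (obSig A).Path X Y → Prop
  | straight₁ : OBRel A δ [.dn] [.dn]
      (step [] (.of .coev) [.dn] [.dn, .up, .dn] <| step [.dn] (.of .ev) [] _ <| .nil _) 1 (.nil _)
  | straight₂ : OBRel A δ [.up] [.up]
      (step [.up] (.of .coev) [] [.up, .dn, .up] <| step [] (.of .ev) [.up] _ <| .nil _) 1 (.nil _)
  | loop : OBRel A δ [] []
      (step [] (.of .coev) [] [.dn, .up] <| step [] (.cross .dn .up) [] [.up, .dn] <|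
        step [] (.of .ev) [] _ <| .nil _) δ (.nil _)
  | square (a : A) : OBRel A δ [.dn] [.dn]
      (step [] (.of (.endo a)) [] [.dn] <| step [] (.of (.endo a)) [] _ <| .nil _) 1 (.nil _)
  | decorated (a : A) : OBRel A δ [] []
      (step [] (.of .coev) [] [.dn, .up] <| step [] (.of (.endo a)) [.up] [.dn, .up] <|
        step [] (.cross .dn .up) [] [.up, .dn] <| step [] (.of .ev) [] _ <| .nil _) 0 (.nil _)

theorem OBRel.homog (A : Type) (δ : k) (X Y P a Q) (h : OBRel A δ X Y P a Q) :
    a = 0 ∨ P.par = Q.par := by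
  have hc : (1 + 1 : ZMod 2) = 0 := rfl
  cases h with
  | decorated a => exact Or.inl rfl
  | _ => right; simp [step, Path.par, Elem.par, obSig, hc]

/-- The oriented Brauer category with odd endomorphisms of `∨` indexed by `A`. -/
def obPres (A : Type) (δ : k) : CatPres k Arrow where
  toSignature := obSig A
  rel := OBRel A δ
  homog := OBRel.homog A δ

/-- The oriented Brauer category `𝒪ℬ(δ)`. -/
abbrev obCat (δ : k) : CatPres k Arrow := obPres Empty δ

/-- The oriented Brauer-Clifford category `𝒪ℬ𝒞`, with one odd endomorphism of `∨` and with loops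
evaluated at `0`. -/
abbrev obcCat (k : Type u) [Field k] : CatPres k Arrow := obPres Unit 0

variable {ι : Type v} [Fintype ι] [DecidableEq ι]

/-- The letter `∨` is realised by the space with basis `e i`, and the letter `∧` by its dual. The
basis elements are `e i` for `Sum.inl i`, and the dual basis elements `(e i)*` for `Sum.inr i`. -/
abbrev arrowSh (ι : Type v) : ι ⊕ ι → Arrow := Sum.elim (fun _ => .dn) (fun _ => .up)

/-- The parities of the `e i` and the `(e i)*`. -/
abbrev dpar (p : ι → ZMod 2) : ι ⊕ ι → ZMod 2 := Sum.elim p p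

/-- The values of the evaluation on words. -/
def evEntry (k : Type u) [Field k] : List (ι ⊕ ι) → k
  | [.inr i, .inl j] => if i = j then 1 else 0
  | _ => 0

/-- The word `e i`. -/
def dnW (i : ι) : Word (arrowSh ι) [.dn] := ⟨[.inl i], rfl⟩

/-- The word `e i ⊗ (e j)*`. -/
def dnup (i j : ι) : Word (arrowSh ι) [.dn, .up] := ⟨[.inl i, .inr j], rfl⟩

/-- The images of words under the endomorphism with matrix `Q`. -/
def endoEntry (Q : Matrix ι ι k) : List (ι ⊕ ι) → Tens k (arrowSh ι) [.dn]
  | [.inl i] => ∑ j, Q j i • bv k (dnW j)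
  | _ => 0

/-- The evaluation `(e i)* ⊗ e j ↦ δ i j`. -/
def evMap (k : Type u) [Field k] (ι : Type v) [DecidableEq ι] :
    Tens k (arrowSh ι) [.up, .dn] →ₗ[k] Tens k (arrowSh ι) [] :=
  Finsupp.lift _ k _ fun w => evEntry k w.1 • bv k (Realization.nilW _)

/-- The coevaluation `1 ↦ ∑ i, e i ⊗ (e i)*`. -/
def coevMap (k : Type u) [Field k] (ι : Type v) [Fintype ι] :
    Tens k (arrowSh ι) [] →ₗ[k] Tens k (arrowSh ι) [.dn, .up] :=
  Finsupp.lift _ k _ fun _ => ∑ i, bv k (dnup i i)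

/-- The endomorphism `e i ↦ ∑ j, Q j i • e j`. -/
def endoMap (Q : Matrix ι ι k) : Tens k (arrowSh ι) [.dn] →ₗ[k] Tens k (arrowSh ι) [.dn] :=
  Finsupp.lift _ k _ fun w => endoEntry Q w.1

/-- `ev` is mapped to the evaluation, `coev` to the coevaluation, and the additional endomorphisms
to the endomorphisms with matrices `Q a`. -/
def obAct (A : Type) (δ : k) (Q : A → Matrix ι ι k) : GenAct (obPres A δ) (arrowSh ι)
  | .ev => evMap k ι
  | .coev => coevMap k ι
  | .endo a => endoMap (Q a)

/-- The word `(e i)* ⊗ e j`. -/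
def updn (i j : ι) : Word (arrowSh ι) [.up, .dn] := ⟨[.inr i, .inl j], rfl⟩

/-- The word `(e i)*`. -/
def upW (i : ι) : Word (arrowSh ι) [.up] := ⟨[.inr i], rfl⟩

theorem exists_dn {x : ι ⊕ ι} (h : arrowSh ι x = .dn) : ∃ i, x = .inl i := by
  cases x with
  | inl i => exact ⟨i, rfl⟩
  | inr i => cases h

theorem exists_up {x : ι ⊕ ι} (h : arrowSh ι x = .up) : ∃ i, x = .inr i := by
  cases x with
  | inl i => cases h
  | inr i => exact ⟨i, rfl⟩

theorem exists_dnW (w : Word (arrowSh ι) [.dn]) : ∃ i, w = dnW i := by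
  obtain ⟨x, hx, rfl⟩ := Realization.exists_one w
  obtain ⟨i, rfl⟩ := exists_dn hx
  exact ⟨i, rfl⟩

theorem exists_upW (w : Word (arrowSh ι) [.up]) : ∃ i, w = upW i := by
  obtain ⟨x, hx, rfl⟩ := Realization.exists_one w
  obtain ⟨i, rfl⟩ := exists_up hx
  exact ⟨i, rfl⟩

theorem exists_updn (w : Word (arrowSh ι) [.up, .dn]) : ∃ i j, w = updn i j := by
  obtain ⟨x, hx, v, hv⟩ := Realization.exists_cons w
  obtain ⟨i, rfl⟩ := exists_up hx
  obtain ⟨j, rfl⟩ := exists_dnW v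
  exact ⟨i, j, Word.ext hv⟩

theorem ev_updn (i j : ι) : evMap k ι (bv k (updn i j)) =
    (if i = j then 1 else 0 : k) • bv k (Realization.nilW (arrowSh ι)) := by
  rw [evMap, lift_bv]
  simp [evEntry, updn]

theorem coev_nil (w : Word (arrowSh ι) []) :
    coevMap k ι (bv k w) = ∑ i, (1 : k) • bv k (dnup i i) := by
  rw [coevMap, lift_bv]
  simp

theorem endo_dnW (Q : Matrix ι ι k) (i : ι) :
    endoMap Q (bv k (dnW i)) = ∑ j, Q j i • bv k (dnW j) := by
  rw [endoMap, lift_bv]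
  simp [endoEntry, dnW]

theorem isHom_evMap (p : ι → ZMod 2) : IsHom (dpar p) 0 (evMap k ι) := by
  refine fun i => tens_ext fun w => ?_
  obtain ⟨a, b, rfl⟩ := exists_updn w
  have h1 : (updn a b).par (dpar p) = p a + p b := by simp [Word.par, updn]
  rw [LinearMap.comp_apply, LinearMap.comp_apply, part_bv, h1, apply_ite (evMap k ι), ev_updn,
    map_zero, map_smul, part_bv, par_nilW, add_zero]
  by_cases hab : a = b
  · subst hab
    rw [CharTwo.add_self_eq_zero]
    split_ifs <;> simp
  · simp [hab]

theorem isHom_coevMap (p : ι → ZMod 2) : IsHom (dpar p) 0 (coevMap k ι) := by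
  refine fun i => tens_ext fun w => ?_
  have h1 : ∀ a, (dnup a a).par (dpar p) = 0 := fun a => by
    simp [Word.par, dnup, CharTwo.add_self_eq_zero]
  rw [LinearMap.comp_apply, LinearMap.comp_apply, part_bv, word_nil w, par_nilW, add_zero,
    apply_ite (coevMap k ι), coev_nil, map_zero, map_sum]
  have h2 : ∀ a, part (dpar p) i ((1 : k) • bv k (dnup a a)) =
      if 0 = i then (1 : k) • bv k (dnup a a) else 0 := fun a => by
    rw [map_smul, part_bv, h1]
    split_ifs <;> simp
  rw [Finset.sum_congr rfl fun a _ => h2 a]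
  split_ifs <;> simp

theorem isHom_endoMap {p : ι → ZMod 2} {Q : Matrix ι ι k}
    (hQ : ∀ i j, p i + p j ≠ 1 → Q i j = 0) : IsHom (dpar p) 1 (endoMap Q) := by
  refine fun i => tens_ext fun w => ?_
  obtain ⟨a, rfl⟩ := exists_dnW w
  have h1 : ∀ a, (dnW a).par (dpar p) = p a := fun a => by simp [Word.par, dnW]
  rw [LinearMap.comp_apply, LinearMap.comp_apply, part_bv, h1, apply_ite (endoMap Q), endo_dnW,
    map_zero, map_sum]
  have h2 : ∀ b, part (dpar p) i (Q b a • bv k (dnW b)) =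
      if p a = i + 1 then Q b a • bv k (dnW b) else 0 := fun b => by
    rw [map_smul, part_bv, h1]
    by_cases hb : p b + p a = 1
    · have h0 : ∀ x y i : ZMod 2, x + y = 1 → (x = i ↔ y = i + 1) := by decide
      simp only [h0 _ _ i hb]
      split_ifs <;> simp
    · rw [hQ _ _ hb]; simp
  rw [Finset.sum_congr rfl fun b _ => h2 b]
  split_ifs <;> simp

theorem obAct_resp (p : ι → ZMod 2) (A : Type) (δ : k) (Q : A → Matrix ι ι k)
    (hQ : ∀ a i j, p i + p j ≠ 1 → Q a i j = 0) (hQ2 : ∀ a, Q a * Q a = 1)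
    (hδ : ∑ i, sgn k (p i) = δ) (X Y P r R) (h : OBRel A δ X Y P r R) :
    pathMap (dpar p) (obAct A δ Q) P = r • pathMap (dpar p) (obAct A δ Q) R := by
  set act := obAct A δ Q with hact
  let n := Realization.nilW (arrowSh ι)
  have ev : ∀ i j, elemMap (dpar p) act (.of OBGen.ev) (bv k (updn i j)) =
      (if i = j then 1 else 0 : k) • bv k n := ev_updn
  have coev : elemMap (dpar p) act (.of OBGen.coev) (bv k n) =
      ∑ i, (1 : k) • bv k (dnup i i) := coev_nil _
  have endo : ∀ a i, elemMap (dpar p) act (.of (OBGen.endo a)) (bv k (dnW i)) =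
      ∑ j, Q a j i • bv k (dnW j) := fun a => endo_dnW (Q a)
  have cr : ∀ i j, elemMap (dpar p) act (.cross .dn .up) (bv k (dnup i j)) =
      sgn k (p i * p j) • bv k (updn j i) := fun i j =>
    cross_two act (dpar p) (.inl i) (.inr j) rfl rfl
  have z : ∀ (c : ZMod 2) (n' : Word (arrowSh ι) []), n' = n →
      sgn k (c * n'.par (dpar p)) = 1 := by
    rintro c _ rfl
    change sgn k (c * 0) = 1
    rw [mul_zero, sgn_zero]
  have z0 : ∀ {X : List Arrow} (w : Word (arrowSh ι) X), sgn k (0 * w.par (dpar p)) = 1 :=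
    fun w => by rw [zero_mul, sgn_zero]
  have close : ∀ i j, pathMap (dpar p) act (step [] (.cross .dn .up) [] [.up, .dn] (step []
      (.of OBGen.ev) [] [] (.nil []) rfl rfl) rfl rfl) (bv k (dnup i j)) =
        (sgn k (p i * p j) * if j = i then 1 else 0) • bv k n := fun i j => by
    refine (step_single act [] [] (.cross .dn .up) rfl rfl _ (dnup i j) n (dnup i j) n rfl _ _
      (cr i j) (updn j i) rfl).trans ?_
    refine (congrArg _ (step_single act [] [] (.of OBGen.ev) rfl rfl _ (updn j i) n (updn j i) n rfl
      _ _ (ev j i) n rfl)).trans ?_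
    rw [z _ n rfl, z _ n rfl, one_mul, one_mul, smul_smul]
    rfl
  cases h with
  | straight₁ =>
    refine tens_ext fun w => ?_
    obtain ⟨i, rfl⟩ := exists_dnW w
    refine (step_apply act [] [.dn] (.of OBGen.coev) rfl rfl _ (dnW i) n n (dnW i) rfl _ _ coev
      (fun m => ⟨[.inl m, .inr m, .inl i], rfl⟩) fun _ => rfl).trans ?_
    have h1 : ∀ m, pathMap (dpar p) act (step [.dn] (.of OBGen.ev) [] [.dn] (.nil _) rfl rfl)
        (bv k ⟨[.inl m, .inr m, .inl i], rfl⟩) =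
        (1 * if m = i then 1 else 0 : k) • bv k (dnW m) := fun m => by
      refine (step_single act [.dn] [] (.of OBGen.ev) rfl rfl _ _ (dnW m) (updn m i) n
        rfl _ _ (ev m i) (dnW m) rfl).trans ?_
      exact congrArg (fun x => (x * _) • bv k (dnW m)) (z0 (dnW m))
    refine (Finset.sum_congr rfl fun m _ => congrArg _ (h1 m)).trans ?_
    rw [one_smul]
    change _ = bv k (dnW i)
    rw [z _ n rfl]
    simp
  | straight₂ =>
    refine tens_ext fun w => ?_
    obtain ⟨i, rfl⟩ := exists_upW w
    refine (step_apply act [.up] [] (.of OBGen.coev) rfl rfl _ (upW i) (upW i) n n rfl _ _ coev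
      (fun m => ⟨[.inr i, .inl m, .inr m], rfl⟩) fun _ => rfl).trans ?_
    have h1 : ∀ m, pathMap (dpar p) act (step [] (.of OBGen.ev) [.up] [.up] (.nil _) rfl rfl)
        (bv k ⟨[.inr i, .inl m, .inr m], rfl⟩) =
        (1 * if i = m then 1 else 0 : k) • bv k (upW m) := fun m => by
      refine (step_single act [] [.up] (.of OBGen.ev) rfl rfl _ _ n (updn i m) (upW m)
        rfl _ _ (ev i m) (upW m) rfl).trans ?_
      exact congrArg (fun x => (x * _) • bv k (upW m)) (z _ n rfl)
    refine (Finset.sum_congr rfl fun m _ => congrArg _ (h1 m)).trans ?_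
    rw [one_smul]
    change _ = bv k (upW i)
    refine (Finset.sum_congr rfl fun m _ => congrArg (fun x => (x * (1 : k)) • _)
      (z0 (upW i))).trans ?_
    simp
  | loop =>
    refine tens_ext fun w => ?_
    rw [word_nil w]
    refine (step_apply act [] [] (.of OBGen.coev) rfl rfl _ n n n n rfl _ _ coev
      (fun m => dnup m m) fun _ => rfl).trans ?_
    refine (Finset.sum_congr rfl fun m _ => congrArg _ (close m m)).trans ?_
    change _ = δ • bv k n
    rw [← hδ, Finset.sum_smul]
    refine Finset.sum_congr rfl fun m _ => ?_
    have h3 : p m * p m = p m := by generalize p m = a; revert a; decide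
    rw [z _ n rfl, if_pos rfl, one_mul, one_smul, mul_one, h3]
  | square a =>
    refine tens_ext fun w => ?_
    obtain ⟨i, rfl⟩ := exists_dnW w
    refine (step_apply act [] [] (.of (OBGen.endo a)) rfl rfl _ (dnW i) n (dnW i) n rfl _ _
      (endo a i) (fun m => dnW m) fun _ => rfl).trans ?_
    have h1 : ∀ i, pathMap (dpar p) act (step [] (.of (OBGen.endo a)) [] [.dn] (.nil _) rfl rfl)
        (bv k (dnW i)) = ∑ j, (1 * Q a j i) • bv k (dnW j) := fun i => by
      refine (step_apply act [] [] (.of (OBGen.endo a)) rfl rfl _ (dnW i) n (dnW i) n rfl _ _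
        (endo a i) (fun m => dnW m) fun _ => rfl).trans ?_
      rw [z _ n rfl]
      rfl
    refine (Finset.sum_congr rfl fun m _ => congrArg _ (h1 m)).trans ?_
    change _ = (1 : k) • bv k (dnW i)
    have h2 : ∀ j, ∑ m, Q a j m * Q a m i = if j = i then 1 else 0 := fun j => by
      rw [← Matrix.mul_apply, hQ2, Matrix.one_apply]
    simp only [Finset.smul_sum, smul_smul]
    rw [Finset.sum_comm, z _ n rfl]
    have h3 : ∀ j, ∑ m, (1 * Q a m i * (1 * Q a j m)) • bv k (dnW j) =
        (if j = i then 1 else 0 : k) • bv k (dnW j) := fun j => by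
      rw [← h2, Finset.sum_smul]
      exact Finset.sum_congr rfl fun m _ => by rw [one_mul, one_mul, mul_comm]
    refine (Finset.sum_congr rfl fun j _ => h3 j).trans ?_
    simp
  | decorated a =>
    refine tens_ext fun w => ?_
    rw [word_nil w]
    refine (step_apply act [] [] (.of OBGen.coev) rfl rfl _ n n n n rfl _ _ coev
      (fun m => dnup m m) fun _ => rfl).trans ?_
    rw [zero_smul, LinearMap.zero_apply]
    refine Finset.sum_eq_zero fun m _ => ?_
    have h1 := (step_apply act [] [.up] (.of (OBGen.endo a)) rfl rfl
      (step [] (.cross .dn .up) [] [.up, .dn] (step [] (.of OBGen.ev) [] [] (.nil []) rfl rfl)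
        rfl rfl) (dnup m m) n (dnW m) (upW m) rfl _ _
      (endo a m) (fun j => dnup j m) fun _ => rfl).trans
      (Finset.sum_congr rfl fun j _ => congrArg _ (close j m))
    refine (congrArg _ h1).trans ?_
    rw [Finset.sum_eq_zero, smul_zero]
    intro j _
    by_cases hj : m = j
    · subst hj
      rw [hQ a m m (by rw [CharTwo.add_self_eq_zero]; decide), mul_zero, zero_smul]
    · rw [if_neg hj, mul_zero, zero_smul, smul_zero]

/-- The monoidal super functor from the oriented Brauer category given by the super space with
homogeneous basis `ι`, and by odd involutive endomorphisms with matrices `Q a`. -/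
def obFunctor (p : ι → ZMod 2) (A : Type) (δ : k) (Q : A → Matrix ι ι k)
    (hQ : ∀ a i j, p i + p j ≠ 1 → Q a i j = 0) (hQ2 : ∀ a, Q a * Q a = 1)
    (hδ : ∑ i, sgn k (p i) = δ) : Realization (obPres A δ) (arrowSh ι) (dpar p) where
  act := obAct A δ Q
  homog
    | .ev => isHom_evMap p
    | .coev => isHom_coevMap p
    | .endo a => isHom_endoMap (hQ a)
  resp := obAct_resp p A δ Q hQ hQ2 hδ

end OrientedBrauer

/-! ## The four functors -/

section Functors

variable {k : Type u} [Field k] {V : Type w} [AddCommGroup V] [Module k V]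

/-- A homogeneous basis of a super space. -/
structure HomogBasis (𝒱 : ZMod 2 → Submodule k V) (ι : Type v) where
  basis : Module.Basis ι k V
  par : ι → ZMod 2
  mem : ∀ i, basis i ∈ 𝒱 (par i)

/-- A nondegenerate homogeneous bilinear form, even for `c = 0` and odd for `c = 1`, which is
symmetric with respect to the braiding of super spaces. -/
structure SuperForm (𝒱 : ZMod 2 → Submodule k V) (c : ZMod 2) where
  form : LinearMap.BilinForm k V
  homog : ∀ i j, ∀ x ∈ 𝒱 i, ∀ y ∈ 𝒱 j, i + j ≠ c → form x y = 0
  symm : ∀ i j, ∀ x ∈ 𝒱 i, ∀ y ∈ 𝒱 j, form x y = sgn k (i * j) * form y x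
  nondeg : form.Nondegenerate

/-- An odd endomorphism with square the identity. -/
structure OddInvolution (𝒱 : ZMod 2 → Submodule k V) where
  q : V →ₗ[k] V
  odd : ∀ i, ∀ x ∈ 𝒱 i, q x ∈ 𝒱 (i + 1)
  sq : q ∘ₗ q = LinearMap.id

variable {𝒱 : ZMod 2 → Submodule k V} {ι : Type v} [Fintype ι] [DecidableEq ι]

namespace HomogBasis

variable (b : HomogBasis 𝒱 ι)

/-- The super dimension, in `k`: the number of even basis elements minus the number of odd ones. -/
def sdim : k := ∑ i, sgn k (b.par i)

theorem repr_eq_zero [DirectSum.Decomposition 𝒱] {c : ZMod 2} {x : V} (hx : x ∈ 𝒱 c) (i : ι)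
    (hi : b.par i ≠ c) : b.basis.repr x i = 0 := by
  have h1 : x = ∑ j, b.basis.repr x j • (DirectSum.decompose 𝒱 (b.basis j) c : V) := by
    conv_lhs => rw [← DirectSum.decompose_of_mem_same 𝒱 hx, ← b.basis.sum_repr x]
    rw [DirectSum.decompose_sum, DFinsupp.finsetSum_apply, AddSubmonoidClass.coe_finsetSum]
    refine Finset.sum_congr rfl fun j _ => ?_
    rw [DirectSum.decompose_smul]
    rfl
  have h2 : ∀ j, (DirectSum.decompose 𝒱 (b.basis j) c : V) =
      if b.par j = c then b.basis j else 0 := by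
    intro j
    split_ifs with h
    · subst h
      exact DirectSum.decompose_of_mem_same 𝒱 (b.mem j)
    · exact DirectSum.decompose_of_mem_ne 𝒱 (b.mem j) h
  conv_lhs => rw [h1]
  rw [map_sum, Finsupp.finsetSum_apply]
  refine Finset.sum_eq_zero fun j _ => ?_
  rw [h2, map_smul, Finsupp.smul_apply]
  split_ifs with h
  · have hji : j ≠ i := fun e => hi (e ▸ h)
    rw [b.basis.repr_self, Finsupp.single_eq_of_ne (Ne.symm hji), smul_zero]
  · rw [map_zero, Finsupp.zero_apply, smul_zero]

end HomogBasis

namespace SuperForm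

variable {c : ZMod 2} (B : SuperForm 𝒱 c) (b : HomogBasis 𝒱 ι)

/-- The Gram matrix. -/
def gram : Matrix ι ι k := LinearMap.BilinForm.toMatrix b.basis B.form

theorem gram_apply (i j : ι) : B.gram b i j = B.form (b.basis i) (b.basis j) :=
  LinearMap.BilinForm.toMatrix_apply _ _ _ _

theorem isGram : IsGram b.par c (B.gram b) where
  homog i j h := by
    rw [gram_apply]
    exact B.homog _ _ _ (b.mem i) _ (b.mem j) h
  symm i j := by
    rw [gram_apply, gram_apply]
    exact B.symm _ _ _ (b.mem i) _ (b.mem j)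
  inv := isUnit_iff_ne_zero.2 ((LinearMap.BilinForm.nondegenerate_iff_det_ne_zero b.basis).1
    B.nondeg)

theorem sdim_odd (B : SuperForm 𝒱 1) (b : HomogBasis 𝒱 ι) : b.sdim = 0 :=
  sdim_eq_zero b.par (B.gram b) (B.gram b)⁻¹ (B.isGram b).homog
    (Matrix.mul_nonsing_inv _ (B.isGram b).inv)

/-- The super group of automorphisms of a super space with form: `OSp(V)` for an even form, `Pe(V)`
for an odd form. -/
def group : GroupEqs k b.par := formEqs b.par (B.gram b) c (B.isGram b).homog

/-- The functor from `ℬ(δ)` given by an even form on `V`, where `δ` is the super dimension. -/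
def brauerFun (B : SuperForm 𝒱 0) (b : HomogBasis 𝒱 ι) :
    Realization (brauerCat b.sdim) (unitSh ι) b.par :=
  brauerFunctor b.par 0 b.sdim (B.gram b) (B.isGram b) rfl

/-- The functor from `𝒜` given by an odd form on `V`. -/
def periplecticFun (B : SuperForm 𝒱 1) (b : HomogBasis 𝒱 ι) :
    Realization (periplecticCat k) (unitSh ι) b.par :=
  brauerFunctor b.par 1 0 (B.gram b) (B.isGram b) (B.sdim_odd b)

end SuperForm

namespace OddInvolution

variable [DirectSum.Decomposition 𝒱] (q : OddInvolution 𝒱) (b : HomogBasis 𝒱 ι)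

/-- The matrix of the involution. -/
def mat : Matrix ι ι k := LinearMap.toMatrix b.basis b.basis q.q

theorem mat_homog (i j : ι) (h : b.par i + b.par j ≠ 1) : q.mat b i j = 0 := by
  rw [mat, LinearMap.toMatrix_apply]
  refine b.repr_eq_zero (q.odd _ _ (b.mem j)) i fun e => h ?_
  rw [e, add_right_comm, CharTwo.add_self_eq_zero, zero_add]

theorem mat_sq : q.mat b * q.mat b = 1 := by
  rw [mat, ← LinearMap.toMatrix_comp b.basis b.basis b.basis, q.sq, LinearMap.toMatrix_id]

theorem sdim_eq (q : OddInvolution 𝒱) (b : HomogBasis 𝒱 ι) : b.sdim = 0 := sdim_eq_zero b.par _ _ (q.mat_homog b) (q.mat_sq b)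

/-- The super group `Q(V)`, the subgroup of `GL(V)` which commutes with the involution. -/
def group : GroupEqs k b.par := commEqs b.par (q.mat b) 1 (q.mat_homog b)

/-- The functor from `𝒪ℬ𝒞` given by an odd involution on `V`. -/
def obcFun : Realization (obcCat k) (arrowSh ι) (dpar b.par) :=
  obFunctor b.par Unit 0 (fun _ => q.mat b) (fun _ => q.mat_homog b) (fun _ => q.mat_sq b)
    (q.sdim_eq b)

end OddInvolution

/-- The functor from `𝒪ℬ(δ)` given by a super space `V`, where `δ` is the super dimension. -/
def HomogBasis.obFun (b : HomogBasis 𝒱 ι) :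
    Realization (obCat b.sdim) (arrowSh ι) (dpar b.par) :=
  obFunctor b.par Empty b.sdim (fun a => a.elim) (fun a => a.elim) (fun a => a.elim) rfl

/-- The coaction `e i ↦ ∑ j, e j ⊗ X j i` on `V`. -/
def GroupEqs.natCoact {p : ι → ZMod 2} (G : GroupEqs k p) : ι → ι → G.O := G.X

/-- The coactions on `V` and on the dual `V*`, where `(e i)* ↦ ∑ j, (e j)* ⊗ Y j i` with
`Y j i = (-1)^([j]([i]+[j])) Z i j`. -/
def GroupEqs.dualCoact {p : ι → ZMod 2} (G : GroupEqs k p) : ι ⊕ ι → ι ⊕ ι → G.O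
  | .inl j, .inl i => G.X j i
  | .inr j, .inr i => sgn k (p j * (p i + p j)) • G.Z i j
  | _, _ => 0

end Functors

end SuperBrauer

end

/-! The centraliser coalgebra is spanned by matrix units `cl u v`, the classes of `u* ⊗ v` for basis
words `u`, `v` over the same object. The map `φ` sends such a unit to the matrix coefficient `coeff
u v`, a signed product of coefficients of single letters. The content of the theorem is that the
relations `α F(f) ⊗ v = α ⊗ F(f) v`, with `f` running over all diagrams, amount exactly to the
defining relations of `𝒪[G]`. No description of the invariants or of the representations of `G` is
needed.

One direction says that `φ` is well defined, that is, that every diagram acts by an equivariant map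
(`isEquivariant_path`). Equivariance passes to layers `id ⊗ e ⊗ id` and to composites, so only
crossings and generators matter. Crossings are equivariant because `𝒪[G]` is super commutative, `ev`
because `ZX = 1`, the cap because of the equations of the form, the odd endomorphism because of the
commutation equations. For `coev` and the cup the identity `XZ = 1` is needed as well, and it is not
among the defining relations. It holds because `𝒪[G]` is finite over its center
(`SuperPres.finite_over_center`), so that a surjective endomorphism of a free module of finite rank
is injective. This argument works in every characteristic.

The other direction constructs the inverse of `φ`. The coordinates are made to act on the
centraliser coalgebra by multiplication with matrix units of letters. The defining relations of
`𝒪[G]` hold for these operators since each is the relation of a single elementary morphism: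
crossings give super commutativity (`cmul_comm_cl`), `ev` gives `ZX = 1`, the cap gives the
equations of the form, the odd endomorphism the commutation with `Q`. Without a dual letter, `Z` is
expressed through `X` and the Gram matrix (`formInv`). This yields an algebra map `L` from `𝒪[G]` to
the linear endomorphisms of the coalgebra, and `x ↦ L x 1` is inverse to `φ`: applied to `coeff u v`
it gives `cl u v`, by induction on the words, while `φ (L x y) = x * φ y` holds because it holds for
algebra generators `x`. Working with operators has the advantage that associativity of the product
of the coalgebra is never used.

Compatibility with product, coproduct, counit and parity is then checked on matrix units. The
general argument is `phiIsIso_of_action`; the four cases are instances of `phiIsIso_brauerFunctor`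
and `phiIsIso_obFunctor`. -/

noncomputable section

namespace SuperBrauer

universe u v w

/-! ## Left inverses of matrices over commutative super algebras -/

section TwoSided

/-- Over an algebra which is finite over its center, left inverses of square matrices are right
inverses. -/
theorem matrix_mul_eq_one_symm {k : Type u} [Field k] {O : Type w} [Ring O] [Algebra k O]
    [Module.Finite (Subalgebra.center k O) O] {n : Type v} [Fintype n] [DecidableEq n]
    {A B : Matrix n n O} (h : A * B = 1) : B * A = 1 := by
  -- Left multiplication by a matrix does not commute with left scalars from `O`, but it does with
  -- central ones. Over the center, a commutative ring, `Oⁿ` is a finite module.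
  let f : (n → O) →ₗ[Subalgebra.center k O] (n → O) :=
    { toFun := fun v => A.mulVec v
      map_add' := fun v w => Matrix.mulVec_add A v w
      map_smul' := fun r v => by
        ext i
        simp only [Matrix.mulVec, dotProduct, Pi.smul_apply, RingHom.id_apply, Finset.smul_sum,
          Subalgebra.smul_def, smul_eq_mul]
        refine Finset.sum_congr rfl fun j _ => ?_
        rw [← mul_assoc, ← mul_assoc, (Subalgebra.mem_center_iff.1 r.2 (A i j))] }
  have hf : ∀ v, f v = A.mulVec v := fun _ => rfl
  have hs : Function.Surjective f := fun v => ⟨B.mulVec v, by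
    rw [hf, Matrix.mulVec_mulVec, h, Matrix.one_mulVec]⟩
  -- A surjective endomorphism of a finite module over a commutative ring is injective. Hence `A`
  -- can be cancelled from `A(BAv) = (AB)Av = Av`.
  have hi := OrzechProperty.injective_of_surjective_endomorphism f hs
  refine Matrix.ext_iff_mulVec.2 fun v => hi ?_
  rw [hf, hf, Matrix.one_mulVec, Matrix.mulVec_mulVec, ← mul_assoc, h, one_mul]

variable {k : Type u} [Field k] {T : Type v} {par : T → ZMod 2} (P : SuperPres k par)

/-! ### Finiteness of a finitely generated commutative super algebra over its center -/

namespace SuperPres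

theorem adjoin_gen : Algebra.adjoin k (Set.range P.gen) = ⊤ := by
  rw [← top_le_iff]
  rintro x -
  obtain ⟨x, rfl⟩ := P.quo_surjective x
  induction x using FreeAlgebra.induction with
  | grade0 r => rw [AlgHom.commutes]; exact Subalgebra.algebraMap_mem _ r
  | grade1 t => exact Algebra.subset_adjoin ⟨t, rfl⟩
  | mul a b ha hb => rw [map_mul]; exact mul_mem ha hb
  | add a b ha hb => rw [map_add]; exact add_mem ha hb

/-- Against each homogeneous component of the other factor the sign has exponent `i * 0`. -/
theorem mem_center_of_even {a : P.Alg} (ha : a ∈ P.gr 0) : a ∈ Subalgebra.center k P.Alg := by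
  rw [Subalgebra.mem_center_iff]
  intro b
  classical
  rw [← DirectSum.sum_support_decompose P.gr b, Finset.sum_mul, Finset.mul_sum]
  refine Finset.sum_congr rfl fun i _ => ?_
  rw [P.super_comm (SetLike.coe_mem _) ha, mul_zero, sgn_zero, one_smul]

/-- The product of two odd generators is even, hence central, so `1` and the generators already span
the algebra over its center. Nilpotency of odd elements, which can fail in characteristic 2, plays
no role. -/
theorem finite_over_center [Finite T] : Module.Finite (Subalgebra.center k P.Alg) P.Alg := by
  set M := Submodule.span (Subalgebra.center k P.Alg) (insert 1 (Set.range P.gen)) with hM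
  have h1 : (1 : P.Alg) ∈ M := Submodule.subset_span (Set.mem_insert _ _)
  have hg : ∀ t, P.gen t ∈ M := fun t => Submodule.subset_span (Or.inr ⟨t, rfl⟩)
  have hc : ∀ {a b : P.Alg}, a ∈ P.gr 0 → b ∈ M → a * b ∈ M := fun ha hb =>
    M.smul_mem (⟨_, P.mem_center_of_even ha⟩ : Subalgebra.center k P.Alg) hb
  -- An even factor is a central scalar times the other generator; two odd factors give a central
  -- scalar times `1`.
  have hgg : ∀ t s, P.gen t * P.gen s ∈ M := fun t s => by
    rcases parity_cases (par t) with ht | ht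
    · exact hc (ht ▸ P.gen_mem_gr t) (hg s)
    · rcases parity_cases (par s) with hs | hs
      · have h := P.mem_center_of_even (hs ▸ P.gen_mem_gr s)
        rw [Subalgebra.mem_center_iff.1 h (P.gen t)]
        exact hc (hs ▸ P.gen_mem_gr s) (hg t)
      · have h := SetLike.mul_mem_graded (P.gen_mem_gr t) (P.gen_mem_gr s)
        rw [ht, hs, CharTwo.add_self_eq_zero] at h
        simpa using hc h h1
  have hmul : ∀ t, ∀ x ∈ M, P.gen t * x ∈ M := fun t x hx => by
    induction hx using Submodule.span_induction with
    | mem x hx =>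
      rcases hx with rfl | ⟨s, rfl⟩
      · rw [mul_one]; exact hg t
      · exact hgg t s
    | zero => rw [mul_zero]; exact zero_mem _
    | add x y _ _ hx hy => rw [mul_add]; exact add_mem hx hy
    | smul r x _ hx =>
      rw [Subalgebra.smul_def, smul_eq_mul, ← mul_assoc, Subalgebra.mem_center_iff.1 r.2, mul_assoc]
      exact M.smul_mem r hx
  -- So `M` is a left ideal, and it contains `1`.
  have hall : ∀ x : P.Alg, ∀ y ∈ M, x * y ∈ M := fun x => by
    have hx : x ∈ Algebra.adjoin k (Set.range P.gen) := P.adjoin_gen ▸ Algebra.mem_top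
    induction hx using Algebra.adjoin_induction with
    | mem x hx => obtain ⟨t, rfl⟩ := hx; exact hmul t
    | algebraMap r => exact fun y hy => M.smul_mem (algebraMap k (Subalgebra.center k P.Alg) r) hy
    | add a b _ _ ha hb => intro y hy; rw [add_mul]; exact add_mem (ha y hy) (hb y hy)
    | mul a b _ _ ha hb => intro y hy; rw [mul_assoc]; exact ha _ (hb y hy)
  refine ⟨⟨((Set.finite_range P.gen).insert 1).toFinset, ?_⟩⟩
  rw [Set.Finite.coe_toFinset, eq_top_iff]
  exact fun x _ => by simpa using hall x 1 h1

end SuperPres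

instance {ι : Type v} [Finite ι] : Finite (Coord ι) :=
  Finite.of_surjective (Sum.elim (fun x : ι × ι => Coord.X x.1 x.2) fun x : ι × ι => .Z x.1 x.2)
    fun c => by
      cases c with
      | X i j => exact ⟨.inl (i, j), rfl⟩
      | Z i j => exact ⟨.inr (i, j), rfl⟩

/-! ### Two-sided invertibility of the coordinate matrix -/

namespace GroupEqs

variable {ι : Type v} [Fintype ι] [DecidableEq ι] {p : ι → ZMod 2} (G : GroupEqs k p)

theorem Z_mul_X_matrix : Matrix.of G.Z * Matrix.of G.X = 1 := by
  ext i j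
  rw [Matrix.mul_apply, Matrix.one_apply]
  exact G.Z_mul_X i j

/-- The presentation imposes only `ZX = 1`. The opposite identity is what makes `coev` and the cup
equivariant, and what makes left inverses of `X` unique. -/
theorem X_mul_Z_matrix : Matrix.of G.X * Matrix.of G.Z = 1 :=
  have := G.pres.finite_over_center
  matrix_mul_eq_one_symm (k := k) G.Z_mul_X_matrix

theorem X_mul_Z (i l : ι) : ∑ j, G.X i j * G.Z j l = if i = l then 1 else 0 := by
  have := congrFun (congrFun G.X_mul_Z_matrix i) l
  rwa [Matrix.mul_apply, Matrix.one_apply] at this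

/-- A left inverse of the matrix `X` is equal to `Z`. -/
theorem eq_Z {W : Matrix ι ι G.O} (hW : W * Matrix.of G.X = 1) : W = Matrix.of G.Z := by
  rw [← mul_one W, ← G.X_mul_Z_matrix, ← mul_assoc, hW, one_mul]

end GroupEqs

end TwoSided

/-! ## Matrix entries of layers -/

section Layers

variable {k : Type u} [Field k] {S : Type} {E : Type v} {sh : E → S} {p : E → ZMod 2}
  {C : CatPres k S} {X Y Z : List S}

open Signature

theorem part_apply (i : ZMod 2) (t : Tens k sh X) (w : Word sh X) :
    part p i t w = if w.par p = i then t w else 0 := by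
  classical
  induction t using Finsupp.induction_linear with
  | zero => simp
  | add f g hf hg => rw [map_add, Finsupp.add_apply, Finsupp.add_apply, hf, hg]; split_ifs <;> simp
  | single v c =>
    have hv : (Finsupp.single v c : Tens k sh X) = c • bv k v := by simp [bv]
    rw [hv, map_smul, part_bv, Finsupp.smul_apply, Finsupp.smul_apply]
    by_cases h : v = w
    · subst h; split_ifs <;> simp
    · split_ifs <;> simp [Finsupp.single_eq_of_ne (Ne.symm h)]

/-- Where a matrix entry is nonzero, homogeneity fixes the parity of one index by that of the other.
This allows signs depending on a summation index to be pulled out of the sum. -/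
theorem IsHom.par_eq {c : ZMod 2} {f : Tens k sh X →ₗ[k] Tens k sh Y} (hf : IsHom p c f)
    (y : Word sh X) (y' : Word sh Y) (h : f (bv k y) y' ≠ 0) : y.par p = y'.par p + c := by
  by_contra hne
  refine h ?_
  have h1 := LinearMap.congr_fun (hf (y'.par p)) (bv k y)
  rw [LinearMap.comp_apply, LinearMap.comp_apply, part_bv, if_neg hne, map_zero] at h1
  have h2 := DFunLike.congr_fun h1 y'
  rwa [part_apply, if_pos rfl] at h2

theorem dbv_bv [DecidableEq E] (u w : Word sh X) :
    dbv k u (bv k w) = if u.1 = w.1 then 1 else 0 := by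
  classical
  rw [dbv, Finsupp.lapply_apply, Finsupp.single_apply]
  simp only [Word.ext_iff, eq_comm]

theorem tens_eq_sum [Fintype E] (t : Tens k sh X) : t = ∑ u, t u • bv k u := by
  conv_lhs => rw [← Finsupp.univ_sum_single t]
  simp [bv]

theorem dual_eq_sum [Fintype E] (α : DualTens k sh X) : α = ∑ u, α (bv k u) • dbv k u := by
  refine tens_ext fun w => ?_
  rw [LinearMap.sum_apply, Finset.sum_eq_single w]
  · simp
  · intro b _ hb
    simp [Finsupp.single_eq_of_ne hb]
  · simp

/-- The transpose of `id ⊗ e ⊗ id` in terms of the transpose of `e`. -/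
theorem dbv_layerMap (act : GenAct C sh) {M : Type w} [Fintype M] (a b : List S)
    (e : C.toSignature.Elem) (hX : X = a ++ (e.dom ++ b)) (hY : Y = a ++ (e.cod ++ b))
    (w : Word sh Y) (x : Word sh a) (y : Word sh e.cod) (z : Word sh b)
    (hw : w.1 = x.1 ++ (y.1 ++ z.1)) (c : M → k) (u : M → Word sh e.dom)
    (hy : dbv k y ∘ₗ elemMap p act e = ∑ m, c m • dbv k (u m)) (w' : M → Word sh X)
    (hw' : ∀ m, (w' m).1 = x.1 ++ ((u m).1 ++ z.1)) :
    dbv k w ∘ₗ layerMap p act ⟨a, e, b, hX, hY⟩ =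
      ∑ m, (sgn k (e.par * x.par p) * c m) • dbv k (w' m) := by
  classical
  subst hX hY
  refine tens_ext fun v => ?_
  obtain ⟨x₀, y₀, z₀, rfl⟩ : ∃ (x₀ : Word sh a) (y₀ : Word sh e.dom) (z₀ : Word sh b),
      v = x₀.append (y₀.append z₀) :=
    ⟨v.fst, v.snd.fst, v.snd.snd, by rw [Word.append_fst_snd, Word.append_fst_snd]⟩
  have h0 : layerMap p act ⟨a, e, b, rfl, rfl⟩ (bv k (x₀.append (y₀.append z₀))) = _ :=
    Realization.layerMap_bv act ⟨a, e, b, rfl, rfl⟩ x₀ y₀ z₀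
  have hy₀ := LinearMap.congr_fun hy (bv k y₀)
  have e1 : w = x.append (y.append z) := Word.ext hw
  have e2 : ∀ m, w' m = x.append ((u m).append z) := fun m => Word.ext (hw' m)
  rw [LinearMap.comp_apply, h0, map_smul, LinearMap.sum_apply, e1]
  simp only [LinearMap.smul_apply, e2]
  rw [LinearMap.comp_apply, LinearMap.sum_apply] at hy₀
  simp only [LinearMap.smul_apply] at hy₀
  -- The letters of the object fix the lengths of the three pieces, so the splitting of a word is
  -- unique.
  have inj : ∀ {l : List S} (y₀ y : Word sh l), x₀.append (y₀.append z₀) = x.append (y.append z) →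
      x₀ = x ∧ y₀ = y ∧ z₀ = z := fun y₀ y h => by
    have h1 := congrArg Word.fst h
    have h2 := congrArg Word.snd h
    rw [Word.fst_append, Word.fst_append] at h1
    rw [Word.snd_append, Word.snd_append] at h2
    have h3 := congrArg Word.fst h2
    have h4 := congrArg Word.snd h2
    rw [Word.fst_append, Word.fst_append] at h3
    rw [Word.snd_append, Word.snd_append] at h4
    exact ⟨h1, h3, h4⟩
  -- The layer leaves the outer words unchanged, so both sides vanish unless these agree. If they
  -- agree, the sign attached to the input word `x₀` is the one attached to `x`.
  by_cases hxz : x₀ = x ∧ z₀ = z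
  · obtain ⟨rfl, rfl⟩ := hxz
    have hinj : Function.Injective fun v : Word sh e.cod => x₀.append (v.append z₀) :=
      fun v v' h => (inj v v' h).2.1
    have h1 : dbv k (x₀.append (y.append z₀)) (Finsupp.lmapDomain k k
        (fun v : Word sh e.cod => x₀.append (v.append z₀)) (elemMap p act e (bv k y₀))) =
        dbv k y (elemMap p act e (bv k y₀)) := Finsupp.mapDomain_apply hinj _ y
    have h2 : ∀ m, dbv k (x₀.append ((u m).append z₀)) (bv k (x₀.append (y₀.append z₀))) =
        dbv k (u m) (bv k y₀) := fun m => by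
      rw [dbv_bv, dbv_bv]
      simp [Word.append]
    simp only [h2]
    refine (congrArg _ (h1.trans hy₀)).trans ?_
    rw [Finset.smul_sum]
    exact Finset.sum_congr rfl fun m _ => by simp only [smul_eq_mul, mul_assoc]
  · have h1 : dbv k (x.append (y.append z)) (Finsupp.lmapDomain k k
        (fun v : Word sh e.cod => x₀.append (v.append z₀)) (elemMap p act e (bv k y₀))) = 0 :=
      Finsupp.mapDomain_of_notMem_range _ _ fun ⟨v, hv⟩ => hxz ⟨(inj v y hv).1, (inj v y hv).2.2⟩
    refine (congrArg _ h1).trans ?_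
    rw [smul_zero, Finset.sum_eq_zero]
    intro m _
    rw [dbv, Finsupp.lapply_apply, Finsupp.single_eq_of_ne, smul_zero]
    exact fun h => hxz ⟨(inj _ _ h.symm).1, (inj _ _ h.symm).2.2⟩

theorem dbv_comp [Fintype E] (f : Tens k sh X →ₗ[k] Tens k sh Y) (y : Word sh Y) :
    dbv k y ∘ₗ f = ∑ m, f (bv k m) y • dbv k m :=
  dual_eq_sum _

theorem crossMap_two (p : E → ZMod 2) {x y : S} (i j : E)
    (h : [i, j].map sh = [x, y]) (h' : [j, i].map sh = [y, x]) :
    crossMap p x y (bv k (⟨[i, j], h⟩ : Word sh [x, y])) =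
      sgn k (p i * p j) • bv k (⟨[j, i], h'⟩ : Word sh [y, x]) := by
  refine (crossMap_bv p _).trans ?_
  simp [Word.rev]

/-- The transpose of a crossing. -/
theorem dbv_crossMap (p : E → ZMod 2) {x y : S} (i j : E)
    (h : [i, j].map sh = [x, y]) (h' : [j, i].map sh = [y, x]) :
    dbv k (⟨[j, i], h'⟩ : Word sh [y, x]) ∘ₗ crossMap p x y =
      sgn k (p i * p j) • dbv k (⟨[i, j], h⟩ : Word sh [x, y]) := by
  classical
  refine tens_ext fun w => ?_
  obtain ⟨a, ha, v, hv⟩ := Realization.exists_cons w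
  obtain ⟨b, hb, rfl⟩ := Realization.exists_one v
  obtain rfl : w = ⟨[a, b], by simp [ha, hb]⟩ := Word.ext hv
  rw [LinearMap.comp_apply, crossMap_two p a b _ (by simp [ha, hb]), map_smul,
    LinearMap.smul_apply, dbv_bv, dbv_bv]
  simp only [List.cons.injEq, and_true]
  by_cases hab : i = a ∧ j = b
  · obtain ⟨rfl, rfl⟩ := hab
    simp
  · rw [if_neg fun h => hab h.symm, if_neg hab, smul_zero, smul_zero]

end Layers

/-! ## Equivariance of morphisms -/

section Equivariance

variable {k : Type u} [Field k] {S : Type} {E : Type v} {sh : E → S} {p : E → ZMod 2}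
  {X Y Z : List S} {O : Type w} [Ring O] [Algebra k O] {c : E → E → O}

open Signature

/-- The sign is the Koszul sign for moving the coefficient of the first factor, of parity `|u| +
|v|`, past the basis word `u'`. Equal lengths are needed since `coeff` is zero for lists of
different lengths. -/
theorem coeff_append (u v u' v' : List E) (h : u.length = v.length) :
    coeff k p c (u ++ u') (v ++ v') =
      sgn k (((u.map p).sum + (v.map p).sum) * (u'.map p).sum) •
        (coeff k p c u v * coeff k p c u' v') := by
  induction u generalizing v with
  | nil =>
    obtain rfl : v = [] := List.length_eq_zero_iff.1 h.symm
    simp [coeff, sgn_zero]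
  | cons a u ih =>
    match v, h with
    | b :: v, h =>
      simp only [List.cons_append, coeff, ih v (by simpa using h), mul_smul_comm, smul_mul_assoc,
        smul_smul, List.map_append, List.sum_append, List.map_cons, List.sum_cons, mul_assoc]
      congr 1
      rw [← sgn_add, ← sgn_add]
      congr 1
      ring

variable [Fintype E]

theorem matCoeff_bv (α : DualTens k sh X) (v : Word sh X) :
    matCoeff p c α (bv k v) = ∑ u : Word sh X, α (bv k u) • coeff k p c u.1 v.1 := by
  simp [matCoeff, coact, bv]

theorem matCoeff_dbv_bv (u v : Word sh X) :
    matCoeff p c (dbv k u) (bv k v) = coeff k p c u.1 v.1 := by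
  rw [matCoeff_bv, Finset.sum_eq_single u]
  · simp
  · intro w _ hw
    simp [Finsupp.single_eq_of_ne (Ne.symm hw)]
  · simp

/-- Matrix coefficients as a bilinear map. -/
def matCoeffLin (p : E → ZMod 2) (c : E → E → O) (X : List S) :
    DualTens k sh X →ₗ[k] Tens k sh X →ₗ[k] O :=
  LinearMap.mk₂ k (matCoeff p c)
    (fun α β v => by simp [matCoeff, TensorProduct.map_add_left])
    (fun r α v => by simp [matCoeff, TensorProduct.map_smul_left])
    (fun α v w => by simp [matCoeff])
    (fun r α v => by simp [matCoeff])

theorem matCoeffLin_apply (α : DualTens k sh X) (v : Tens k sh X) :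
    matCoeffLin p c X α v = matCoeff p c α v := rfl

/-- Linear maps which commute with the coactions. -/
def IsEquivariant (p : E → ZMod 2) (c : E → E → O) (f : Tens k sh X →ₗ[k] Tens k sh Y) : Prop :=
  ∀ α v, matCoeff p c (α ∘ₗ f) v = matCoeff p c α (f v)

/-- Both sides of the equivariance condition are bilinear, and the dual basis spans the dual since
there are finitely many words over an object. -/
theorem isEquivariant_of_basis {f : Tens k sh X →ₗ[k] Tens k sh Y}
    (h : ∀ u v, matCoeff p c (dbv k u ∘ₗ f) (bv k v) = matCoeff p c (dbv k u) (f (bv k v))) :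
    IsEquivariant p c f := by
  intro α v
  have h1 : ∀ u, (matCoeffLin p c X (dbv k u ∘ₗ f) : Tens k sh X →ₗ[k] O) =
      matCoeffLin p c Y (dbv k u) ∘ₗ f := fun u => tens_ext (h u)
  change matCoeffLin p c X (f.dualMap α) v = matCoeffLin p c Y α (f v)
  have h2 : ∀ u, f.dualMap (dbv k u) = dbv k u ∘ₗ f := fun _ => rfl
  rw [dual_eq_sum α]
  simp only [h2, map_sum, map_smul, LinearMap.sum_apply, LinearMap.smul_apply, h1,
    LinearMap.comp_apply]

/-- Turns equivariance at a pair of basis words into one identity in `𝒪[G]`. The row and the column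
of `f` may be indexed by any finite types, so that each generator can be described by its own few
nonzero entries. -/
theorem matCoeff_expand {f : Tens k sh X →ₗ[k] Tens k sh Y} {M N : Type*} [Fintype M] [Fintype N]
    {u : Word sh Y} {v : Word sh X} {a : M → k} {m : M → Word sh X} {b : N → k} {n : N → Word sh Y}
    (h₁ : dbv k u ∘ₗ f = ∑ i, a i • dbv k (m i)) (h₂ : f (bv k v) = ∑ j, b j • bv k (n j)) :
    (matCoeff p c (dbv k u ∘ₗ f) (bv k v) = matCoeff p c (dbv k u) (f (bv k v))) ↔
      ∑ i, a i • coeff k p c (m i).1 v.1 = ∑ j, b j • coeff k p c u.1 (n j).1 := by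
  rw [h₁, h₂, ← matCoeffLin_apply, ← matCoeffLin_apply]
  simp only [map_sum, map_smul, LinearMap.sum_apply, LinearMap.smul_apply, matCoeffLin_apply,
    matCoeff_dbv_bv]

variable {C : CatPres k S}

/-- Equivariance of the braiding is super commutativity of the coefficients: the two crossing signs
and the two signs in `coeff` add up to the sign of the commutation rule. -/
theorem isEquivariant_crossMap
    (hcomm : ∀ a b a' b', c a b * c a' b' = sgn k ((p a + p b) * (p a' + p b')) •
      (c a' b' * c a b)) (x y : S) :
    IsEquivariant p c (crossMap p x y : Tens k sh [x, y] →ₗ[k] Tens k sh [y, x]) := by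
  refine isEquivariant_of_basis fun u v => ?_
  obtain ⟨a', ha', u₁, hu⟩ := Realization.exists_cons u
  obtain ⟨a, ha, rfl⟩ := Realization.exists_one u₁
  obtain ⟨b, hb, v₁, hv⟩ := Realization.exists_cons v
  obtain ⟨b', hb', rfl⟩ := Realization.exists_one v₁
  obtain rfl : u = ⟨[a', a], by simp [ha, ha']⟩ := Word.ext hu
  obtain rfl : v = ⟨[b, b'], by simp [hb, hb']⟩ := Word.ext hv
  refine (matCoeff_expand (M := Unit) (N := Unit) (a := fun _ => sgn k (p a * p a'))
    (m := fun _ => ⟨[a, a'], by simp [ha, ha']⟩) (b := fun _ => sgn k (p b * p b'))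
    (n := fun _ => ⟨[b', b], by simp [hb, hb']⟩)
    (by simpa using dbv_crossMap p a a' _ _) (by simpa using crossMap_two (k := k) p b b' _ _)).2 ?_
  simp only [Finset.univ_unique, Finset.sum_singleton, coeff, List.map_cons, List.map_nil,
    List.sum_cons, List.sum_nil, add_zero, mul_zero, sgn_zero, one_smul, mul_one, smul_smul]
  rw [hcomm a b a' b', smul_smul]
  congr 1
  simp only [← sgn_add]
  congr 1
  have h2 := fun x : ZMod 2 => CharTwo.add_self_eq_zero x
  linear_combination h2 (p a * p a') + h2 (p b * p a')

/-- Each coefficient of a three-part word factors by `coeff_append`. Both sides then become a common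
sign times the left coefficient, times one side of the equivariance identity of `e`, times the right
coefficient. -/
theorem isEquivariant_layer (F : Realization C sh p)
    (hF : ∀ e, IsEquivariant p c (elemMap p F.act e)) (L : C.toSignature.Layer X Y) :
    IsEquivariant p c (layerMap p F.act L) := by
  obtain ⟨l, e, r, hX, hY⟩ := L
  subst hX hY
  refine isEquivariant_of_basis fun u v => ?_
  obtain ⟨x', y', z', rfl⟩ : ∃ (x₀ : Word sh l) (y₀ : Word sh e.cod) (z₀ : Word sh r),
      u = x₀.append (y₀.append z₀) :=
    ⟨u.fst, u.snd.fst, u.snd.snd, by rw [Word.append_fst_snd, Word.append_fst_snd]⟩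
  obtain ⟨x, y, z, rfl⟩ : ∃ (x₀ : Word sh l) (y₀ : Word sh e.dom) (z₀ : Word sh r),
      v = x₀.append (y₀.append z₀) :=
    ⟨v.fst, v.snd.fst, v.snd.snd, by rw [Word.append_fst_snd, Word.append_fst_snd]⟩
  refine (matCoeff_expand
    (dbv_layerMap F.act l r e rfl rfl _ x' y' z' rfl _ _ (dbv_comp _ _)
      (fun m => x'.append (m.append z')) fun _ => rfl)
    (Realization.layer_apply F.act l r e rfl rfl _ x y z rfl _ _ (tens_eq_sum _)
      (fun m => x.append (m.append z)) fun _ => rfl)).2 ?_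
  have key := (matCoeff_expand (p := p) (c := c) (dbv_comp (elemMap p F.act e) y')
    (tens_eq_sum (elemMap p F.act e (bv k y)))).1 (hF e _ _)
  have len : ∀ {Q : List S} (u v : Word sh Q), u.1.length = v.1.length := fun u v => by
    rw [u.length_eq, v.length_eq]
  have hco : ∀ (m : Word sh e.dom ) , coeff k p c (x'.append (m.append z')).1
      (x.append (y.append z)).1 = sgn k ((x'.par p + x.par p) * (m.par p + z'.par p) +
        (m.par p + y.par p) * z'.par p) •
        (coeff k p c x'.1 x.1 * (coeff k p c m.1 y.1 * coeff k p c z'.1 z.1)) := fun m => by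
    simp only [Word.append]
    rw [coeff_append _ _ _ _ (len x' x), coeff_append _ _ _ _ (len m y), mul_smul_comm, smul_smul,
      List.map_append, List.sum_append, ← sgn_add]
    rfl
  have hco' : ∀ (m : Word sh e.cod ) , coeff k p c (x'.append (y'.append z')).1
      (x.append (m.append z)).1 = sgn k ((x'.par p + x.par p) * (y'.par p + z'.par p) +
        (y'.par p + m.par p) * z'.par p) •
        (coeff k p c x'.1 x.1 * (coeff k p c y'.1 m.1 * coeff k p c z'.1 z.1)) := fun m => by
    simp only [Word.append]
    rw [coeff_append _ _ _ _ (len x' x), coeff_append _ _ _ _ (len y' m), mul_smul_comm, smul_smul,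
      List.map_append, List.sum_append, ← sgn_add]
    rfl
  -- The common sign, free of summation indices. For nonzero entries of `e`, homogeneity gives `|m|
  -- = |y'| + |e|` on the left side and `|m| = |y| + |e|` on the right side.
  set s := sgn k (e.par * x.par p + (x'.par p + x.par p) * (y'.par p + z'.par p) +
    (y'.par p + (y.par p + e.par)) * z'.par p) with hs
  have h2 := fun x : ZMod 2 => CharTwo.add_self_eq_zero x
  have e1 : ∀ m : Word sh e.dom, (sgn k (e.par * x'.par p) * elemMap p F.act e (bv k m) y') •
      coeff k p c (x'.append (m.append z')).1 (x.append (y.append z)).1 =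
      s • (coeff k p c x'.1 x.1 * ((elemMap p F.act e (bv k m) y' • coeff k p c m.1 y.1) *
        coeff k p c z'.1 z.1)) := fun m => by
    by_cases h0 : elemMap p F.act e (bv k m) y' = 0
    · simp [h0]
    · have hm := (F.isHom_elem e).par_eq m y' h0
      rw [hco, smul_mul_assoc, mul_smul_comm, smul_smul, smul_smul, hm, mul_right_comm, ← sgn_add,
        hs]
      congr 3
      linear_combination h2 (e.par * x'.par p)
  have e2 : ∀ m : Word sh e.cod, (sgn k (e.par * x.par p) * elemMap p F.act e (bv k y) m) •
      coeff k p c (x'.append (y'.append z')).1 (x.append (m.append z)).1 =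
      s • (coeff k p c x'.1 x.1 * ((elemMap p F.act e (bv k y) m • coeff k p c y'.1 m.1) *
        coeff k p c z'.1 z.1)) := fun m => by
    by_cases h0 : elemMap p F.act e (bv k y) m = 0
    · simp [h0]
    · have hm := (F.isHom_elem e).par_eq y m h0
      rw [hco', smul_mul_assoc, mul_smul_comm, smul_smul, smul_smul, mul_right_comm, ← sgn_add,
        hs, hm]
      congr 3
      linear_combination - h2 e.par * z'.par p
  rw [Finset.sum_congr rfl fun m _ => e1 m, Finset.sum_congr rfl fun m _ => e2 m,
    ← Finset.smul_sum, ← Finset.smul_sum, ← Finset.mul_sum, ← Finset.mul_sum, ← Finset.sum_mul,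
    ← Finset.sum_mul, key]

theorem isEquivariant_path (F : Realization C sh p)
    (hF : ∀ e, IsEquivariant p c (elemMap p F.act e)) (P : C.Diag X Y) :
    IsEquivariant p c (pathMap p F.act P) := by
  induction P with
  | nil => exact fun _ _ => rfl
  | cons L P ih =>
    intro α v
    rw [pathMap, ← LinearMap.comp_assoc, isEquivariant_layer F hF L, ih]
    rfl

end Equivariance

/-! ## Matrix units of the centraliser coalgebra -/

section Centraliser

variable {k : Type u} [Field k] {S : Type} [DecidableEq S] {E : Type v} [Fintype E]
  {sh : E → S} {p : E → ZMod 2} {C : CatPres k S} {X Y Z : List S}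

open Signature

theorem dbv_part (u : Word sh X) (i : ZMod 2) :
    dbv k u ∘ₗ part p i = if u.par p = i then dbv k u else 0 :=
  LinearMap.ext fun t => by
    rw [LinearMap.comp_apply, dbv, Finsupp.lapply_apply, part_apply]
    split_ifs <;> rfl

theorem dualMul_dbv (u : Word sh X) (v : Word sh Y) :
    dualMul p (dbv k u) (dbv k v) = sgn k (v.par p * u.par p) • dbv k (u.append v) := by
  classical
  refine tens_ext fun w => ?_
  rw [← w.append_fst_snd, ← tmul_bv, dualMul_bv, tmul_bv, LinearMap.smul_apply, dbv_bv, dbv_bv,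
    dbv_bv]
  by_cases h : u.1 = w.fst.1 ∧ v.1 = w.snd.1
  · rw [if_pos h.1, if_pos h.2, if_pos (by simp only [Word.append, h.1, h.2]), Word.ext h.1,
      Word.ext h.2, mul_one, smul_eq_mul]
  · have h' : (u.append v).1 ≠ (w.fst.append w.snd).1 := fun e => h (by
      have := List.append_inj e (by rw [u.length_eq, w.fst.length_eq])
      exact this)
    rw [if_neg h', smul_zero]
    by_cases h1 : u.1 = w.fst.1
    · rw [if_neg fun h2 => h ⟨h1, h2⟩]; simp
    · rw [if_neg h1]; simp

namespace Realization

variable (F : Realization C sh p)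

/-- The class of `u* ⊗ v`, for words `u` and `v` over the same object, and zero if `u` and `v` lie
over different objects. -/
def cl (u v : List E) : F.CEnd :=
  if h : v.map sh = u.map sh then F.cls (u.map sh) (dbv k ⟨u, rfl⟩ ⊗ₜ bv k ⟨v, h⟩) else 0

theorem cls_dbv_bv (u v : Word sh X) : F.cls X (dbv k u ⊗ₜ bv k v) = F.cl u.1 v.1 := by
  obtain ⟨u, rfl⟩ := u
  rw [cl, dif_pos v.2]

/-- Shows that the matrix units span, which reduces equalities of linear maps on the centraliser
coalgebra to matrix units. -/
theorem cls_eq_sum (α : DualTens k sh X) (v : Tens k sh X) :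
    F.cls X (α ⊗ₜ v) = ∑ u : Word sh X, ∑ w : Word sh X, (α (bv k u) * v w) • F.cl u.1 w.1 := by
  conv_lhs => rw [dual_eq_sum α, tens_eq_sum v]
  simp only [TensorProduct.sum_tmul, TensorProduct.tmul_sum, TensorProduct.smul_tmul_smul, map_sum,
    map_smul, cls_dbv_bv]
  exact Finset.sum_comm

theorem cend_ext_cl {M : Type w} [AddCommGroup M] [Module k M] {f g : F.CEnd →ₗ[k] M}
    (h : ∀ (X : List S) (u v : Word sh X), f (F.cl u.1 v.1) = g (F.cl u.1 v.1)) : f = g :=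
  F.cend_ext fun X α v => by simp only [cls_eq_sum, map_sum, map_smul, h]

theorem eq_top_of_cl {N : Submodule k F.CEnd}
    (h : ∀ (X : List S) (u v : Word sh X), F.cl u.1 v.1 ∈ N) : N = ⊤ := by
  have h1 : N.mkQ = 0 := F.cend_ext_cl fun X u v => by
    rw [LinearMap.zero_apply]
    exact (Submodule.Quotient.mk_eq_zero _).2 (h X u v)
  rw [← N.ker_mkQ, h1, LinearMap.ker_zero]

/-- Two signs combine: `|v||u'|` from the product rule, and `|u'||u|` from the tensor product of
functionals. The result agrees with the sign in `coeff_append`, and this is why `φ` is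
multiplicative. -/
theorem cmul_cl (u v : Word sh X) (u' v' : Word sh Y) :
    F.cmul (F.cl u.1 v.1) (F.cl u'.1 v'.1) =
      sgn k ((u.par p + v.par p) * u'.par p) • F.cl (u.1 ++ u'.1) (v.1 ++ v'.1) := by
  -- The functional dual to `u'` is homogeneous, so only the summand of its own parity survives.
  rw [← cls_dbv_bv, ← cls_dbv_bv, cmul_cls, mulPiece_tmul, Finset.sum_eq_single (u'.par p)]
  · rw [dbv_part, if_pos rfl, dualMul_dbv, tw_bv, map_smul, LinearMap.smul_apply, tmul_bv,
      TensorProduct.smul_tmul_smul, map_smul, cls_dbv_bv, ← sgn_add]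
    congr 2
    ring
  · intro i _ hi
    rw [dbv_part, if_neg (Ne.symm hi), map_zero, TensorProduct.zero_tmul]
  · simp

theorem cl_of_ne {a b : E} (h : sh a ≠ sh b) : F.cl [a] [b] = 0 :=
  dif_neg fun e => h (by simpa using e.symm)

theorem cmul_cl_cons {a b : E} (h : sh a = sh b) (u v : Word sh X) :
    F.cmul (F.cl [a] [b]) (F.cl u.1 v.1) =
      sgn k ((p a + p b) * u.par p) • F.cl (a :: u.1) (b :: v.1) := by
  refine (F.cmul_cl (one a rfl) (one b h.symm) u v).trans ?_
  simp [one, Word.par]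

theorem cone_eq_cl : F.cone = F.cl [] [] := F.cls_dbv_bv _ _

/-- The relations given by an elementary morphism. -/
theorem cl_elem {M N : Type*} [Fintype M] [Fintype N] (e : C.toSignature.Elem) {y' : Word sh e.cod}
    {y : Word sh e.dom} {a : M → k} {m : M → Word sh e.dom} {b : N → k} {n : N → Word sh e.cod}
    (h₁ : dbv k y' ∘ₗ elemMap p F.act e = ∑ i, a i • dbv k (m i))
    (h₂ : elemMap p F.act e (bv k y) = ∑ j, b j • bv k (n j)) (z' z : Word sh Z) :
    ∑ i, a i • F.cl ((m i).1 ++ z'.1) (y.1 ++ z.1) =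
      ∑ j, b j • F.cl (y'.1 ++ z'.1) ((n j).1 ++ z.1) := by
  have hl := dbv_layerMap F.act [] Z e rfl rfl (y'.append z') (nilW sh) y' z' rfl _ _ h₁
    (fun i => (m i).append z') fun _ => rfl
  have hr := layer_apply F.act [] Z e rfl rfl (y.append z) (nilW sh) y z rfl _ _ h₂
    (fun j => (n j).append z) fun _ => rfl
  -- The coalgebra relation for the one-layer diagram `e ⊗ id_Z`. With no letters to the left of
  -- `e`, no sign arises even if `e` is odd.
  have key := F.cls_path (.step [] e Z _ (.nil _)) (dbv k (y'.append z')) (bv k (y.append z))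
  simp only [Path.step, pathMap, LinearMap.id_comp] at key
  erw [hl, hr] at key
  simp only [par_nilW, mul_zero, sgn_zero, one_mul, TensorProduct.sum_tmul, TensorProduct.tmul_sum,
    ← TensorProduct.smul_tmul', TensorProduct.tmul_smul, map_sum, map_smul, cls_dbv_bv] at key
  exact key

theorem cl_cross {a b a' b' : E} (h : sh a = sh b) (h' : sh a' = sh b') (z' z : Word sh Z) :
    sgn k (p a * p a') • F.cl (a :: a' :: z'.1) (b :: b' :: z.1) =
      sgn k (p b * p b') • F.cl (a' :: a :: z'.1) (b' :: b :: z.1) := by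
  have := F.cl_elem (M := Unit) (N := Unit) (.cross (sh a) (sh a')) (a := fun _ => sgn k (p a * p a'))
    (m := fun _ => ⟨[a, a'], rfl⟩) (b := fun _ => sgn k (p b * p b'))
    (n := fun _ => ⟨[b', b], by simp [h, h', Elem.cod]⟩) (y' := ⟨[a', a], rfl⟩)
    (y := ⟨[b, b'], by simp [h, h', Elem.dom]⟩) (by simpa using! dbv_crossMap p a a' rfl rfl)
    (by simpa using! crossMap_two (k := k) p b b' (by simp [h, h']) (by simp [h, h'])) z' z
  simpa using this

/-- The crossing relation `cl_cross`, read as an identity of multiplication operators. Both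
composites are evaluated on a matrix unit by prefixing letters, which avoids any appeal to
associativity. -/
theorem cmul_comm_cl (a b a' b' : E) :
    (F.cmul (F.cl [a] [b]) * F.cmul (F.cl [a'] [b']) : Module.End k F.CEnd) =
      sgn k ((p a + p b) * (p a' + p b')) •
        (F.cmul (F.cl [a'] [b']) * F.cmul (F.cl [a] [b]) : Module.End k F.CEnd) := by
  by_cases h : sh a = sh b
  swap
  · rw [F.cl_of_ne h, map_zero, zero_mul, mul_zero, smul_zero]
  by_cases h' : sh a' = sh b'
  swap
  · rw [F.cl_of_ne h', map_zero, zero_mul, mul_zero, smul_zero]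
  refine F.cend_ext_cl fun X u v => ?_
  have e1 := F.cmul_cl_cons h ((one a' rfl).append u) ((one b' h'.symm).append v)
  have e2 := F.cmul_cl_cons h' ((one a rfl).append u) ((one b h.symm).append v)
  simp only [Word.append, one, List.singleton_append] at e1 e2
  have e3 := F.cl_cross h h' u v
  rw [LinearMap.smul_apply, Module.End.mul_apply, Module.End.mul_apply, F.cmul_cl_cons h',
    F.cmul_cl_cons h, map_smul, map_smul, e1, e2]
  -- Signs are their own inverses, so both crossing signs can be collected on one side.
  have e4 : F.cl (a :: a' :: u.1) (b :: b' :: v.1) =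
      (sgn k (p a * p a') * sgn k (p b * p b')) • F.cl (a' :: a :: u.1) (b' :: b :: v.1) := by
    rw [mul_smul, ← e3, smul_smul, sgn_mul_self, one_smul]
  rw [e4]
  simp only [smul_smul, ← sgn_add]
  congr 2
  simp only [Word.par, List.map_cons, List.sum_cons]
  have h2 := fun x : ZMod 2 => CharTwo.add_self_eq_zero x
  linear_combination -h2 (p a * p b')

end Realization

end Centraliser

/-! ## A criterion for the comparison map to be an isomorphism -/

section Criterion

variable {k : Type u} [Field k] {S : Type} {E : Type v} {sh : E → S} {p : E → ZMod 2}
  {C : CatPres k S} {X : List S} {ι : Type v} [Fintype ι] [DecidableEq ι] {p' : ι → ZMod 2}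
  {G : GroupEqs k p'} {c : E → E → G.O}

open Signature

theorem coeff_mem_gr (hgr : ∀ a b, c a b ∈ G.pres.gr (p a + p b)) (u v : List E) :
    coeff k p c u v ∈ G.pres.gr ((u.map p).sum + (v.map p).sum) := by
  induction u generalizing v with
  | nil =>
    cases v with
    | nil => simpa [coeff] using SetLike.one_mem_graded G.pres.gr
    | cons b v => exact zero_mem _
  | cons a u ih =>
    cases v with
    | nil => exact zero_mem _
    | cons b v =>
      refine Submodule.smul_mem _ _ ?_
      have := SetLike.mul_mem_graded (hgr a b) (ih v)
      simpa only [List.map_cons, List.sum_cons, add_add_add_comm] using this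

theorem coeff_singleton (a b : E) : coeff k p c [a] [b] = c a b := by
  simp [coeff, sgn_zero]

theorem counit_coeff [DecidableEq E] (hc : ∀ a b, G.counit (c a b) = if a = b then 1 else 0)
    (u v : List E) : G.counit (coeff k p c u v) = if u = v then 1 else 0 := by
  induction u generalizing v with
  | nil => cases v <;> simp [coeff]
  | cons a u ih =>
    cases v with
    | nil => simp [coeff]
    | cons b v =>
      rw [coeff, map_smul, map_mul, hc, ih]
      by_cases h : a = b
      · subst h
        simp [CharTwo.add_self_eq_zero, sgn_zero]
      · simp [h]

/-- Adjoining a letter to a word. -/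
def consWord {x : S} (d : {d : E // sh d = x}) (w : Word sh X) : Word sh (x :: X) :=
  ⟨d.1 :: w.1, by rw [List.map_cons, d.2, w.2]⟩

/-- Compares the sum in the coproduct of the coalgebra, over words with first letter lying over `x`,
with the sum in `comul (c a b)`, over all basis elements; those not over `x` contribute zero. -/
theorem sum_consWord [Fintype E] {M : Type*} [AddCommMonoid M] (x : S) (f : E → Word sh X → M)
    (hf : ∀ d w, sh d ≠ x → f d w = 0) (g : Word sh (x :: X) → M)
    (hg : ∀ d w, g (consWord d w) = f d.1 w) : ∑ w, g w = ∑ d, ∑ w, f d w := by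
  classical
  have hb : Function.Bijective fun y : {d : E // sh d = x} × Word sh X => consWord y.1 y.2 := by
    constructor
    · rintro ⟨d, w⟩ ⟨d', w'⟩ h
      have h1 := congrArg Word.list h
      simp only [consWord, List.cons.injEq] at h1
      exact Prod.ext (Subtype.ext h1.1) (Word.ext h1.2)
    · intro w
      obtain ⟨a, ha, u, hu⟩ := Realization.exists_cons w
      exact ⟨(⟨a, ha⟩, u), Word.ext hu.symm⟩
  rw [← hb.sum_comp, Fintype.sum_prod_type]
  simp only [hg]
  refine Fintype.sum_of_injective Subtype.val Subtype.val_injective _ _ (fun d hd => ?_)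
    fun _ => rfl
  refine Finset.sum_eq_zero fun w _ => hf d w fun h => hd ⟨⟨d, h⟩, rfl⟩

/-- Induction on the word, as `comul` is multiplicative. The interchange sign of the graded tensor
square, from moving `c d b` past `coeff u w`, accounts for the difference between the sign of the
long coefficient and the signs of its two factors. -/
theorem comul_coeff [Fintype E] (hgr : ∀ a b, c a b ∈ G.pres.gr (p a + p b))
    (hsh : ∀ a b, sh a ≠ sh b → c a b = 0)
    (hc : ∀ a b, G.comul (c a b) = ∑ d, G.pres.tm (c a d) (c d b)) (u v : Word sh X) :
    G.comul (coeff k p c u.1 v.1) =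
      ∑ w : Word sh X, G.pres.tm (coeff k p c u.1 w.1) (coeff k p c w.1 v.1) := by
  induction X with
  | nil =>
    rw [word_nil u, word_nil v, Fintype.sum_eq_single (Realization.nilW sh)
      fun w hw => (hw (word_nil w)).elim]
    exact map_one _
  | cons x X ih =>
    obtain ⟨a, ha, u, hu⟩ := Realization.exists_cons u
    obtain ⟨b, hb, v, hv⟩ := Realization.exists_cons v
    rw [hu, hv]
    have zl : ∀ y, G.pres.tm 0 y = 0 := fun y => by
      rw [SuperPres.tm, GradedTensorProduct.tmul, TensorProduct.zero_tmul, map_zero]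
    rw [sum_consWord x (fun d w => sgn k ((p a + p b) * u.par p) •
      (sgn k ((p d + p b) * (u.par p + w.par p)) •
        G.pres.tm (c a d * coeff k p c u.1 w.1) (c d b * coeff k p c w.1 v.1)))]
    · rw [coeff, map_smul, map_mul, hc, ih, Finset.sum_mul_sum]
      simp only [Finset.smul_sum]
      refine Finset.sum_congr rfl fun d _ => Finset.sum_congr rfl fun w _ => ?_
      rw [G.pres.tm_mul_tm _ _ (hgr d b) (coeff_mem_gr hgr u.1 w.1)]
      rfl
    · intro d w hd
      rw [hsh a d (by rw [ha]; exact Ne.symm hd), zero_mul, zl, smul_zero, smul_zero]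
    · intro d w
      simp only [consWord, coeff]
      rw [G.pres.tm_smul_left, G.pres.tm_smul_right, smul_smul, smul_smul, ← sgn_add, ← sgn_add]
      congr 2
      change (p a + p d) * u.par p + (p d + p b) * w.par p = _
      linear_combination -CharTwo.add_self_eq_zero (p b * u.par p)

variable [Fintype E] [DecidableEq S] (F : Realization C sh p)

/-- The comparison map is an isomorphism of super bialgebras if the coaction on letters is
compatible with all structures and preserved by the generating morphisms, the coefficients of this
coaction generate `𝒪[G]`, and `𝒪[G]` acts on the centraliser coalgebra such that these
coefficients act by multiplication with the corresponding matrix units. -/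
theorem phiIsIso_of_action (hgr : ∀ a b, c a b ∈ G.pres.gr (p a + p b))
    (hsh : ∀ a b, sh a ≠ sh b → c a b = 0)
    (hact : ∀ g, IsEquivariant p c (F.act g))
    (hcounit : ∀ a b, G.counit (c a b) = Finsupp.single a (1 : k) b)
    (hcomul : ∀ a b, G.comul (c a b) = ∑ d, G.pres.tm (c a d) (c d b))
    (hgen : Algebra.adjoin k (Set.range (Function.uncurry c)) = ⊤)
    (L : G.O →ₐ[k] Module.End k F.CEnd) (hL : ∀ a b, L (c a b) = F.cmul (F.cl [a] [b])) :
    PhiIsIso F G c := by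
  classical
  have hel : ∀ e, IsEquivariant p c (elemMap p F.act e) := fun e => by
    cases e with
    | cross x y => exact isEquivariant_crossMap (fun a b a' b' =>
        G.pres.super_comm (hgr a b) (hgr a' b')) x y
    | of g => exact hact g
  -- Equivariance of all diagrams is precisely the condition for `[α|v]` to descend to the quotient.
  set φ : F.CEnd →ₗ[k] G.O := F.liftC (fun X => TensorProduct.lift (matCoeffLin p c X))
    (fun X Y P α v => by
      rw [TensorProduct.lift.tmul, TensorProduct.lift.tmul]
      exact isEquivariant_path F hel P α v) with hφ
  have φ_cls : ∀ (X : List S) (α : DualTens k sh X) (v : Tens k sh X),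
      φ (F.cls X (α ⊗ₜ v)) = matCoeff p c α v := fun X α v => by
    rw [hφ, F.liftC_cls, TensorProduct.lift.tmul, matCoeffLin_apply]
  have φ_cl : ∀ {X : List S} (u v : Word sh X), φ (F.cl u.1 v.1) = coeff k p c u.1 v.1 :=
    fun u v => by rw [← F.cls_dbv_bv, φ_cls, matCoeff_dbv_bv]
  have φ_one : φ F.cone = 1 := by
    rw [F.cone_eq_cl]
    exact φ_cl (Realization.nilW sh) (Realization.nilW sh)
  have φ_mul : ∀ x y, φ (F.cmul x y) = φ x * φ y := by
    have : F.cmul.compr₂ φ = (LinearMap.mul k G.O).compl₁₂ φ φ :=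
      F.cend_ext_cl fun X u v => F.cend_ext_cl fun Y u' v' => by
        rw [LinearMap.compr₂_apply, LinearMap.compl₁₂_apply, LinearMap.mul_apply', F.cmul_cl,
          map_smul, φ_cl, φ_cl]
        have h1 : φ (F.cl (u.1 ++ u'.1) (v.1 ++ v'.1)) = _ := φ_cl (u.append u') (v.append v')
        rw [h1]
        simp only [Word.append]
        rw [coeff_append _ _ _ _ (by rw [u.length_eq, v.length_eq])]
        exact (smul_smul _ _ _).trans (by rw [Word.par, Word.par, Word.par, sgn_mul_self, one_smul])
    exact fun x y => LinearMap.congr_fun₂ this x y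
  have φ_letter : ∀ a b, φ (F.cl [a] [b]) = c a b := fun a b => by
    by_cases h : sh a = sh b
    · rw [← coeff_singleton (k := k) (p := p) (c := c) a b]
      exact φ_cl (Realization.one a rfl) (Realization.one b h.symm)
    · rw [F.cl_of_ne h, hsh a b h, map_zero]
  -- Through `φ`, the operator `L x` becomes left multiplication by `x`. The set of such `x` is
  -- closed under sums and products, so the letter coefficients suffice.
  have φ_act : ∀ x y, φ (L x y) = x * φ y := fun x => by
    have hx : x ∈ Algebra.adjoin k (Set.range (Function.uncurry c)) := hgen ▸ Algebra.mem_top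
    induction hx using Algebra.adjoin_induction with
    | mem x hx =>
      obtain ⟨⟨a, b⟩, rfl⟩ := hx
      intro y
      rw [Function.uncurry_apply_pair, hL, φ_mul, φ_letter]
    | algebraMap r =>
      intro y
      rw [AlgHom.commutes, Module.algebraMap_end_apply, map_smul, Algebra.smul_def]
    | add a b _ _ ha hb =>
      intro y
      rw [map_add, LinearMap.add_apply, map_add, ha, hb, add_mul]
    | mul a b _ _ ha hb =>
      intro y
      rw [map_mul, Module.End.mul_apply, ha, hb, mul_assoc]
  -- Acting on the unit recovers the matrix unit: at each letter the sign in `coeff` cancels the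
  -- sign in `cmul_cl_cons`.
  have L_coeff : ∀ {X : List S} (u v : Word sh X),
      L (coeff k p c u.1 v.1) F.cone = F.cl u.1 v.1 := by
    intro X
    induction X with
    | nil =>
      intro u v
      rw [word_nil u, word_nil v, F.cone_eq_cl]
      exact LinearMap.congr_fun (map_one L) _
    | cons x X ih =>
      intro u v
      obtain ⟨a, ha, u, hu⟩ := Realization.exists_cons u
      obtain ⟨b, hb, v, hv⟩ := Realization.exists_cons v
      rw [hu, hv, coeff, map_smul, map_mul, LinearMap.smul_apply, Module.End.mul_apply, ih, hL,
        F.cmul_cl_cons (ha.trans hb.symm), smul_smul]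
      change (sgn k ((p a + p b) * u.par p) * _) • _ = _
      rw [sgn_mul_self, one_smul]
  -- The candidate inverse is evaluation of the action at the unit, `x ↦ L x 1`.
  have left : (LinearMap.flip L.toLinearMap F.cone) ∘ₗ φ = LinearMap.id :=
    F.cend_ext_cl fun X u v => by
      rw [LinearMap.comp_apply, φ_cl]
      exact L_coeff u v
  have right : φ ∘ₗ (LinearMap.flip L.toLinearMap F.cone) = LinearMap.id :=
    LinearMap.ext fun x => (φ_act x F.cone).trans (by rw [φ_one, mul_one]; rfl)
  set Φ := LinearEquiv.ofLinearMap φ _ right left with hΦ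
  have hΦφ : Φ.toLinearMap = φ := rfl
  refine ⟨Φ, φ_cls, φ_one, φ_mul, ?_, ?_, ?_⟩
  · have : G.counit.toLinearMap ∘ₗ φ = F.counit := F.cend_ext_cl fun X u v => by
      rw [LinearMap.comp_apply, φ_cl, ← F.cls_dbv_bv, Realization.counit, F.liftC_cls,
        contractLeft_apply, dbv_bv]
      refine counit_coeff (fun a b => ?_) u.1 v.1
      rw [hcounit, Finsupp.single_apply]
    exact fun x => LinearMap.congr_fun this x
  · have : G.comul.toLinearMap ∘ₗ φ = (GradedTensorProduct.of k G.pres.gr G.pres.gr).toLinearMap ∘ₗ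
        TensorProduct.map φ φ ∘ₗ F.comul := F.cend_ext_cl fun X u v => by
      rw [LinearMap.comp_apply, φ_cl]
      refine (comul_coeff hgr hsh hcomul u v).trans ?_
      rw [LinearMap.comp_apply, LinearMap.comp_apply, ← F.cls_dbv_bv, Realization.comul,
        F.liftC_cls, LinearMap.sum_apply, map_sum, map_sum]
      refine Finset.sum_congr rfl fun w _ => ?_
      rw [TensorProduct.map_tmul, LinearMap.comp_apply, LinearMap.comp_apply,
        LinearMap.flip_apply, TensorProduct.mk_apply, TensorProduct.mk_apply,
        TensorProduct.map_tmul, F.cls_dbv_bv, F.cls_dbv_bv, φ_cl, φ_cl]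
      rfl
    exact fun x => LinearMap.congr_fun this x
  · intro i
    rw [hΦφ]
    refine le_antisymm ?_ fun x hx => ?_
    · rw [Realization.cgr, Submodule.map_span, Submodule.span_le]
      rintro _ ⟨_, ⟨X, u, w, rfl, rfl⟩, rfl⟩
      rw [F.cls_dbv_bv, φ_cl]
      exact coeff_mem_gr hgr u.1 w.1
    -- Each matrix unit is sent to a homogeneous element, so its component of parity `i` is either
    -- its full image, coming from `cgr i`, or zero. By linearity the component of parity `i` of
    -- every image lies in `φ (cgr i)`; for a preimage of `x` of parity `i` this component is `x`.
    · have htop : ((F.cgr i).map φ).comap (GradedAlgebra.proj G.pres.gr i ∘ₗ φ) = ⊤ :=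
        F.eq_top_of_cl fun X u v => by
          have hmem : coeff k p c u.1 v.1 ∈ G.pres.gr (u.par p + v.par p) :=
            coeff_mem_gr hgr u.1 v.1
          rw [Submodule.mem_comap, LinearMap.comp_apply, φ_cl, GradedAlgebra.proj_apply]
          by_cases h : u.par p + v.par p = i
          · subst h
            rw [DirectSum.decompose_of_mem_same _ hmem, ← φ_cl]
            exact Submodule.mem_map_of_mem (Submodule.subset_span
              ⟨X, u, v, rfl, (F.cls_dbv_bv u v).symm⟩)
          · rw [DirectSum.decompose_of_mem_ne _ hmem h]
            exact zero_mem _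
      have hy : Φ.symm x ∈ ((F.cgr i).map φ).comap (GradedAlgebra.proj G.pres.gr i ∘ₗ φ) :=
        htop ▸ Submodule.mem_top
      have e : φ (Φ.symm x) = x := Φ.apply_symm_apply x
      rwa [Submodule.mem_comap, LinearMap.comp_apply, e, GradedAlgebra.proj_apply,
        DirectSum.decompose_of_mem_same _ hx] at hy

end Criterion

/-! ## The oriented categories -/

section Oriented

variable {k : Type u} [Field k] {ι : Type v} [Fintype ι] [DecidableEq ι] {p : ι → ZMod 2}

open Signature

/-! ### Structure maps on the coefficients of `V` and `V*` -/

namespace GroupEqs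

variable (G : GroupEqs k p)

theorem counit_X (i j : ι) : G.counit (G.X i j) = if i = j then 1 else 0 :=
  G.pres.lift_gen _ _ _ _

theorem counit_Z (i j : ι) : G.counit (G.Z i j) = if i = j then 1 else 0 :=
  G.pres.lift_gen _ _ _ _

theorem comul_X (i j : ι) : G.comul (G.X i j) = ∑ l, G.pres.tm (G.X i l) (G.X l j) :=
  G.pres.lift_gen _ _ _ _

theorem comul_Z (j l : ι) : G.comul (G.Z j l) =
    ∑ m, sgn k ((p j + p m) * (p m + p l)) • G.pres.tm (G.Z m l) (G.Z j m) :=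
  G.pres.lift_gen _ _ _ _

theorem adjoin_eq_top {A : Subalgebra k G.O} (hX : ∀ i j, G.X i j ∈ A) (hZ : ∀ i j, G.Z i j ∈ A) :
    A = ⊤ := by
  rw [← top_le_iff, ← G.pres.adjoin_gen, Algebra.adjoin_le_iff]
  rintro _ ⟨t, rfl⟩
  cases t with
  | X i j => exact hX i j
  | Z i j => exact hZ i j

theorem dualCoact_mem_gr (a b : ι ⊕ ι) :
    G.dualCoact a b ∈ G.pres.gr (dpar p a + dpar p b) := by
  rcases a with j | j <;> rcases b with i | i
  · exact G.X_mem j i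
  · exact zero_mem _
  · exact zero_mem _
  · refine Submodule.smul_mem _ _ ?_
    change G.Z i j ∈ G.pres.gr (p j + p i)
    rw [add_comm]
    exact G.Z_mem i j

theorem counit_dualCoact (a b : ι ⊕ ι) :
    G.counit (G.dualCoact a b) = Finsupp.single a (1 : k) b := by
  rw [Finsupp.single_apply]
  rcases a with j | j <;> rcases b with i | i
  · simp only [dualCoact, counit_X, Sum.inl.injEq]
  · simp [dualCoact]
  · simp [dualCoact]
  · simp only [dualCoact, map_smul, counit_Z, Sum.inr.injEq]
    by_cases h : i = j
    · subst h
      simp [CharTwo.add_self_eq_zero, sgn_zero]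
    · simp [h, Ne.symm h]

/-- The coproduct of `Z` has its factors in reversed order. Since `dualCoact` transposes the indices
of `Z`, the order becomes that of a matrix coproduct, and its signs absorb the sign in `comul_Z`. -/
theorem comul_dualCoact (a b : ι ⊕ ι) :
    G.comul (G.dualCoact a b) = ∑ d, G.pres.tm (G.dualCoact a d) (G.dualCoact d b) := by
  have zl : ∀ y, G.pres.tm 0 y = 0 := fun y => by
    rw [SuperPres.tm, GradedTensorProduct.tmul, TensorProduct.zero_tmul, map_zero]
  have zr : ∀ y, G.pres.tm y 0 = 0 := fun y => by
    rw [SuperPres.tm, GradedTensorProduct.tmul, TensorProduct.tmul_zero, map_zero]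
  rw [Fintype.sum_sum_type]
  rcases a with j | j <;> rcases b with i | i
  · simp only [dualCoact, comul_X, zl, Finset.sum_const_zero, add_zero]
  · simp only [dualCoact, map_zero, zl, zr, Finset.sum_const_zero, add_zero]
  · simp only [dualCoact, map_zero, zl, zr, Finset.sum_const_zero, add_zero]
  · simp only [dualCoact, map_smul, comul_Z, zl, Finset.sum_const_zero, zero_add, Finset.smul_sum,
      G.pres.tm_smul_left, G.pres.tm_smul_right, smul_smul, ← sgn_add]
    refine Finset.sum_congr rfl fun m _ => ?_
    congr 2
    generalize p i = a
    generalize p j = b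
    generalize p m = c
    revert a b c
    decide

theorem adjoin_dualCoact : Algebra.adjoin k (Set.range (Function.uncurry G.dualCoact)) = ⊤ := by
  refine G.adjoin_eq_top (fun i j => Algebra.subset_adjoin ⟨(.inl i, .inl j), rfl⟩) fun i j => ?_
  have h : sgn k (p j * (p i + p j)) • G.dualCoact (.inr j) (.inr i) = G.Z i j := by
    rw [dualCoact, smul_smul, sgn_mul_self, one_smul]
  have h' : G.dualCoact (.inr j) (.inr i) ∈
      Algebra.adjoin k (Set.range (Function.uncurry G.dualCoact)) :=
    Algebra.subset_adjoin ⟨(.inr j, .inr i), rfl⟩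
  rw [← h]
  exact Subalgebra.smul_mem _ h' _

end GroupEqs

/-! ### Transposes and equivariance of the oriented generators -/

theorem dbv_evMap : dbv k (Realization.nilW (arrowSh ι)) ∘ₗ evMap k ι =
    ∑ m, (1 : k) • dbv k (updn m m) := by
  refine tens_ext fun w => ?_
  obtain ⟨i, j, rfl⟩ := exists_updn w
  rw [LinearMap.comp_apply, ev_updn, map_smul, LinearMap.sum_apply]
  simp only [LinearMap.smul_apply, dbv_bv]
  simp [updn, ite_and]

theorem dbv_coevMap (i j : ι) : dbv k (dnup i j) ∘ₗ coevMap k ι =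
    (if i = j then 1 else 0 : k) • dbv k (Realization.nilW (arrowSh ι)) := by
  refine tens_ext fun w => ?_
  rw [word_nil w, LinearMap.comp_apply, coev_nil, map_sum, LinearMap.smul_apply]
  simp only [map_smul, dbv_bv]
  simp [dnup, ite_and]
  simp only [eq_comm]

theorem dbv_endoMap (Q : Matrix ι ι k) (j : ι) : dbv k (dnW j) ∘ₗ endoMap Q =
    ∑ i, Q j i • dbv k (dnW i) := by
  refine tens_ext fun w => ?_
  obtain ⟨i, rfl⟩ := exists_dnW w
  rw [LinearMap.comp_apply, endo_dnW, map_sum, LinearMap.sum_apply]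
  simp only [map_smul, LinearMap.smul_apply, dbv_bv]
  simp [dnW]

theorem exists_dnup (w : Word (arrowSh ι) [.dn, .up]) : ∃ i j, w = dnup i j := by
  obtain ⟨x, hx, v, hv⟩ := Realization.exists_cons w
  obtain ⟨i, rfl⟩ := exists_dn hx
  obtain ⟨j, rfl⟩ := exists_upW v
  exact ⟨i, j, Word.ext hv⟩

variable (G : GroupEqs k p)

/-- Equivariance of the evaluation is `ZX = 1`: the sign in the coaction on `V*` cancels the sign of
the tensor product coaction. -/
theorem isEquivariant_evMap : IsEquivariant (dpar p) G.dualCoact (evMap k ι) := by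
  refine isEquivariant_of_basis fun u v => ?_
  obtain ⟨i, j, rfl⟩ := exists_updn v
  rw [word_nil u]
  refine (matCoeff_expand (N := Unit) dbv_evMap (b := fun _ => if i = j then 1 else 0)
    (n := fun _ => Realization.nilW (arrowSh ι)) (by simpa using ev_updn (k := k) i j)).2 ?_
  have h1 : ∀ m, (1 : k) • coeff k (dpar p) G.dualCoact (updn m m).1 (updn i j).1 =
      G.Z i m * G.X m j := fun m => by
    simp only [updn, coeff, GroupEqs.dualCoact, List.map_cons, List.map_nil, List.sum_cons,
      List.sum_nil, add_zero, mul_zero, sgn_zero, one_smul, mul_one, smul_mul_assoc, smul_smul,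
      Sum.elim_inl, Sum.elim_inr]
    rw [one_mul, mul_comm (p m), add_comm (p i), sgn_mul_self, one_smul]
  rw [Finset.sum_congr rfl fun m _ => h1 m, G.Z_mul_X]
  simp [Realization.nilW, coeff]

/-- Here the derived identity `XZ = 1` enters. The signs combine to one that does not depend on the
summation index. -/
theorem isEquivariant_coevMap : IsEquivariant (dpar p) G.dualCoact (coevMap k ι) := by
  refine isEquivariant_of_basis fun u v => ?_
  obtain ⟨i, j, rfl⟩ := exists_dnup u
  rw [word_nil v]
  refine (matCoeff_expand (M := Unit) (a := fun _ => if i = j then 1 else 0)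
    (m := fun _ => Realization.nilW (arrowSh ι)) (by simpa using dbv_coevMap (k := k) i j) (coev_nil _)).2 ?_
  have h1 : ∀ m, (1 : k) • coeff k (dpar p) G.dualCoact (dnup i j).1 (dnup m m).1 =
      sgn k (p i * p j + p j) • (G.X i m * G.Z m j) := fun m => by
    simp only [dnup, coeff, GroupEqs.dualCoact, List.map_cons, List.map_nil, List.sum_cons,
      List.sum_nil, add_zero, mul_zero, sgn_zero, one_mul, mul_one, mul_smul_comm, smul_smul,
      Sum.elim_inl, Sum.elim_inr, ← sgn_add]
    congr 2
    generalize p i = a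
    generalize p j = b
    generalize p m = c
    revert a b c
    decide
  rw [Finset.sum_congr rfl fun m _ => h1 m, ← Finset.smul_sum (r := sgn k (p i * p j + p j)),
    G.X_mul_Z]
  by_cases h : i = j
  · subst h
    -- On the diagonal the remaining sign is trivial, because squaring is the identity on `ZMod 2`.
    have h2 : p i * p i + p i = 0 := by generalize p i = a; revert a; decide
    simp [h2, sgn_zero, Realization.nilW, coeff]
  · simp [h]

theorem isEquivariant_endoMap (Q : Matrix ι ι k)
    (hQ : ∀ i l, ∑ j, Q j l • G.X i j = ∑ j, Q i j • G.X j l) :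
    IsEquivariant (dpar p) G.dualCoact (endoMap Q) := by
  refine isEquivariant_of_basis fun u v => ?_
  obtain ⟨i, rfl⟩ := exists_dnW u
  obtain ⟨l, rfl⟩ := exists_dnW v
  refine (matCoeff_expand (dbv_endoMap Q i) (endo_dnW Q l)).2 ?_
  simp only [dnW, coeff_singleton, GroupEqs.dualCoact]
  exact (hQ i l).symm

/-! ### Action of the coordinates in the oriented case -/

/-- The operators on the centraliser coalgebra by which the coordinates act. -/
def orientedGen {C : CatPres k Arrow} (F : Realization C (arrowSh ι) (dpar p)) :
    Coord ι → Module.End k F.CEnd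
  | .X i j => F.cmul (F.cl [.inl i] [.inl j])
  | .Z i j => sgn k (p j * (p i + p j)) • F.cmul (F.cl [.inr j] [.inr i])

theorem orientedGen_comm {C : CatPres k Arrow} (F : Realization C (arrowSh ι) (dpar p))
    (s t : Coord ι) : orientedGen F s * orientedGen F t =
      sgn k (Coord.par p s * Coord.par p t) • (orientedGen F t * orientedGen F s) := by
  -- Each coordinate acts by a scalar multiple of a matrix unit of its own parity, so `cmul_comm_cl`
  -- covers all four combinations of `X` and `Z`.
  have key : ∀ s : Coord ι, ∃ (r : k) (a b : ι ⊕ ι), dpar p a + dpar p b = Coord.par p s ∧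
      orientedGen F s = r • F.cmul (F.cl [a] [b]) := by
    rintro (⟨i, j⟩ | ⟨i, j⟩)
    · exact ⟨1, .inl i, .inl j, rfl, (one_smul _ _).symm⟩
    · exact ⟨_, .inr j, .inr i, add_comm _ _, rfl⟩
  obtain ⟨r, a, b, h, e⟩ := key s
  obtain ⟨r', a', b', h', e'⟩ := key t
  rw [e, e', ← h, ← h', smul_mul_smul_comm, smul_mul_smul_comm, F.cmul_comm_cl, smul_smul,
    smul_smul]
  congr 1
  ring

variable {A : Type} {δ : k} {Q : A → Matrix ι ι k} (hQ : ∀ a i j, p i + p j ≠ 1 → Q a i j = 0)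
  (hQ2 : ∀ a, Q a * Q a = 1) (hδ : ∑ i, sgn k (p i) = δ)

/-- This is the coalgebra relation of `ev` at `(e i)* ⊗ e l`. The sign of the composite operators is
independent of `j`, and it is trivial when `i = l`, the only case in which the right side is
nonzero. -/
theorem orientedGen_inv (i l : ι) :
    ∑ j, orientedGen (obFunctor p A δ Q hQ hQ2 hδ) (.Z i j) *
      orientedGen (obFunctor p A δ Q hQ hQ2 hδ) (.X j l) = if i = l then 1 else 0 := by
  set F := obFunctor p A δ Q hQ hQ2 hδ with hF
  refine F.cend_ext_cl fun Y u v => ?_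
  have e1 : ∀ j, (orientedGen F (.Z i j) * orientedGen F (.X j l)) (F.cl u.1 v.1) =
      sgn k ((p l + p i) * u.par (dpar p)) •
        F.cl (.inr j :: .inl j :: u.1) (.inr i :: .inl l :: v.1) := fun j => by
    have e2 := F.cmul_cl_cons (a := .inr j) (b := .inr i) rfl ((dnW j).append u) ((dnW l).append v)
    simp only [Word.append, dnW, List.singleton_append] at e2
    rw [Module.End.mul_apply, orientedGen, orientedGen, LinearMap.smul_apply,
      F.cmul_cl_cons (a := .inl j) (b := .inl l) rfl u v, map_smul, e2, smul_smul, smul_smul,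
      ← sgn_add, ← sgn_add]
    congr 2
    simp only [Word.par, List.map_cons, List.sum_cons, Sum.elim_inl, Sum.elim_inr]
    generalize (u.1.map (dpar p)).sum = d
    generalize p i = a
    generalize p j = b
    generalize p l = c
    revert a b c d
    decide
  have e3 := F.cl_elem (N := Unit) (.of OBGen.ev) (y := updn i l) dbv_evMap
    (b := fun _ => if i = l then 1 else 0) (n := fun _ => Realization.nilW (arrowSh ι))
    (by simpa using! ev_updn (k := k) i l) u v
  rw [LinearMap.sum_apply, Finset.sum_congr rfl fun j _ => e1 j, ← Finset.smul_sum]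
  simp only [one_smul, updn, Realization.nilW, List.cons_append, List.nil_append,
    Finset.univ_unique, Finset.sum_singleton] at e3
  rw [e3]
  by_cases h : i = l
  · subst h
    simp [CharTwo.add_self_eq_zero, sgn_zero]
  · simp [h]

/-- This is the coalgebra relation of the odd endomorphism. Since `Q a` is odd, `[j]` is `[l] + 1`
on one side and `[i] + 1` on the other wherever its entry is nonzero, so all terms carry the same
sign. -/
theorem orientedGen_endo (a : A) (i l : ι) :
    ∑ j, Q a j l • orientedGen (obFunctor p A δ Q hQ hQ2 hδ) (.X i j) =
      ∑ j, Q a i j • orientedGen (obFunctor p A δ Q hQ hQ2 hδ) (.X j l) := by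
  set F := obFunctor p A δ Q hQ hQ2 hδ with hF
  refine F.cend_ext_cl fun Y u v => ?_
  have e1 : ∀ j, (Q a j l • orientedGen F (.X i j)) (F.cl u.1 v.1) =
      sgn k ((p i + p l + 1) * u.par (dpar p)) • Q a j l • F.cl (.inl i :: u.1) (.inl j :: v.1) :=
    fun j => by
      by_cases h : p j + p l = 1
      · have h' : p j = p l + 1 := by
          linear_combination h - CharTwo.add_self_eq_zero (p l)
        rw [LinearMap.smul_apply, orientedGen, F.cmul_cl_cons (a := .inl i) (b := .inl j) rfl u v,
          smul_comm]
        simp only [Sum.elim_inl, h', add_assoc]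
      · rw [hQ a _ _ h]; simp
  have e2 : ∀ j, (Q a i j • orientedGen F (.X j l)) (F.cl u.1 v.1) =
      sgn k ((p i + p l + 1) * u.par (dpar p)) • Q a i j • F.cl (.inl j :: u.1) (.inl l :: v.1) :=
    fun j => by
      by_cases h : p i + p j = 1
      · have h' : p j = p i + 1 := by
          linear_combination h - CharTwo.add_self_eq_zero (p i)
        rw [LinearMap.smul_apply, orientedGen, F.cmul_cl_cons (a := .inl j) (b := .inl l) rfl u v,
          smul_comm]
        simp only [Sum.elim_inl, h', add_right_comm]
      · rw [hQ a _ _ h]; simp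
  have e3 := F.cl_elem (.of (OBGen.endo a)) (y' := dnW i) (y := dnW l) (dbv_endoMap (Q a) i)
    (endo_dnW (Q a) l) u v
  rw [LinearMap.sum_apply, LinearMap.sum_apply, Finset.sum_congr rfl fun j _ => e1 j,
    Finset.sum_congr rfl fun j _ => e2 j, ← Finset.smul_sum, ← Finset.smul_sum]
  exact congrArg _ e3.symm

/-- Treats `GL(V)` and `Q(V)` together. The two hypotheses bound `G` from both sides: `hX` says that
its equations imply commutation with the endomorphisms, so that `φ` exists, and `hrel` that its
equations hold in the coalgebra, so that the action exists. -/
theorem phiIsIso_obFunctor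
    (hX : ∀ a i l, ∑ j, Q a j l • G.X i j = ∑ j, Q a i j • G.X j l)
    (hrel : ∀ r ∈ G.rel,
      FreeAlgebra.lift k (orientedGen (obFunctor p A δ Q hQ hQ2 hδ)) r = 0) :
    PhiIsIso (obFunctor p A δ Q hQ hQ2 hδ) G G.dualCoact := by
  set F := obFunctor p A δ Q hQ hQ2 hδ with hF
  let L : G.O →ₐ[k] Module.End k F.CEnd := G.pres.lift (orientedGen F) (orientedGen_comm F)
    fun r hr => hr.elim
      (by
        rintro ⟨i, l, rfl⟩
        rw [map_sub, sub_eq_zero, map_sum, AlgHom.commutes]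
        simp only [map_mul, FreeAlgebra.lift_ι_apply]
        refine (orientedGen_inv hQ hQ2 hδ i l).trans ?_
        split_ifs <;> simp)
      (hrel r)
  refine phiIsIso_of_action F G.dualCoact_mem_gr ?_ ?_ G.counit_dualCoact G.comul_dualCoact
    G.adjoin_dualCoact L ?_
  · rintro (i | i) (j | j) h
    · exact (h rfl).elim
    · rfl
    · rfl
    · exact (h rfl).elim
  · rintro (_ | _ | a)
    · exact isEquivariant_evMap G
    · exact isEquivariant_coevMap G
    · exact isEquivariant_endoMap G (Q a) (hX a)
  · rintro (i | i) (j | j)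
    · exact G.pres.lift_gen _ _ _ (.X i j)
    · rw [F.cl_of_ne (by simp), map_zero]
      exact map_zero L
    · rw [F.cl_of_ne (by simp), map_zero]
      exact map_zero L
    -- The sign in the coaction on `V*` and the sign in `orientedGen` are equal and cancel.
    · rw [GroupEqs.dualCoact, map_smul]
      refine (congrArg _ (G.pres.lift_gen _ _ _ (.Z j i))).trans ?_
      rw [orientedGen, smul_smul, sgn_mul_self, one_smul]

end Oriented

/-! ## The Brauer category and the periplectic Brauer category -/

section Unoriented

variable {k : Type u} [Field k] {ι : Type v} [Fintype ι] [DecidableEq ι] {p : ι → ZMod 2}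
  {γ : ZMod 2} {g : Matrix ι ι k}

open Signature

/-- The left inverse of a matrix `x` which preserves the form with Gram matrix `g`. -/
def formInv {B : Type w} [Ring B] [Algebra k B] (p : ι → ZMod 2) (g : Matrix ι ι k)
    (x : ι → ι → B) (l b : ι) : B :=
  ∑ i, ∑ a, (g⁻¹ l i * (sgn k (p b * (p a + p i)) * g a b)) • x a i

/-- After pulling out `g⁻¹`, the inner sum is the equation of the form, and `g⁻¹ g = 1` remains. The
algebra `B` is arbitrary because the lemma serves twice: in `𝒪[G]`, and for operators on the
centraliser coalgebra. -/
theorem formInv_mul (hg : IsGram p γ g) {B : Type w} [Ring B] [Algebra k B] {x : ι → ι → B}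
    (hx : ∀ i j, ∑ a, ∑ b, (sgn k (p b * (p a + p i)) * g a b) • (x a i * x b j) =
      algebraMap k B (g i j)) (l j : ι) :
    ∑ b, formInv p g x l b * x b j = if l = j then 1 else 0 := by
  have h1 : ∀ b, formInv p g x l b * x b j = ∑ i, g⁻¹ l i •
      ∑ a, (sgn k (p b * (p a + p i)) * g a b) • (x a i * x b j) := fun b => by
    simp only [formInv, Finset.sum_mul, Finset.smul_sum, smul_mul_assoc, smul_smul]
  rw [Finset.sum_congr rfl fun b _ => h1 b, Finset.sum_comm]
  have h2 : ∀ i, ∑ b, g⁻¹ l i • ∑ a, (sgn k (p b * (p a + p i)) * g a b) • (x a i * x b j) =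
      algebraMap k B (g⁻¹ l i * g i j) := fun i => by
    rw [← Finset.smul_sum, Finset.sum_comm, hx, map_mul, Algebra.smul_def]
  rw [Finset.sum_congr rfl fun i _ => h2 i, ← map_sum, hg.inv_mul]
  split_ifs <;> simp

/-- In a nonzero term `[l] + [i] = γ = [a] + [b]`, so `x a i` has parity `[l] + [b]`. Hence the sum
obeys the commutation rule expected of `Z l b`. -/
theorem formInv_comm (hg : IsGram p γ g) {B : Type w} [Ring B] [Algebra k B] {x : ι → ι → B}
    {d : ZMod 2} {y : B} (hy : ∀ a i, x a i * y = sgn k ((p a + p i) * d) • (y * x a i))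
    (l b : ι) : formInv p g x l b * y = sgn k ((p l + p b) * d) • (y * formInv p g x l b) := by
  simp only [formInv, Finset.sum_mul, Finset.mul_sum, Finset.smul_sum]
  refine Finset.sum_congr rfl fun i _ => Finset.sum_congr rfl fun a _ => ?_
  rw [smul_mul_assoc, mul_smul_comm, hy, smul_comm]
  by_cases h1 : p l + p i = γ
  · by_cases h2 : p a + p b = γ
    · congr 3
      have h3 := fun x : ZMod 2 => CharTwo.add_self_eq_zero x
      linear_combination h2 - h1 - h3 (p b) + h3 (p i)
    · rw [hg.homog _ _ h2]; simp
  · rw [hg.inv_homog _ _ h1]; simp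

theorem dbv_capMap (g : Matrix ι ι k) : dbv k (Realization.nilW (unitSh ι)) ∘ₗ capMap g =
    ∑ m : ι × ι, g m.1 m.2 • dbv k (two m.1 m.2) := by
  refine tens_ext fun w => ?_
  obtain ⟨i, j, rfl⟩ := exists_two w
  rw [LinearMap.comp_apply, cap_two, map_smul, LinearMap.sum_apply, Finset.sum_eq_single (i, j)]
  · simp
  · intro m _ hm
    rw [LinearMap.smul_apply, dbv_bv, if_neg, smul_zero]
    intro h
    simp only [two, List.cons.injEq, and_true] at h
    exact hm (Prod.ext h.1 h.2)
  · simp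

theorem dbv_cupMap (p : ι → ZMod 2) (γ : ZMod 2) (g : Matrix ι ι k) (i j : ι) :
    dbv k (two i j) ∘ₗ cupMap p γ g =
      (sgn k (γ * p j) * g⁻¹ i j) • dbv k (Realization.nilW (unitSh ι)) := by
  refine tens_ext fun w => ?_
  rw [word_nil w, LinearMap.comp_apply, cup_nil, map_sum, Finset.sum_eq_single (i, j)]
  · simp
  · intro m _ hm
    rw [map_smul, dbv_bv, if_neg, smul_zero]
    intro h
    simp only [two, List.cons.injEq, and_true] at h
    exact hm (Prod.ext h.1.symm h.2.symm)
  · simp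

theorem coeff_two {O : Type w} [Ring O] [Algebra k O] (c : ι → ι → O) (a b i j : ι) :
    coeff k p c [a, b] [i, j] = sgn k ((p a + p i) * p b) • (c a i * c b j) := by
  simp [coeff, sgn_zero]

/-! ### Consequences of the equations of the form in `𝒪[G]` -/

section Group

variable (hg : IsGram p γ g)

theorem formEqs_rel (i j : ι) :
    ∑ a, ∑ b, (sgn k (p b * (p a + p i)) * g a b) •
      ((formEqs p g γ hg.homog).X a i * (formEqs p g γ hg.homog).X b j) =
        algebraMap k _ (g i j) := by
  have := (formEqs p g γ hg.homog).pres.quo_rel (Or.inr ⟨i, j, rfl⟩)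
  rw [map_sub, sub_eq_zero, AlgHom.commutes] at this
  simp only [map_sum, map_smul, map_mul] at this
  exact this

/-- Both are left inverses of `X`, and left inverses are unique because `Z` is a two-sided inverse.
Thus `Z` is a linear expression in `X`. -/
theorem formInv_eq_Z : Matrix.of (formInv p g (formEqs p g γ hg.homog).X) =
    Matrix.of (formEqs p g γ hg.homog).Z :=
  GroupEqs.eq_Z _ (by
    ext l j
    rw [Matrix.mul_apply, Matrix.one_apply]
    exact formInv_mul hg (formEqs_rel hg) l j)

/-- The matrix `X` preserves the copairing. -/
theorem formEqs_dual_rel (a b : ι) :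
    ∑ i, ∑ j, (sgn k (γ * p j) * g⁻¹ i j * sgn k ((p a + p i) * p b)) •
      ((formEqs p g γ hg.homog).X a i * (formEqs p g γ hg.homog).X b j) =
        algebraMap k _ (sgn k (γ * p b) * g⁻¹ a b) := by
  set G := formEqs p g γ hg.homog with hG
  -- The identity `XZ = 1` with `Z` replaced by its expression in `X`.
  have h1 : ∀ d, ∑ l, ∑ i, ∑ e, (g⁻¹ l i * (sgn k (p d * (p e + p i)) * g e d)) •
      (G.X a l * G.X e i) = if a = d then 1 else 0 := fun d => by
    rw [← G.X_mul_Z a d]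
    refine Finset.sum_congr rfl fun l _ => ?_
    have h2 : formInv p g G.X l d = G.Z l d := congrFun (congrFun (formInv_eq_Z hg) l) d
    rw [← h2, formInv]
    simp only [Finset.mul_sum, mul_smul_comm]
  -- Contracting with `g⁻¹ d b` over `d` removes the Gram matrix: homogeneity gives `[d] = [e] + γ`,
  -- so the sign leaves the sum, and `g g⁻¹ = 1` forces `e = b`.
  have h2 : ∀ l i, ∑ e, ∑ d, (g⁻¹ d b * (g⁻¹ l i * (sgn k (p d * (p e + p i)) * g e d))) •
      (G.X a l * G.X e i) =
        (g⁻¹ l i * sgn k ((p b + γ) * (p b + p i))) • (G.X a l * G.X b i) := fun l i => by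
    have h3 : ∀ e, ∑ d, (g⁻¹ d b * (g⁻¹ l i * (sgn k (p d * (p e + p i)) * g e d))) •
        (G.X a l * G.X e i) = (if e = b then
          g⁻¹ l i * sgn k ((p e + γ) * (p e + p i)) else 0) • (G.X a l * G.X e i) := fun e => by
      rw [← Finset.sum_smul]
      congr 1
      have h4 : ∀ d, g⁻¹ d b * (g⁻¹ l i * (sgn k (p d * (p e + p i)) * g e d)) =
          (g⁻¹ l i * sgn k ((p e + γ) * (p e + p i))) * (g e d * g⁻¹ d b) := fun d => by
        by_cases hd : p e + p d = γ
        · have : p d = p e + γ := by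
            linear_combination hd - CharTwo.add_self_eq_zero (p e)
          rw [this]; ring
        · rw [hg.homog _ _ hd]; ring
      rw [Finset.sum_congr rfl fun d _ => h4 d, ← Finset.mul_sum, hg.mul_inv, mul_ite, mul_one,
        mul_zero]
    rw [Finset.sum_congr rfl fun e _ => h3 e]
    simp
  have h3 : ∑ l, ∑ i, (g⁻¹ l i * sgn k ((p b + γ) * (p b + p i))) • (G.X a l * G.X b i) =
      algebraMap k G.O (g⁻¹ a b) := by
    rw [Finset.sum_congr rfl fun l _ => Finset.sum_congr rfl fun i _ => (h2 l i).symm]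
    have h4 : ∑ d, g⁻¹ d b • (if a = d then 1 else 0 : G.O) = algebraMap k G.O (g⁻¹ a b) := by
      simp [Algebra.algebraMap_eq_smul_one]
    rw [← h4, Finset.sum_congr rfl fun d _ => congrArg _ (h1 d).symm]
    simp only [Finset.smul_sum, smul_smul]
    symm
    rw [Finset.sum_comm]
    refine Finset.sum_congr rfl fun l _ => ?_
    rw [Finset.sum_comm]
    refine Finset.sum_congr rfl fun i _ => ?_
    rw [Finset.sum_comm]
  -- On the support of `g⁻¹` the desired sign differs from that in `h3` by a factor depending only
  -- on `a` and `b`.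
  have h5 : ∀ i j, (sgn k (γ * p j) * g⁻¹ i j * sgn k ((p a + p i) * p b)) • (G.X a i * G.X b j) =
      sgn k (γ * p b + p b * (p a + p b + γ)) •
        (g⁻¹ i j * sgn k ((p b + γ) * (p b + p j))) • (G.X a i * G.X b j) := fun i j => by
    rw [smul_smul]
    by_cases hij : p i + p j = γ
    · congr 1
      rw [mul_right_comm, ← sgn_add, mul_comm (g⁻¹ i j), ← mul_assoc, ← sgn_add, ← hij]
      congr 2
      generalize p a = a
      generalize p b = b
      generalize p i = i
      generalize p j = j
      revert a b i j
      decide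
    · rw [hg.inv_homog _ _ hij]; simp
  rw [Finset.sum_congr rfl fun i _ => Finset.sum_congr rfl fun j _ => h5 i j]
  simp only [← Finset.smul_sum]
  rw [h3, Algebra.smul_def, ← map_mul]
  -- Where `g⁻¹ a b` is nonzero, this factor is the required `sgn k (γ * p b)`.
  by_cases hab : p a + p b = γ
  · rw [hab, CharTwo.add_self_eq_zero, mul_zero, add_zero]
  · rw [hg.inv_homog _ _ hab, mul_zero, mul_zero]

theorem isEquivariant_capMap :
    IsEquivariant p (formEqs p g γ hg.homog).natCoact (capMap g) := by
  refine isEquivariant_of_basis fun u v => ?_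
  obtain ⟨i, j, rfl⟩ := exists_two v
  rw [word_nil u]
  refine (matCoeff_expand (N := Unit) (dbv_capMap g) (b := fun _ => g i j)
    (n := fun _ => Realization.nilW (unitSh ι)) (by simpa using cap_two g i j)).2 ?_
  have h1 : ∑ x : Unit, g i j • coeff k p (formEqs p g γ hg.homog).natCoact
      (Realization.nilW (unitSh ι)).1 (Realization.nilW (unitSh ι)).1 =
      algebraMap k _ (g i j) := by
    simp [Realization.nilW, coeff, Algebra.algebraMap_eq_smul_one]
  rw [h1, ← formEqs_rel hg, Fintype.sum_prod_type]
  refine Finset.sum_congr rfl fun a _ => Finset.sum_congr rfl fun b _ => ?_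
  simp only [two, coeff_two, smul_smul, GroupEqs.natCoact]
  rw [mul_comm (g a b), mul_comm (p b)]

/-- The cap needs only the defining equations of the group; the cup needs `formEqs_dual_rel`, and
with it the two-sided inverse. -/
theorem isEquivariant_cupMap :
    IsEquivariant p (formEqs p g γ hg.homog).natCoact (cupMap p γ g) := by
  refine isEquivariant_of_basis fun u v => ?_
  obtain ⟨a, b, rfl⟩ := exists_two u
  rw [word_nil v]
  refine (matCoeff_expand (M := Unit) (a := fun _ => sgn k (γ * p b) * g⁻¹ a b)
    (m := fun _ => Realization.nilW (unitSh ι)) (by simpa using dbv_cupMap p γ g a b)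
    (cup_nil p γ g _)).2 ?_
  have h1 : ∑ x : Unit, (sgn k (γ * p b) * g⁻¹ a b) • coeff k p (formEqs p g γ hg.homog).natCoact
      (Realization.nilW (unitSh ι)).1 (Realization.nilW (unitSh ι)).1 =
      algebraMap k _ (sgn k (γ * p b) * g⁻¹ a b) := by
    simp [Realization.nilW, coeff, Algebra.algebraMap_eq_smul_one]
  rw [h1, ← formEqs_dual_rel hg, Fintype.sum_prod_type]
  refine Finset.sum_congr rfl fun i _ => Finset.sum_congr rfl fun j _ => ?_
  simp only [two, coeff_two, smul_smul, GroupEqs.natCoact]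

/-- There is no dual letter here, so the coefficients of `V` alone must generate. They do, since `Z`
is a linear combination of the `X`. -/
theorem adjoin_natCoact :
    Algebra.adjoin k (Set.range (Function.uncurry (formEqs p g γ hg.homog).natCoact)) = ⊤ := by
  have hX : ∀ i j, (formEqs p g γ hg.homog).X i j ∈
      Algebra.adjoin k (Set.range (Function.uncurry (formEqs p g γ hg.homog).natCoact)) :=
    fun i j => Algebra.subset_adjoin ⟨(i, j), rfl⟩
  refine GroupEqs.adjoin_eq_top _ hX fun l b => ?_
  have h : formInv p g (formEqs p g γ hg.homog).X l b = (formEqs p g γ hg.homog).Z l b :=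
    congrFun (congrFun (formInv_eq_Z hg) l) b
  rw [← h, formInv]
  exact sum_mem fun i _ => sum_mem fun a _ => Subalgebra.smul_mem _ (hX a i) _

end Group

/-! ### Action of the coordinates in the unoriented case -/

/-- The operators on the centraliser coalgebra by which the coordinates act. -/
def unorientedGen (g : Matrix ι ι k) {C : CatPres k Unit} (F : Realization C (unitSh ι) p) :
    Coord ι → Module.End k F.CEnd
  | .X i j => F.cmul (F.cl [i] [j])
  | .Z i j => formInv p g (fun i j => (F.cmul (F.cl [i] [j]) : Module.End k F.CEnd)) i j

theorem unorientedGen_comm (hg : IsGram p γ g) {C : CatPres k Unit}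
    (F : Realization C (unitSh ι) p) (s t : Coord ι) :
    unorientedGen g F s * unorientedGen g F t =
      sgn k (Coord.par p s * Coord.par p t) • (unorientedGen g F t * unorientedGen g F s) := by
  have flip : ∀ {a b : ZMod 2} {x y : Module.End k F.CEnd}, x * y = sgn k (a * b) • (y * x) →
      y * x = sgn k (b * a) • (x * y) := fun {a b x y} h => by
    rw [h, smul_smul, mul_comm b, sgn_mul_self, one_smul]
  -- Once the operators of `X` commute correctly with all operators, `formInv_comm` extends this
  -- from `X` to `Z` in the first argument, including the case of two operators of `Z`.
  have hX : ∀ (i j : ι) (t : Coord ι), unorientedGen g F (.X i j) * unorientedGen g F t =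
      sgn k ((p i + p j) * Coord.par p t) •
        (unorientedGen g F t * unorientedGen g F (.X i j)) := fun i j t => by
    cases t with
    | X i' j' => exact F.cmul_comm_cl i j i' j'
    | Z i' j' => exact flip (formInv_comm hg (fun a b => F.cmul_comm_cl a b i j) i' j')
  cases s with
  | X i j => exact hX i j t
  | Z i j => exact formInv_comm hg (fun a b => hX a b t) i j

variable (hg : IsGram p γ g) {δ : k} (hδ : ∑ i, sgn k (p i) = δ)

/-- This is the coalgebra relation of the cap. On the support of `g` the composite operators carry
the common sign `(γ + [i] + [j])|u|`, which is trivial where `g i j` is nonzero. -/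
theorem unorientedGen_form (i j : ι) :
    ∑ a, ∑ b, (sgn k (p b * (p a + p i)) * g a b) •
      (unorientedGen g (brauerFunctor p γ δ g hg hδ) (.X a i) *
        unorientedGen g (brauerFunctor p γ δ g hg hδ) (.X b j)) =
      algebraMap k _ (g i j) := by
  set F := brauerFunctor p γ δ g hg hδ with hF
  refine F.cend_ext_cl fun Y u v => ?_
  have e1 : ∀ a b, ((sgn k (p b * (p a + p i)) * g a b) • (unorientedGen g F (.X a i) *
      unorientedGen g F (.X b j))) (F.cl u.1 v.1) = sgn k ((γ + p i + p j) * u.par p) •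
        g a b • F.cl (a :: b :: u.1) (i :: j :: v.1) := fun a b => by
    by_cases hab : p a + p b = γ
    · have e2 := F.cmul_cl_cons (a := a) (b := i) rfl ((Realization.one b rfl).append u)
        ((Realization.one j rfl).append v)
      simp only [Word.append, Realization.one, List.singleton_append] at e2
      rw [LinearMap.smul_apply, Module.End.mul_apply, unorientedGen, unorientedGen,
        F.cmul_cl_cons (a := b) (b := j) rfl u v, map_smul, e2, smul_smul, smul_smul, smul_smul,
        mul_right_comm _ (g a b), mul_right_comm _ (g a b), ← sgn_add, ← sgn_add]
      congr 3
      rw [← hab]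
      simp only [Word.par, List.map_cons, List.sum_cons]
      generalize (u.1.map p).sum = d
      generalize p i = i
      generalize p j = j
      generalize p a = a
      generalize p b = b
      revert a b i j d
      decide
    · rw [hg.homog _ _ hab]; simp
  have e3 := F.cl_elem (N := Unit) (.of BrauerGen.cap) (y := two i j) (dbv_capMap g)
    (b := fun _ => g i j) (n := fun _ => Realization.nilW (unitSh ι))
    (by rw [Fintype.sum_unique]; exact cap_two g i j) u v
  simp only [two, Realization.nilW, List.cons_append, List.nil_append,
    Finset.univ_unique, Finset.sum_singleton, Fintype.sum_prod_type] at e3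
  simp only [LinearMap.sum_apply, e1, ← Finset.smul_sum]
  rw [e3, Module.algebraMap_end_apply]
  by_cases hij : p i + p j = γ
  · rw [add_assoc, hij, CharTwo.add_self_eq_zero, zero_mul, sgn_zero, one_smul]
  · rw [hg.homog _ _ hij]; simp

/-- The parity `γ` of the form is kept general, so `OSp(V)` and `Pe(V)` are handled by one argument.
-/
theorem phiIsIso_brauerFunctor : PhiIsIso (brauerFunctor p γ δ g hg hδ)
    (formEqs p g γ hg.homog) (formEqs p g γ hg.homog).natCoact := by
  set F := brauerFunctor p γ δ g hg hδ with hF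
  set G := formEqs p g γ hg.homog with hG
  let L : G.O →ₐ[k] Module.End k F.CEnd := G.pres.lift (unorientedGen g F)
    (unorientedGen_comm hg F) fun r hr => hr.elim
      (by
        rintro ⟨i, l, rfl⟩
        rw [map_sub, sub_eq_zero, map_sum, AlgHom.commutes]
        simp only [map_mul, FreeAlgebra.lift_ι_apply]
        -- The relation `ZX = 1` for the operators follows from the equations of the form by
        -- `formInv_mul`, now applied in the endomorphism algebra.
        refine (formInv_mul hg (unorientedGen_form hg hδ) i l).trans ?_
        split_ifs <;> simp)
      (by
        rintro ⟨i, j, rfl⟩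
        rw [map_sub, sub_eq_zero, AlgHom.commutes]
        simp only [map_sum, map_smul, map_mul, FreeAlgebra.lift_ι_apply]
        exact unorientedGen_form hg hδ i j)
  refine phiIsIso_of_action F G.X_mem (fun _ _ h => (h rfl).elim) ?_ (fun a b => ?_) G.comul_X
    (adjoin_natCoact hg) L fun i j => G.pres.lift_gen _ _ _ (.X i j)
  · rintro (_ | _)
    · exact isEquivariant_capMap hg
    · exact isEquivariant_cupMap hg
  · rw [Finsupp.single_apply]
    exact G.counit_X a b

end Unoriented

/-! ### The groups `GL(V)` and `Q(V)` -/

section Conclusion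

variable {k : Type u} [Field k] {V : Type w} [AddCommGroup V] [Module k V]
  {𝒱 : ZMod 2 → Submodule k V} {ι : Type v} [Fintype ι] [DecidableEq ι] (b : HomogBasis 𝒱 ι)

/-- With no additional endomorphisms and no further equations, both conditions are vacuous. -/
theorem phiIsIso_obFun : PhiIsIso b.obFun (glEqs k b.par) (glEqs k b.par).dualCoact :=
  phiIsIso_obFunctor _ _ _ _ (fun a => a.elim) fun _ h => h.elim

/-- The equations of `Q(V)` are used twice: as identities in `𝒪[G]` for the equivariance of `q`, and
as relations to be verified for the operators by `orientedGen_endo`. -/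
theorem phiIsIso_obcFun [DirectSum.Decomposition 𝒱] (q : OddInvolution 𝒱) :
    PhiIsIso (q.obcFun b) (q.group b) (q.group b).dualCoact := by
  refine phiIsIso_obFunctor (q.group b) _ _ _ (fun _ i l => ?_) ?_
  · have := (q.group b).pres.quo_rel (Or.inr ⟨i, l, rfl⟩)
    rw [map_sub, sub_eq_zero] at this
    simp only [map_sum, map_smul] at this
    exact this
  · rintro _ ⟨i, l, rfl⟩
    rw [map_sub, sub_eq_zero]
    simp only [map_sum, map_smul, FreeAlgebra.lift_ι_apply]
    exact orientedGen_endo _ _ _ () i l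

end Conclusion

end SuperBrauer

end

theorem mainTheorem8 {k : Type*} [Field k] [IsAlgClosed k]
    {V : Type*} [AddCommGroup V] [Module k V]
    (𝒱 : ZMod 2 → Submodule k V) [DirectSum.Decomposition 𝒱]
    {ι : Type*} [Fintype ι] [DecidableEq ι] (b : SuperBrauer.HomogBasis 𝒱 ι) :
    (∀ B : SuperBrauer.SuperForm 𝒱 0,
      SuperBrauer.PhiIsIso (B.brauerFun b) (B.group b) (B.group b).natCoact) ∧
    SuperBrauer.PhiIsIso b.obFun (SuperBrauer.glEqs k b.par)
      (SuperBrauer.glEqs k b.par).dualCoact ∧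
    (∀ B : SuperBrauer.SuperForm 𝒱 1,
      SuperBrauer.PhiIsIso (B.periplecticFun b) (B.group b) (B.group b).natCoact) ∧
    (∀ q : SuperBrauer.OddInvolution 𝒱,
      SuperBrauer.PhiIsIso (q.obcFun b) (q.group b) (q.group b).dualCoact) := by
  -- For an even form the loop value is the super dimension by definition. For an odd form it is
  -- `0`, which `sdim_odd` shows to be the super dimension.
  exact ⟨fun B => SuperBrauer.phiIsIso_brauerFunctor (B.isGram b) rfl,
    SuperBrauer.phiIsIso_obFun b,
    fun B => SuperBrauer.phiIsIso_brauerFunctor (B.isGram b) (B.sdim_odd b),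
    fun q => SuperBrauer.phiIsIso_obcFun b q⟩
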